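/- An \emph{Orlicz function} is an even convex function $M:\mathbb R\to\mathbb R$ with $M(0)=0$ which is not identically zero. For $1\le p,q<\infty$ it is called \emph{$p$-convex} if $t\mapsto M(t^{1/p})$ is convex on $(0,\infty)$, and \emph{$q$-concave} if $t\mapsto M(t^{1/q})$ is concave on $(0,\infty)$. Two Orlicz functions $M,N$ are \emph{equivalent on $[0,1]$} if $C^{-1}M(t)\le N(t)\le C\,M(t)$ for some $C>0$ and all $t\in[0,1]$. The Orlicz sequence space $l_M$ consists of all bounded complex sequences $x=(x(k))_{k\ge0}$ with $\sum_k M(|x(k)|/\lambda)<\infty$ for some $\lambda>0$, with the norm $\|x\|_{l_M}=\inf\{\lambda>0:\sum_k M(|x(k)|/\lambda)\le 1\}$. Let $H$ be an infinite-dimensional separable complex Hilbert space. For a bounded operator $A$ on $H$ let $\mu(A)=(\mu(k,A))_{k\ge0}$, $\mu(k,A)=\inf\{\|A(1-P)\|: P \text{ an orthogonal projection of rank at most } k\}$, be its sequence of singular values. The Orlicz ideal is $\mathcal L_M(H)=\{A\in\mathcal L(H):\mu(A)\in l_M\}$, with the norm $\|A\|_{\mathcal L_M}=\|\mu(A)\|_{l_M}$.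 Let $E$ be $l_M$ or $\mathcal L_M(H)$, and let $|x|$ and powers be computed coordinatewise in $l_M$ and by functional calculus, with $|x|=(x^*x)^{1/2}$, in $\mathcal L_M(H)$. The space $E$ is \emph{$p$-convex} (\emph{$q$-concave}) if there is a constant $C>0$ such that for all finite families $(x_k)$ in $E$ $$\Big\|\Big(\sum_k|x_k|^p\Big)^{1/p}\Big\|_E\le C\Big(\sum_k\|x_k\|_E^p\Big)^{1/p}\qquad\text{respectively}\qquad \Big(\sum_k\|x_k\|_E^q\Big)^{1/q}\le C\Big\|\Big(\sum_k|x_k|^q\Big)^{1/q}\Big\|_E .$$ It satisfies an \emph{upper $p$-estimate} (a \emph{lower $q$-estimate}) if there is a constant $K>0$ such that for all finite families $(x_k)$ of pairwise disjoint elements of $E$ $$\Big\|\sum_k x_k\Big\|_E\le K\Big(\sum_k\|x_k\|_E^p\Big)^{1/p}\qquad\text{respectively}\qquad \Big(\sum_k\|x_k\|_E^q\Big)^{1/q}\le K\Big\|\sum_k x_k\Big\|_E ,$$ where sequences are disjoint if their supports are disjoint, and operators $x,y$ are disjoint if $r(x)r(y)=0$, $r(x)$ being the orthogonal projection onto $(\ker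 x)^\perp$. \textbf{Theorem.} Let $1\le p\le 2\le q<\infty$ and let $M$ be an Orlicz function. The following conditions are equivalent: (i) $\mathcal L_M(H)$ is $p$-convex and $q$-concave; (ii) $\mathcal L_M(H)$ satisfies an upper $p$-estimate and a lower $q$-estimate; (iii) $l_M$ is $p$-convex and $q$-concave; (iv) $l_M$ satisfies an upper $p$-estimate and a lower $q$-estimate; (v) $M$ is equivalent on $[0,1]$ to some Orlicz function that is both $p$-convex and $q$-concave. -/

import Mathlib

open scoped InnerProductSpace

noncomputable section

/-! ### Orlicz functions -/

/-- An Orlicz function: an even convex function `M : ℝ → ℝ` with `M 0 = 0`, not identically zero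
(otherwise the associated Luxemburg functional vanishes identically and is not a norm). -/
structure IsOrliczFunction (M : ℝ → ℝ) : Prop where
  even : ∀ t, M (-t) = M t
  convex : ConvexOn ℝ Set.univ M
  map_zero : M 0 = 0
  nontrivial : ∃ t, M t ≠ 0

/-- `M` is `p`-convex: `t ↦ M (t ^ (1 / p))` is convex on `(0, ∞)`. -/
def IsPConvexFunction (p : ℝ) (M : ℝ → ℝ) : Prop :=
  ConvexOn ℝ (Set.Ioi 0) (fun t : ℝ => M (t ^ (1 / p)))

/-- `M` is `q`-concave: `t ↦ M (t ^ (1 / q))` is concave on `(0, ∞)`. -/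
def IsQConcaveFunction (q : ℝ) (M : ℝ → ℝ) : Prop :=
  ConcaveOn ℝ (Set.Ioi 0) (fun t : ℝ => M (t ^ (1 / q)))

/-- Equivalence of two functions on `[0, 1]`. -/
def EquivOnUnitInterval (M₁ M₂ : ℝ → ℝ) : Prop :=
  ∃ C : ℝ, 0 < C ∧ ∀ t ∈ Set.Icc (0 : ℝ) 1, C⁻¹ * M₁ t ≤ M₂ t ∧ M₂ t ≤ C * M₁ t

/-! ### The Orlicz sequence space `l_M` -/

/-- Membership in `l_M`: the bounded complex sequences `x` such that `M (|x| / r)` is summable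
for some `r > 0`. -/
def MemOrliczSeq (M : ℝ → ℝ) (x : ℕ → ℂ) : Prop :=
  BddAbove (Set.range fun k => ‖x k‖) ∧ ∃ r : ℝ, 0 < r ∧ Summable (fun k => M (‖x k‖ / r))

/-- The (Luxemburg) norm of `l_M`. -/
def orliczSeqNorm (M : ℝ → ℝ) (x : ℕ → ℂ) : ℝ :=
  sInf {r : ℝ | 0 < r ∧ Summable (fun k => M (‖x k‖ / r)) ∧ ∑' k, M (‖x k‖ / r) ≤ 1}

/-- The sequence `(∑ |x_k| ^ s) ^ (1 / s)`, computed coordinatewise. -/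
def seqPowerSum (s : ℝ) {n : ℕ} (x : Fin n → ℕ → ℂ) : ℕ → ℂ :=
  fun i => (((∑ k, ‖x k i‖ ^ s) ^ (1 / s) : ℝ) : ℂ)

/-- The Banach lattice `l_M` is `p`-convex. -/
def OrliczSeqPConvex (M : ℝ → ℝ) (p : ℝ) : Prop :=
  ∃ C : ℝ, 0 < C ∧ ∀ (n : ℕ) (x : Fin n → ℕ → ℂ), (∀ k, MemOrliczSeq M (x k)) →
    MemOrliczSeq M (seqPowerSum p x) ∧
      orliczSeqNorm M (seqPowerSum p x) ≤ C * (∑ k, orliczSeqNorm M (x k) ^ p) ^ (1 / p)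

/-- The Banach lattice `l_M` is `q`-concave. -/
def OrliczSeqQConcave (M : ℝ → ℝ) (q : ℝ) : Prop :=
  ∃ C : ℝ, 0 < C ∧ ∀ (n : ℕ) (x : Fin n → ℕ → ℂ), (∀ k, MemOrliczSeq M (x k)) →
    MemOrliczSeq M (seqPowerSum q x) ∧
      (∑ k, orliczSeqNorm M (x k) ^ q) ^ (1 / q) ≤ C * orliczSeqNorm M (seqPowerSum q x)

/-- The sequences `x` and `y` are disjointly supported. -/
def SeqDisjoint (x y : ℕ → ℂ) : Prop :=
  ∀ i, x i = 0 ∨ y i = 0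

/-- The Banach lattice `l_M` satisfies an upper `p`-estimate. -/
def OrliczSeqUpperEstimate (M : ℝ → ℝ) (p : ℝ) : Prop :=
  ∃ K : ℝ, 0 < K ∧ ∀ (n : ℕ) (x : Fin n → ℕ → ℂ), (∀ k, MemOrliczSeq M (x k)) →
    (∀ j k, j ≠ k → SeqDisjoint (x j) (x k)) →
    MemOrliczSeq M (∑ k, x k) ∧
      orliczSeqNorm M (∑ k, x k) ≤ K * (∑ k, orliczSeqNorm M (x k) ^ p) ^ (1 / p)

/-- The Banach lattice `l_M` satisfies a lower `q`-estimate. -/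
def OrliczSeqLowerEstimate (M : ℝ → ℝ) (q : ℝ) : Prop :=
  ∃ K : ℝ, 0 < K ∧ ∀ (n : ℕ) (x : Fin n → ℕ → ℂ), (∀ k, MemOrliczSeq M (x k)) →
    (∀ j k, j ≠ k → SeqDisjoint (x j) (x k)) →
    MemOrliczSeq M (∑ k, x k) ∧
      (∑ k, orliczSeqNorm M (x k) ^ q) ^ (1 / q) ≤ K * orliczSeqNorm M (∑ k, x k)

/-! ### The Orlicz ideal `𝓛_M(H)` -/

section Operators

variable {H : Type*} [NormedAddCommGroup H] [InnerProductSpace ℂ H] [CompleteSpace H]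

/-- The singular values `μ(k, A) = inf {‖A (1 - P)‖ : P an orthogonal projection, Tr P ≤ k}` of a
bounded operator `A`. The trace of an orthogonal projection is its rank. For compact `A` this is
the decreasing sequence of the eigenvalues of `|A|`, counted with multiplicities. -/
def singularValue (A : H →L[ℂ] H) (k : ℕ) : ℝ :=
  sInf {r : ℝ | ∃ P : H →L[ℂ] H, IsStarProjection P ∧
    LinearMap.rank (P : H →ₗ[ℂ] H) ≤ (k : Cardinal) ∧ r = ‖A * (1 - P)‖}

/-- The singular values, as a complex sequence. -/
def singularSeq (A : H →L[ℂ] H) : ℕ → ℂ :=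
  fun k => (singularValue A k : ℂ)

/-- Membership in the Orlicz ideal `𝓛_M(H)`. -/
def MemOrliczIdeal (M : ℝ → ℝ) (A : H →L[ℂ] H) : Prop :=
  MemOrliczSeq M (singularSeq A)

/-- The norm of the Orlicz ideal `𝓛_M(H)`. -/
def orliczIdealNorm (M : ℝ → ℝ) (A : H →L[ℂ] H) : ℝ :=
  orliczSeqNorm M (singularSeq A)

/-- The operator `(∑ |x_k| ^ s) ^ (1 / s)`, through the continuous functional calculus. -/
def opPowerSum (s : ℝ) {n : ℕ} (x : Fin n → H →L[ℂ] H) : H →L[ℂ] H :=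
  CFC.rpow (∑ k, CFC.rpow (CFC.abs (x k)) s) (1 / s)

/-- The right support projection of `x`: the projection onto the orthogonal complement of the
kernel of `x`. -/
def rightSupport (x : H →L[ℂ] H) : H →L[ℂ] H :=
  (LinearMap.ker (x : H →ₗ[ℂ] H))ᗮ.starProjection

/-- `x` and `y` are left disjointly supported: `r(x) r(y) = 0`. -/
def LeftDisjoint (x y : H →L[ℂ] H) : Prop :=
  rightSupport x * rightSupport y = 0

end Operators

section Ideal

variable (H : Type*) [NormedAddCommGroup H] [InnerProductSpace ℂ H] [CompleteSpace H]

/-- The Orlicz ideal `𝓛_M(H)` is `p`-convex. -/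
def OrliczIdealPConvex (M : ℝ → ℝ) (p : ℝ) : Prop :=
  ∃ C : ℝ, 0 < C ∧ ∀ (n : ℕ) (x : Fin n → H →L[ℂ] H), (∀ k, MemOrliczIdeal M (x k)) →
    MemOrliczIdeal M (opPowerSum p x) ∧
      orliczIdealNorm M (opPowerSum p x) ≤ C * (∑ k, orliczIdealNorm M (x k) ^ p) ^ (1 / p)

/-- The Orlicz ideal `𝓛_M(H)` is `q`-concave. -/
def OrliczIdealQConcave (M : ℝ → ℝ) (q : ℝ) : Prop :=
  ∃ C : ℝ, 0 < C ∧ ∀ (n : ℕ) (x : Fin n → H →L[ℂ] H), (∀ k, MemOrliczIdeal M (x k)) →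
    MemOrliczIdeal M (opPowerSum q x) ∧
      (∑ k, orliczIdealNorm M (x k) ^ q) ^ (1 / q) ≤ C * orliczIdealNorm M (opPowerSum q x)

/-- The Orlicz ideal `𝓛_M(H)` satisfies an upper `p`-estimate. -/
def OrliczIdealUpperEstimate (M : ℝ → ℝ) (p : ℝ) : Prop :=
  ∃ K : ℝ, 0 < K ∧ ∀ (n : ℕ) (x : Fin n → H →L[ℂ] H), (∀ k, MemOrliczIdeal M (x k)) →
    (∀ j k, j ≠ k → LeftDisjoint (x j) (x k)) →
    MemOrliczIdeal M (∑ k, x k) ∧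
      orliczIdealNorm M (∑ k, x k) ≤ K * (∑ k, orliczIdealNorm M (x k) ^ p) ^ (1 / p)

/-- The Orlicz ideal `𝓛_M(H)` satisfies a lower `q`-estimate. -/
def OrliczIdealLowerEstimate (M : ℝ → ℝ) (q : ℝ) : Prop :=
  ∃ K : ℝ, 0 < K ∧ ∀ (n : ℕ) (x : Fin n → H →L[ℂ] H), (∀ k, MemOrliczIdeal M (x k)) →
    (∀ j k, j ≠ k → LeftDisjoint (x j) (x k)) →
    MemOrliczIdeal M (∑ k, x k) ∧
      (∑ k, orliczIdealNorm M (x k) ^ q) ^ (1 / q) ≤ K * orliczIdealNorm M (∑ k, x k)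

end Ideal

end

/-! Every condition is equivalent to two-sided power growth of `M` on `(0, 1]`: `M (s t) ≤ C s ^ p M
t` and `s ^ q M t ≤ C M (s t)`.

Necessity is tested on indicators of blocks, or on projections onto spans of basis vectors. If `φ k`
is the norm of a sum of `k` unit atoms, each of the conditions on `l_M` or on the ideal yields `φ (n
m) ≲ m ^ (1/p) φ n` and `m ^ (1/q) φ n ≲ φ (n m)`. Since `M (1 / φ k) = 1 / k`, these are growth
bounds for `M` (`growth_of_fundamental`). A supremum of power kernels then produces a density `d`
with `d s / s ^ (p-1)` increasing and `d s / s ^ (q-1)` decreasing. Its primitive `N` is equivalent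
to `M`, `p`-convex and `q`-concave (`HasPowerGrowth.exists_isPowerDensity`).

Sufficiency is proved for modulars of `N`. With weights `(l k / L) ^ p` of total mass at most one,
an inequality between the modular of a combination at `L` and the weighted modulars of the `x k` at
`l k` turns into a norm inequality (`norm_le_of_modular_upper`, `norm_le_of_modular_lower`). For
sequences the modular inequality is Jensen at each coordinate. For `(∑ |x k| ^ p) ^ (1/p)` in the
ideal, it is Jensen in an eigenbasis of `∑ |x k| ^ p`, followed by the trace inequality `∑ F ⟪e i, Y
e i⟫ ≤ ∑ F (t j)` for convex `F` and the eigenvalues `t j` of `Y`, reversed for concave `F`.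

For left disjoint operators put `S = ∑ x k` and `P k = r (x k)`, so that `x k = S P k` with
orthogonal `P k`. The identity `‖S v‖ ^ 2 = ∑ s i ^ 2 |⟪e i, v⟫| ^ 2` and Jensen give pinching
inequalities for the Schatten power sums, in one direction for exponents `≥ 2` and in the other for
exponents `≤ 2`; this is where `p ≤ 2 ≤ q` enters. They pass to `N` because `N` is a superposition
of the functions `(t ^ p - u ^ p)₊` and also of the functions `min t u ^ q`. Both are handled by
cutting the singular values at a threshold (`tsum_excess_le`, `tsum_truncation_le`). -/

section OrliczIdeals

open Set Filter Topology MeasureTheory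
open scoped ENNReal NNReal InnerProductSpace

/-! ### Elementary properties of Orlicz functions -/

namespace IsOrliczFunction

variable {M : ℝ → ℝ}

lemma nonneg (hM : IsOrliczFunction M) (t : ℝ) : 0 ≤ M t := by
  have h : M ((1 / 2 : ℝ) • t + (1 / 2 : ℝ) • (-t)) ≤ (1 / 2 : ℝ) • M t + (1 / 2 : ℝ) • M (-t) :=
    hM.convex.2 (mem_univ t) (mem_univ (-t)) (by norm_num) (by norm_num) (by norm_num)
  have h0 : (1 / 2 : ℝ) • t + (1 / 2 : ℝ) • (-t) = 0 := by simp
  rw [h0, hM.map_zero, hM.even] at h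
  simp only [smul_eq_mul] at h
  linarith

lemma map_mul_le (hM : IsOrliczFunction M) {c : ℝ} (h0 : 0 ≤ c) (h1 : c ≤ 1) (t : ℝ) :
    M (c * t) ≤ c * M t := by
  have h := hM.convex.2 (mem_univ t) (mem_univ 0) h0 (sub_nonneg.2 h1) (by ring)
  simpa [hM.map_zero] using h

lemma mono (hM : IsOrliczFunction M) {s t : ℝ} (hs : 0 ≤ s) (hst : s ≤ t) : M s ≤ M t := by
  rcases eq_or_lt_of_le (hs.trans hst) with ht | ht
  · rw [le_antisymm (hst.trans ht.symm.le) hs, ← ht]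
  · have h := hM.map_mul_le (div_nonneg hs ht.le) (div_le_one_of_le₀ hst ht.le) t
    rw [div_mul_cancel₀ _ ht.ne'] at h
    exact h.trans (mul_le_of_le_one_left (hM.nonneg t) (div_le_one_of_le₀ hst ht.le))

lemma continuous (hM : IsOrliczFunction M) : Continuous M :=
  continuousOn_univ.1 (hM.convex.continuousOn isOpen_univ)

/-- Convexity with `M 0 = 0` gives `M (k t) ≥ k M t` for integers `k ≥ 1`, so `M` is unbounded as
soon as it is nonzero. -/
lemma exists_gt (hM : IsOrliczFunction M) (b : ℝ) : ∃ T : ℝ, 1 ≤ T ∧ b < M T := by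
  obtain ⟨t, ht⟩ := hM.nontrivial
  have hpos : 0 < M |t| := by
    rcases abs_choice t with h | h <;> rw [h]
    · exact lt_of_le_of_ne (hM.nonneg t) ht.symm
    · rw [hM.even]; exact lt_of_le_of_ne (hM.nonneg t) ht.symm
  obtain ⟨m, hm⟩ := exists_nat_gt (b / M |t|)
  have hm1 : (1 : ℝ) ≤ (m + 1 : ℝ) := by simp
  have h := hM.map_mul_le (c := 1 / (m + 1 : ℝ)) (by positivity)
    (div_le_one_of_le₀ hm1 (by positivity)) ((m + 1) * |t|)
  rw [← mul_assoc, one_div, inv_mul_cancel₀ (by positivity), one_mul,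
    inv_mul_eq_div, le_div_iff₀ (by positivity)] at h
  refine ⟨max 1 ((m + 1) * |t|), le_max_left _ _, ?_⟩
  refine lt_of_lt_of_le ?_ (hM.mono (by positivity) (le_max_right _ _))
  rw [div_lt_iff₀ hpos] at hm
  nlinarith

end IsOrliczFunction

/-! ### Modulars, and the passage from modular to norm inequalities -/

/-- The modular `∑ N (|x k| / r)` of a sequence, as an extended nonnegative real. -/
noncomputable def modular (N : ℝ → ℝ) (x : ℕ → ℂ) (r : ℝ) : ℝ≥0∞ :=
  ∑' k, ENNReal.ofReal (N (‖x k‖ / r))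

section Modular

variable {M N : ℝ → ℝ}

lemma summable_of_tsum_ofReal_ne_top {ι : Type*} {f : ι → ℝ} (hf : ∀ i, 0 ≤ f i)
    (h : ∑' i, ENNReal.ofReal (f i) ≠ ⊤) : Summable f := by
  have := ENNReal.summable_toReal h
  simpa [ENNReal.toReal_ofReal (hf _)] using this

lemma modular_ne_top_iff (hN : IsOrliczFunction N) {x : ℕ → ℂ} {r : ℝ} :
    modular N x r ≠ ⊤ ↔ Summable fun k => N (‖x k‖ / r) := by
  refine ⟨summable_of_tsum_ofReal_ne_top fun _ => hN.nonneg _, fun h => ?_⟩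
  rw [modular, ← ENNReal.ofReal_tsum_of_nonneg (fun _ => hN.nonneg _) h]
  exact ENNReal.ofReal_ne_top

lemma modular_le_one_iff (hN : IsOrliczFunction N) {x : ℕ → ℂ} {r : ℝ} :
    modular N x r ≤ 1 ↔
      (Summable fun k => N (‖x k‖ / r)) ∧ ∑' k, N (‖x k‖ / r) ≤ 1 := by
  constructor
  · intro h
    have hs := (modular_ne_top_iff hN).1 (ne_top_of_le_ne_top ENNReal.one_ne_top h)
    refine ⟨hs, ?_⟩
    rwa [modular, ← ENNReal.ofReal_tsum_of_nonneg (fun _ => hN.nonneg _) hs,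
      ENNReal.ofReal_le_one] at h
  · rintro ⟨hs, h⟩
    rwa [modular, ← ENNReal.ofReal_tsum_of_nonneg (fun _ => hN.nonneg _) hs,
      ENNReal.ofReal_le_one]

/-- Dilation by `c` gains a factor `1 / c`. Constants in front of modulars can therefore be traded
for constants in front of norms. -/
lemma modular_mul_le (hN : IsOrliczFunction N) (x : ℕ → ℂ) {c : ℝ} (hc : 1 ≤ c) (r : ℝ) :
    modular N x (c * r) ≤ ENNReal.ofReal c⁻¹ * modular N x r := by
  rw [modular, modular, ← ENNReal.tsum_mul_left]
  refine ENNReal.tsum_le_tsum fun k => ?_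
  rw [← ENNReal.ofReal_mul (by positivity)]
  refine ENNReal.ofReal_le_ofReal ?_
  have h := hN.map_mul_le (c := c⁻¹) (by positivity) (inv_le_one_of_one_le₀ hc) (‖x k‖ / r)
  rwa [show c⁻¹ * (‖x k‖ / r) = ‖x k‖ / (c * r) by rw [inv_mul_eq_div, div_div, mul_comm r]] at h

lemma modular_anti (hN : IsOrliczFunction N) (x : ℕ → ℂ) {r s : ℝ} (hr : 0 < r) (hrs : r ≤ s) :
    modular N x s ≤ modular N x r := by
  refine ENNReal.tsum_le_tsum fun k => ENNReal.ofReal_le_ofReal (hN.mono ?_ ?_)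
  · have := hr.trans_le hrs; positivity
  · gcongr

lemma exists_modular_le_one (hN : IsOrliczFunction N) {x : ℕ → ℂ} {r : ℝ} (hr : 0 < r)
    (h : modular N x r ≠ ⊤) : ∃ s, 0 < s ∧ modular N x s ≤ 1 := by
  set c := max 1 (modular N x r).toReal
  have hc : 1 ≤ c := le_max_left _ _
  have hc0 : 0 < c := zero_lt_one.trans_le hc
  refine ⟨c * r, by positivity, (modular_mul_le hN x hc r).trans ?_⟩
  rw [← ENNReal.ofReal_toReal h, ← ENNReal.ofReal_mul (by positivity), ENNReal.ofReal_le_one,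
    inv_mul_le_iff₀ hc0, mul_one]
  exact le_max_right _ _

lemma memOrliczSeq_iff (hN : IsOrliczFunction N) {x : ℕ → ℂ} :
    MemOrliczSeq N x ↔
      BddAbove (range fun k => ‖x k‖) ∧ ∃ r : ℝ, 0 < r ∧ modular N x r ≤ 1 := by
  refine and_congr_right fun _ => ⟨?_, ?_⟩
  · rintro ⟨r, hr, h⟩
    exact exists_modular_le_one hN hr ((modular_ne_top_iff hN).2 h)
  · rintro ⟨r, hr, h⟩
    exact ⟨r, hr, ((modular_le_one_iff hN).1 h).1⟩

lemma orliczSeqNorm_eq (hN : IsOrliczFunction N) (x : ℕ → ℂ) :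
    orliczSeqNorm N x = sInf {r : ℝ | 0 < r ∧ modular N x r ≤ 1} := by
  simp only [orliczSeqNorm, modular_le_one_iff hN]

lemma orliczSeqNorm_nonneg (N : ℝ → ℝ) (x : ℕ → ℂ) : 0 ≤ orliczSeqNorm N x :=
  Real.sInf_nonneg fun _ h => h.1.le

lemma orliczSeqNorm_le (hN : IsOrliczFunction N) {x : ℕ → ℂ} {r : ℝ} (hr : 0 < r)
    (h : modular N x r ≤ 1) : orliczSeqNorm N x ≤ r := by
  rw [orliczSeqNorm_eq hN]
  exact csInf_le ⟨0, fun _ h => h.1.le⟩ ⟨hr, h⟩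

lemma modular_le_one_of_norm_lt (hN : IsOrliczFunction N) {x : ℕ → ℂ} (hx : MemOrliczSeq N x)
    {r : ℝ} (h : orliczSeqNorm N x < r) : modular N x r ≤ 1 := by
  rw [orliczSeqNorm_eq hN] at h
  obtain ⟨s, ⟨hs, hs1⟩, hsr⟩ := exists_lt_of_csInf_lt ((memOrliczSeq_iff hN).1 hx).2 h
  exact (modular_anti hN x hs hsr.le).trans hs1

lemma norm_le_of_modular_le_one (hN : IsOrliczFunction N) {x : ℕ → ℂ} {r T : ℝ}
    (h : modular N x r ≤ 1) (hT0 : 0 ≤ T) (hT : 1 < N T) (k : ℕ) : ‖x k‖ / r ≤ T := by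
  by_contra! hlt
  have h1 : ENNReal.ofReal (N (‖x k‖ / r)) ≤ 1 := (ENNReal.le_tsum k).trans h
  rw [ENNReal.ofReal_le_one] at h1
  exact absurd (hT.trans_le (hN.mono hT0 hlt.le)) (not_lt.2 h1)

/-- `DominatesModular N M D`: the modular unit ball of `N` is contained in `D` times that
of `M`. -/
def DominatesModular (N M : ℝ → ℝ) (D : ℝ) : Prop :=
  ∀ (x : ℕ → ℂ) (r : ℝ), 0 < r → modular N x r ≤ 1 → modular M x (D * r) ≤ 1

/-- A comparison on `[0, 1]` suffices: modular at most one forces every entry below a `T` with `N T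
> 1`, so dilating by `T` brings all arguments into `[0, 1]`. A further dilation by `c` absorbs the
constant of the comparison. -/
lemma exists_dominatesModular (hM : IsOrliczFunction M) (hN : IsOrliczFunction N) {C : ℝ}
    (h : ∀ t ∈ Icc (0 : ℝ) 1, M t ≤ C * N t) :
    ∃ D : ℝ, 0 < D ∧ DominatesModular N M D := by
  obtain ⟨T, hT1, hT⟩ := hN.exists_gt 1
  set c := max 1 C
  have hc : 1 ≤ c := le_max_left _ _
  refine ⟨c * T, by positivity, fun x r hr hx => ?_⟩
  rw [mul_assoc]
  refine (modular_mul_le hM x hc _).trans ?_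
  have h1 : modular M x (T * r) ≤ ENNReal.ofReal c * modular N x r := by
    rw [modular, modular, ← ENNReal.tsum_mul_left]
    refine ENNReal.tsum_le_tsum fun k => ?_
    rw [← ENNReal.ofReal_mul (by positivity)]
    refine ENNReal.ofReal_le_ofReal ?_
    have hT0 : 0 < T := zero_lt_one.trans_le hT1
    have hk := norm_le_of_modular_le_one hN hx hT0.le hT k
    have hle : ‖x k‖ / (T * r) ≤ ‖x k‖ / r := by
      gcongr; exact le_mul_of_one_le_left hr.le hT1
    have h2 : ‖x k‖ / (T * r) ≤ 1 := by
      rw [mul_comm T, ← div_div, div_le_one hT0]; exact hk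
    calc M (‖x k‖ / (T * r)) ≤ C * N (‖x k‖ / (T * r)) := h _ ⟨by positivity, h2⟩
      _ ≤ c * N (‖x k‖ / (T * r)) := by
          gcongr; exacts [hN.nonneg _, le_max_right _ _]
      _ ≤ c * N (‖x k‖ / r) := by gcongr; exact hN.mono (by positivity) hle
  calc ENNReal.ofReal c⁻¹ * modular M x (T * r)
      ≤ ENNReal.ofReal c⁻¹ * (ENNReal.ofReal c * 1) := by gcongr; exact h1.trans (by gcongr)
    _ = 1 := by
        rw [mul_one, ← ENNReal.ofReal_mul (by positivity), inv_mul_cancel₀ (by positivity),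
          ENNReal.ofReal_one]

/-- Take `l k` proportional to a number slightly above the norm of `x k`. Each modular on the right
is then at most one, the weights sum to at most one, and the modular of `S` is at most one. -/
lemma norm_le_of_modular_upper (hM : IsOrliczFunction M)
    {D₁ D₂ C p : ℝ} (hD₁ : 0 < D₁) (hD₂ : 0 < D₂) (hC : 0 < C) (hp : 1 ≤ p)
    (h₁ : DominatesModular N M D₁) (h₂ : DominatesModular M N D₂) {n : ℕ}
    {x : Fin n → ℕ → ℂ} {S : ℕ → ℂ} (hx : ∀ k, MemOrliczSeq M (x k))
    (hS : BddAbove (range fun k => ‖S k‖))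
    (h : ∀ (l : Fin n → ℝ) (L : ℝ), (∀ k, 0 < l k) → 0 < L → ∑ k, (l k / L) ^ p ≤ 1 →
      modular N S (C * L) ≤ ∑ k, ENNReal.ofReal ((l k / L) ^ p) * modular N (x k) (l k)) :
    MemOrliczSeq M S ∧
      orliczSeqNorm M S ≤ D₁ * C * D₂ * (∑ k, orliczSeqNorm M (x k) ^ p) ^ (1 / p) := by
  have hp0 : 0 < p := zero_lt_one.trans_le hp
  have key : ∀ L, (∑ k, orliczSeqNorm M (x k) ^ p) ^ (1 / p) < L →
      modular M S (D₁ * (C * (D₂ * L))) ≤ 1 := by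
    intro L hL
    have hsum0 : 0 ≤ ∑ k, orliczSeqNorm M (x k) ^ p :=
      Finset.sum_nonneg fun k _ => Real.rpow_nonneg (orliczSeqNorm_nonneg _ _) _
    have hL0 : 0 < L := (Real.rpow_nonneg hsum0 _).trans_lt hL
    have hlt : ∑ k, orliczSeqNorm M (x k) ^ p < L ^ p := by
      have := Real.rpow_lt_rpow (Real.rpow_nonneg hsum0 _) hL hp0
      rwa [← Real.rpow_mul hsum0, one_div_mul_cancel hp0.ne', Real.rpow_one] at this
    -- The norms may vanish and need not be attained, so all are raised by a common `e > 0`, small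
    -- enough to keep the strict inequality with `L ^ p`.
    have hcont : Continuous fun e : ℝ => ∑ k, (orliczSeqNorm M (x k) + e) ^ p :=
      continuous_finsetSum _ fun k _ =>
        (continuous_const.add continuous_id).rpow_const fun _ => Or.inr hp0.le
    have hev : ∀ᶠ e in 𝓝[>] (0 : ℝ), ∑ k, (orliczSeqNorm M (x k) + e) ^ p < L ^ p := by
      have : ∀ᶠ e in 𝓝 (0 : ℝ), ∑ k, (orliczSeqNorm M (x k) + e) ^ p < L ^ p :=
        hcont.continuousAt.eventually_lt continuousAt_const (by simpa using hlt)
      exact nhdsWithin_le_nhds this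
    obtain ⟨e, he, he0⟩ := (hev.and self_mem_nhdsWithin).exists
    have he0 : 0 < e := he0
    have hpos : ∀ k, 0 < orliczSeqNorm M (x k) + e := fun k =>
      add_pos_of_nonneg_of_pos (orliczSeqNorm_nonneg _ _) he0
    have hsum : ∑ k, (D₂ * (orliczSeqNorm M (x k) + e) / (D₂ * L)) ^ p ≤ 1 := by
      have : ∀ k, (D₂ * (orliczSeqNorm M (x k) + e) / (D₂ * L)) ^ p
          = (orliczSeqNorm M (x k) + e) ^ p / L ^ p := fun k => by
        rw [mul_div_mul_left _ _ hD₂.ne', Real.div_rpow (hpos k).le hL0.le]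
      simp only [this, ← Finset.sum_div]
      exact div_le_one_of_le₀ he.le (by positivity)
    refine h₁ _ _ (by positivity) ((h _ _ (fun k => mul_pos hD₂ (hpos k)) (by positivity)
      hsum).trans ?_)
    calc _ ≤ ∑ k, ENNReal.ofReal ((D₂ * (orliczSeqNorm M (x k) + e) / (D₂ * L)) ^ p) := by
          refine Finset.sum_le_sum fun k _ => mul_le_of_le_one_right' (h₂ _ _ (hpos k) ?_)
          exact modular_le_one_of_norm_lt hM (hx k) (lt_add_of_pos_right _ he0)
      _ ≤ 1 := by
          rw [← ENNReal.ofReal_sum_of_nonneg fun k _ => Real.rpow_nonneg (by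
            have := hpos k; positivity) _]
          exact ENNReal.ofReal_le_one.2 hsum
  have hA : 0 ≤ (∑ k, orliczSeqNorm M (x k) ^ p) ^ (1 / p) := Real.rpow_nonneg
    (Finset.sum_nonneg fun k _ => Real.rpow_nonneg (orliczSeqNorm_nonneg _ _) _) _
  constructor
  · refine (memOrliczSeq_iff hM).2 ⟨hS, _, ?_, key _ (lt_add_one _)⟩
    positivity
  · refine le_of_forall_gt_imp_ge_of_dense fun b hb => ?_
    have hK : 0 < D₁ * C * D₂ := by positivity
    have hb' := (lt_div_iff₀' hK).2 hb
    have hb0 := hA.trans_lt hb'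
    refine (orliczSeqNorm_le hM (by positivity) (key _ hb')).trans (le_of_eq ?_)
    field_simp

/-- By contradiction: if the left side were too large, every `x k` of nonzero norm would have
modular at least one at its `l k`, forcing the modular of `S` at `L` to be at least one, although
`L` is twice a radius where it is already at most one. -/
lemma norm_le_of_modular_lower (hM : IsOrliczFunction M) (hN : IsOrliczFunction N)
    {D₁ D₂ q : ℝ} (hD₁ : 0 < D₁) (hD₂ : 0 < D₂) (hq : 1 ≤ q)
    (h₁ : DominatesModular N M D₁) (h₂ : DominatesModular M N D₂) {n : ℕ}
    {x : Fin n → ℕ → ℂ} {S : ℕ → ℂ} (hS : MemOrliczSeq M S)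
    (h : ∀ (l : Fin n → ℝ) (L : ℝ), (∀ k, 0 ≤ l k) → 0 < L → ∑ k, (l k / L) ^ q ≤ 1 →
      ∑ k, ENNReal.ofReal ((l k / L) ^ q) * modular N (x k) (l k) ≤ modular N S L) :
    (∑ k, orliczSeqNorm M (x k) ^ q) ^ (1 / q) ≤ 4 * D₁ * D₂ * orliczSeqNorm M S := by
  have hq0 : 0 < q := zero_lt_one.trans_le hq
  have hn := fun k => orliczSeqNorm_nonneg M (x k)
  set A := (∑ k, orliczSeqNorm M (x k) ^ q) ^ (1 / q) with hA
  have hsum0 : 0 ≤ ∑ k, orliczSeqNorm M (x k) ^ q :=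
    Finset.sum_nonneg fun k _ => Real.rpow_nonneg (hn k) _
  have hA0 : 0 ≤ A := Real.rpow_nonneg hsum0 _
  refine le_of_forall_gt_imp_ge_of_dense fun b hb => ?_
  have hK : 0 < 4 * D₁ * D₂ := by positivity
  have hb' := (lt_div_iff₀' hK).2 hb
  set r := b / (4 * D₁ * D₂)
  have hr0 : 0 < r := (orliczSeqNorm_nonneg _ _).trans_lt hb'
  have hbr : b = 4 * D₁ * D₂ * r := by simp only [r]; field_simp
  rw [hbr]
  by_contra! hlt
  have hA1 : 0 < A := lt_trans (by positivity) hlt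
  have hAq : A ^ q = ∑ k, orliczSeqNorm M (x k) ^ q := by
    rw [hA, ← Real.rpow_mul hsum0, one_div_mul_cancel hq0.ne', Real.rpow_one]
  -- The factor `2` puts `D₁ * l k` at half the norm of `x k`, where the modular of `M` must exceed
  -- one.
  set l : Fin n → ℝ := fun k => orliczSeqNorm M (x k) / (2 * D₁) with hl
  set L := A / (2 * D₁) with hL
  have hsum : ∑ k, (l k / L) ^ q = 1 := by
    have : ∀ k, (l k / L) ^ q = orliczSeqNorm M (x k) ^ q / A ^ q := fun k => by
      rw [hl, hL, div_div_div_cancel_right₀ (by positivity), Real.div_rpow (hn k) hA0]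
    simp only [this, ← Finset.sum_div, ← hAq]
    exact div_self (by positivity)
  have hl0 : ∀ k, 0 ≤ l k := fun k => div_nonneg (hn k) (by positivity)
  have hL0 : 0 < L := div_pos hA1 (by positivity)
  have hθ : ∀ k, 0 ≤ (l k / L) ^ q := fun k => Real.rpow_nonneg (div_nonneg (hl0 k) hL0.le) _
  have hmod := h l L hl0 hL0 hsum.le
  have hge : 1 ≤ modular N S L := by
    refine le_trans ?_ hmod
    calc (1 : ℝ≥0∞) = ∑ k, ENNReal.ofReal ((l k / L) ^ q) := by
          rw [← ENNReal.ofReal_sum_of_nonneg fun k _ => hθ k, hsum, ENNReal.ofReal_one]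
      _ ≤ _ := by
          refine Finset.sum_le_sum fun k _ => ?_
          -- A term of norm zero has weight zero, so nothing is needed about its modular.
          rcases (hn k).eq_or_lt with h0 | h0
          · simp [hl, ← h0, Real.zero_rpow hq0.ne']
          · refine le_mul_of_one_le_right' ?_
            by_contra! hc
            have hlk : 0 < l k := by positivity
            have := orliczSeqNorm_le hM (by positivity) (h₁ _ _ hlk hc.le)
            simp only [hl] at this
            rw [mul_div_assoc', mul_comm, mul_div_mul_right _ _ hD₁.ne'] at this
            linarith
  have hSr := h₂ _ _ hr0 (modular_le_one_of_norm_lt hM hS hb')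
  have hle : 2 * (D₂ * r) ≤ L := by
    rw [hL, le_div_iff₀ (by positivity)]; nlinarith
  have hfin : modular N S L ≤ ENNReal.ofReal 2⁻¹ := by
    refine (modular_anti hN S (by positivity) hle).trans
      ((modular_mul_le hN S one_le_two _).trans (mul_le_of_le_one_right' hSr))
  have : (1 : ℝ≥0∞) ≤ ENNReal.ofReal 2⁻¹ := hge.trans hfin
  rw [ENNReal.one_le_ofReal] at this
  norm_num at this

end Modular

/-! ### Power densities and their primitives -/

/-- Two-sided power growth: `n s / s ^ (p - 1)` is nondecreasing and `n s / s ^ (q - 1)` is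
nonincreasing on `(0, ∞)`. -/
structure IsPowerDensity (p q : ℝ) (n : ℝ → ℝ) : Prop where
  pos : ∀ s, 0 < s → 0 < n s
  mono : MonotoneOn (fun s => n s / s ^ (p - 1)) (Ioi 0)
  anti : AntitoneOn (fun s => n s / s ^ (q - 1)) (Ioi 0)

/-- The even primitive of a density on `(0, ∞)`. -/
noncomputable def orliczPrimitive (n : ℝ → ℝ) (t : ℝ) : ℝ := ∫ s in (0 : ℝ)..|t|, n s

namespace IsPowerDensity

variable {p q : ℝ} {n : ℝ → ℝ}

lemma le_rpow_mul (h : IsPowerDensity p q n) {s t : ℝ} (hs : 0 < s) (hst : s ≤ t) :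
    (t / s) ^ (p - 1) * n s ≤ n t := by
  have ht := hs.trans_le hst
  have h1 := h.mono hs ht hst
  simp only at h1
  rw [div_le_div_iff₀ (by positivity) (by positivity)] at h1
  rw [Real.div_rpow ht.le hs.le, div_mul_eq_mul_div, div_le_iff₀ (by positivity)]
  linarith

lemma rpow_mul_le (h : IsPowerDensity p q n) {s t : ℝ} (hs : 0 < s) (hst : s ≤ t) :
    n t ≤ (t / s) ^ (q - 1) * n s := by
  have ht := hs.trans_le hst
  have h1 := h.anti hs ht hst
  simp only at h1
  rw [div_le_div_iff₀ (by positivity) (by positivity)] at h1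
  rw [Real.div_rpow ht.le hs.le, div_mul_eq_mul_div, le_div_iff₀ (by positivity)]
  linarith

lemma monotoneOn (h : IsPowerDensity p q n) (hp : 1 ≤ p) : MonotoneOn n (Ioi 0) := by
  intro s hs t ht hst
  have hs : 0 < s := hs
  refine le_trans ?_ (h.le_rpow_mul hs hst)
  exact le_mul_of_one_le_left (h.pos s hs).le
    (Real.one_le_rpow ((one_le_div hs).2 hst) (by linarith))

/-- The two monotonicity conditions squeeze `n t` between `(t / s) ^ (p - 1) * n s` and `(t / s) ^
(q - 1) * n s`, both of which tend to `n s`. Continuity is thus automatic. -/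
lemma continuousAt (h : IsPowerDensity p q n) {s : ℝ} (hs : 0 < s) : ContinuousAt n s := by
  have hc : ∀ r : ℝ, Tendsto (fun t : ℝ => (t / s) ^ r * n s) (𝓝 s) (𝓝 (n s)) := fun r => by
    have : ContinuousAt (fun t : ℝ => (t / s) ^ r * n s) s :=
      ((continuousAt_id.div_const s).rpow_const
        (Or.inl (by simp [hs.ne']))).mul continuousAt_const
    simpa [ContinuousAt, div_self hs.ne'] using this
  have hmin := (hc (p - 1)).min (hc (q - 1))
  have hmax := (hc (p - 1)).max (hc (q - 1))
  rw [min_self] at hmin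
  rw [max_self] at hmax
  refine tendsto_of_tendsto_of_tendsto_of_le_of_le' hmin hmax ?_ ?_
  · filter_upwards [lt_mem_nhds hs] with t ht
    rcases le_total s t with hst | hst
    · exact (min_le_left _ _).trans (h.le_rpow_mul hs hst)
    · refine (min_le_right _ _).trans ?_
      have := h.rpow_mul_le ht hst
      rw [← inv_div, Real.inv_rpow (by positivity), inv_mul_le_iff₀ (by positivity)]
      exact this
  · filter_upwards [lt_mem_nhds hs] with t ht
    rcases le_total s t with hst | hst
    · exact (h.rpow_mul_le hs hst).trans (le_max_right _ _)
    · refine le_trans ?_ (le_max_left _ _)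
      have := h.le_rpow_mul ht hst
      rw [← inv_div, Real.inv_rpow (by positivity), le_inv_mul_iff₀ (by positivity)]
      exact this

lemma continuousOn (h : IsPowerDensity p q n) : ContinuousOn n (Ioi 0) :=
  fun _ hs => (h.continuousAt hs).continuousWithinAt

lemma intervalIntegrable (h : IsPowerDensity p q n) (hp : 1 ≤ p) {t : ℝ} (ht : 0 ≤ t) :
    IntervalIntegrable n volume 0 t := by
  rw [intervalIntegrable_iff_integrableOn_Ioc_of_le ht]
  refine Integrable.mono' (g := fun _ => n t) (by simp)
    ((h.continuousOn.mono Ioc_subset_Ioi_self).aestronglyMeasurable measurableSet_Ioc) ?_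
  refine (ae_restrict_iff' measurableSet_Ioc).2 (ae_of_all _ fun s hs => ?_)
  rw [Real.norm_of_nonneg (h.pos s hs.1).le]
  exact h.monotoneOn hp hs.1 (hs.1.trans_le hs.2) hs.2

lemma hasDerivAt_integral (h : IsPowerDensity p q n) (hp : 1 ≤ p) {t : ℝ} (ht : 0 < t) :
    HasDerivAt (fun t => ∫ s in (0 : ℝ)..t, n s) (n t) t :=
  intervalIntegral.integral_hasDerivAt_right (h.intervalIntegrable hp ht.le)
    (h.continuousOn.stronglyMeasurableAtFilter isOpen_Ioi t ht) (h.continuousAt ht)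

lemma hasDerivAt (h : IsPowerDensity p q n) (hp : 1 ≤ p) {t : ℝ} (ht : 0 < t) :
    HasDerivAt (orliczPrimitive n) (n t) t := by
  refine (h.hasDerivAt_integral hp ht).congr_of_eventuallyEq ?_
  filter_upwards [lt_mem_nhds ht] with s hs
  rw [orliczPrimitive, abs_of_pos hs]

lemma le_primitive (h : IsPowerDensity p q n) (hp : 1 ≤ p) {s t : ℝ} (hs : 0 < s) (hst : s ≤ t) :
    (t - s) * n s ≤ orliczPrimitive n t := by
  have ht := hs.trans_le hst
  rw [orliczPrimitive, abs_of_pos ht]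
  have hi := h.intervalIntegrable hp ht.le
  have h0s := h.intervalIntegrable hp hs.le
  have hst' : IntervalIntegrable n volume s t := h0s.symm.trans hi
  rw [← intervalIntegral.integral_add_adjacent_intervals h0s hst']
  have h1 : 0 ≤ ∫ u in (0 : ℝ)..s, n u :=
    intervalIntegral.integral_nonneg_of_ae_restrict hs.le (by
      rw [← Measure.restrict_congr_set Ioc_ae_eq_Icc]
      exact (ae_restrict_iff' measurableSet_Ioc).2 (ae_of_all _ fun u hu => (h.pos u hu.1).le))
  have h2 : ∫ _ in s..t, n s ≤ ∫ u in s..t, n u :=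
    intervalIntegral.integral_mono_on hst (by simp) hst' fun u hu =>
      h.monotoneOn hp hs (hs.trans_le hu.1) hu.1
  rw [intervalIntegral.integral_const, smul_eq_mul] at h2
  linarith

lemma primitive_le (h : IsPowerDensity p q n) (hp : 1 ≤ p) {t : ℝ} (ht : 0 < t) :
    orliczPrimitive n t ≤ t * n t := by
  rw [orliczPrimitive, abs_of_pos ht, intervalIntegral.integral_of_le ht.le]
  calc ∫ s in Ioc 0 t, n s ≤ ∫ _ in Ioc 0 t, n t :=
        setIntegral_mono_on ((intervalIntegrable_iff_integrableOn_Ioc_of_le ht.le).1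
          (h.intervalIntegrable hp ht.le)) (by simp) measurableSet_Ioc fun u hu =>
          h.monotoneOn hp hu.1 ht hu.2
    _ = t * n t := by simp [ht.le]

lemma primitive_pos (h : IsPowerDensity p q n) (hp : 1 ≤ p) {t : ℝ} (ht : 0 < t) :
    0 < orliczPrimitive n t := by
  refine lt_of_lt_of_le ?_ (h.le_primitive hp (half_pos ht) (half_le_self ht.le))
  have := h.pos _ (half_pos ht)
  rw [sub_half]
  positivity

lemma continuousOn_primitive (h : IsPowerDensity p q n) (hp : 1 ≤ p) :
    ContinuousOn (orliczPrimitive n) (Ici 0) := by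
  intro t ht
  rcases eq_or_lt_of_le (show (0 : ℝ) ≤ t from ht) with rfl | ht
  · rw [← continuousWithinAt_sdiff_self]
    have h0 : orliczPrimitive n 0 = 0 := by simp [orliczPrimitive]
    have hset : Ici (0 : ℝ) \ {0} = Ioi 0 := by
      ext x; simp [lt_iff_le_and_ne, eq_comm]
    rw [ContinuousWithinAt, h0, hset]
    have hlim : Tendsto (fun t : ℝ => t * n 1) (𝓝[>] 0) (𝓝 0) := by
      have : Continuous fun t : ℝ => t * n 1 := by fun_prop
      simpa using (this.tendsto 0).mono_left nhdsWithin_le_nhds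
    refine tendsto_of_tendsto_of_tendsto_of_le_of_le' tendsto_const_nhds hlim ?_ ?_
    · filter_upwards [self_mem_nhdsWithin] with t ht using (h.primitive_pos hp ht).le
    · filter_upwards [Ioo_mem_nhdsGT zero_lt_one] with t ht
      refine (h.primitive_le hp ht.1).trans ?_
      have := h.monotoneOn hp ht.1 (mem_Ioi.2 zero_lt_one) ht.2.le
      have := ht.1.le
      gcongr
  · exact (h.hasDerivAt hp ht).continuousAt.continuousWithinAt

lemma isOrliczFunction (h : IsPowerDensity p q n) (hp : 1 ≤ p) :
    IsOrliczFunction (orliczPrimitive n) where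
  even t := by simp [orliczPrimitive]
  map_zero := by simp [orliczPrimitive]
  nontrivial := ⟨1, (h.primitive_pos hp zero_lt_one).ne'⟩
  convex := by
    have hd : ∀ t ∈ Ioi (0 : ℝ), deriv (orliczPrimitive n) t = n t :=
      fun t ht => (h.hasDerivAt hp ht).deriv
    have hconv : ConvexOn ℝ (Ici 0) (orliczPrimitive n) := by
      refine MonotoneOn.convexOn_of_deriv (convex_Ici 0) (h.continuousOn_primitive hp) ?_ ?_ <;>
        rw [interior_Ici]
      · exact fun t ht => (h.hasDerivAt hp ht).differentiableAt.differentiableWithinAt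
      · intro s hs t ht hst
        rw [hd s hs, hd t ht]
        exact h.monotoneOn hp hs ht hst
    have hmono : MonotoneOn (orliczPrimitive n) (Ici 0) := by
      refine monotoneOn_of_deriv_nonneg (convex_Ici 0) (h.continuousOn_primitive hp) ?_ ?_ <;>
        rw [interior_Ici]
      · exact fun t ht => (h.hasDerivAt hp ht).differentiableAt.differentiableWithinAt
      · intro t ht
        rw [hd t ht]
        exact (h.pos t ht).le
    have himg : (fun t : ℝ => ‖t‖) '' univ ⊆ Ici 0 := by
      rintro _ ⟨t, -, rfl⟩; exact norm_nonneg t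
    have himg' : (fun t : ℝ => ‖t‖) '' univ = Ici 0 := by
      refine himg.antisymm fun t ht => ⟨t, mem_univ _, ?_⟩
      exact Real.norm_of_nonneg ht
    have := ConvexOn.comp (s := univ) (f := fun t : ℝ => ‖t‖) (himg' ▸ hconv)
      (convexOn_norm convex_univ) (himg' ▸ hmono)
    refine this.congr fun t _ => ?_
    simp [orliczPrimitive]

/-- This form of the derivative shows that monotonicity of `n s / s ^ (p - 1)` and of `n s / s ^ (q
- 1)` is exactly `p`-convexity and `q`-concavity of the primitive. -/
lemma hasDerivAt_rpow (h : IsPowerDensity p q n) (hp : 1 ≤ p) {r : ℝ} (hr : 0 < r) {t : ℝ}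
    (ht : 0 < t) : HasDerivAt (fun t => orliczPrimitive n (t ^ (1 / r)))
      (1 / r * (n (t ^ (1 / r)) / (t ^ (1 / r)) ^ (r - 1))) t := by
  have h1 := (h.hasDerivAt hp (Real.rpow_pos_of_pos ht (1 / r))).comp t
    (Real.hasDerivAt_rpow_const (p := 1 / r) (Or.inl ht.ne'))
  refine h1.congr_deriv ?_
  have : t ^ (1 / r - 1) = ((t ^ (1 / r)) ^ (r - 1))⁻¹ := by
    rw [← Real.rpow_mul ht.le, ← Real.rpow_neg ht.le]
    congr 1; field_simp; ring
  rw [this]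
  ring

lemma continuousOn_primitive_rpow (h : IsPowerDensity p q n) (hp : 1 ≤ p) {r : ℝ} (hr : 0 < r) :
    ContinuousOn (fun t : ℝ => orliczPrimitive n (t ^ (1 / r))) (Ici 0) :=
  (h.isOrliczFunction hp).continuous.continuousOn.comp
    ((Real.continuous_rpow_const (by positivity)).continuousOn) (mapsTo_univ _ _)

lemma convexOn_rpow (h : IsPowerDensity p q n) (hp : 1 ≤ p) :
    ConvexOn ℝ (Ici 0) (fun t : ℝ => orliczPrimitive n (t ^ (1 / p))) := by
  have hp0 : 0 < p := zero_lt_one.trans_le hp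
  refine MonotoneOn.convexOn_of_deriv (convex_Ici 0) (h.continuousOn_primitive_rpow hp hp0)
    ?_ ?_ <;> rw [interior_Ici]
  · exact fun t ht => (h.hasDerivAt_rpow hp hp0 ht).differentiableAt.differentiableWithinAt
  · intro s hs t ht hst
    rw [(h.hasDerivAt_rpow hp hp0 hs).deriv, (h.hasDerivAt_rpow hp hp0 ht).deriv]
    have hs : 0 < s := hs
    have ht : 0 < t := ht
    refine mul_le_mul_of_nonneg_left (h.mono ?_ ?_ ?_) (by positivity)
    · exact Real.rpow_pos_of_pos hs _
    · exact Real.rpow_pos_of_pos ht _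
    · exact Real.rpow_le_rpow hs.le hst (by positivity)

lemma concaveOn_rpow (h : IsPowerDensity p q n) (hp : 1 ≤ p) (hq : 0 < q) :
    ConcaveOn ℝ (Ici 0) (fun t : ℝ => orliczPrimitive n (t ^ (1 / q))) := by
  refine AntitoneOn.concaveOn_of_deriv (convex_Ici 0) (h.continuousOn_primitive_rpow hp hq)
    ?_ ?_ <;> rw [interior_Ici]
  · exact fun t ht => (h.hasDerivAt_rpow hp hq ht).differentiableAt.differentiableWithinAt
  · intro s hs t ht hst
    rw [(h.hasDerivAt_rpow hp hq hs).deriv, (h.hasDerivAt_rpow hp hq ht).deriv]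
    have hs : 0 < s := hs
    have ht : 0 < t := ht
    refine mul_le_mul_of_nonneg_left (h.anti ?_ ?_ ?_) (by positivity)
    · exact Real.rpow_pos_of_pos hs _
    · exact Real.rpow_pos_of_pos ht _
    · exact Real.rpow_le_rpow hs.le hst (by positivity)

end IsPowerDensity

/-! ### Power growth of a function equivalent to a convex and concave one -/

/-- Two-sided power-type growth of `M` on `(0, 1]`. -/
def HasPowerGrowth (M : ℝ → ℝ) (p q : ℝ) : Prop :=
  (∀ t ∈ Ioc (0 : ℝ) 1, 0 < M t) ∧ ∃ C : ℝ, 1 ≤ C ∧ ∀ s ∈ Ioc (0 : ℝ) 1, ∀ t ∈ Ioc (0 : ℝ) 1,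
    M (s * t) ≤ C * (s ^ p * M t) ∧ s ^ q * M t ≤ C * M (s * t)

section Growth

variable {M N : ℝ → ℝ} {p q : ℝ}

lemma IsPConvexFunction.map_mul_le (hN : IsOrliczFunction N) (hp : 0 < p)
    (h : IsPConvexFunction p N) {s t : ℝ} (hs : s ∈ Ioc (0 : ℝ) 1) (ht : 0 < t) :
    N (s * t) ≤ s ^ p * N t := by
  have hcont : Continuous fun t : ℝ => N (t ^ (1 / p)) :=
    hN.continuous.comp (Real.continuous_rpow_const (by positivity))
  have hsp : 0 < s ^ p := Real.rpow_pos_of_pos hs.1 _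
  have hsp1 : s ^ p ≤ 1 := Real.rpow_le_one hs.1.le hs.2 hp.le
  -- The inequality wanted is convexity between `t ^ p` and `0`. Since `0` is outside the open
  -- half-line, it is reached as the limit of points `e > 0`.
  have hl : Tendsto (fun e : ℝ => N ((s ^ p * t ^ p + (1 - s ^ p) * e) ^ (1 / p))) (𝓝[>] 0)
      (𝓝 (N ((s ^ p * t ^ p + (1 - s ^ p) * 0) ^ (1 / p)))) :=
    ((hcont.comp (by fun_prop : Continuous fun e : ℝ => s ^ p * t ^ p + (1 - s ^ p) * e)).tendsto
      0).mono_left nhdsWithin_le_nhds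
  have hr : Tendsto (fun e : ℝ => s ^ p * N ((t ^ p) ^ (1 / p)) + (1 - s ^ p) * N (e ^ (1 / p)))
      (𝓝[>] 0) (𝓝 (s ^ p * N ((t ^ p) ^ (1 / p)) + (1 - s ^ p) * N (0 ^ (1 / p)))) :=
    ((continuous_const.add (continuous_const.mul hcont)).tendsto 0).mono_left nhdsWithin_le_nhds
  have := le_of_tendsto_of_tendsto hl hr (by
    filter_upwards [self_mem_nhdsWithin] with e he
    exact h.2 (Real.rpow_pos_of_pos ht p) he hsp.le (sub_nonneg.2 hsp1) (by ring))
  rw [mul_zero, add_zero, ← Real.mul_rpow hs.1.le ht.le, ← Real.rpow_mul (mul_pos hs.1 ht).le,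
    ← Real.rpow_mul ht.le, mul_one_div_cancel hp.ne', Real.rpow_one, Real.rpow_one,
    Real.zero_rpow (by positivity), hN.map_zero, mul_zero, add_zero] at this
  exact this

lemma IsQConcaveFunction.le_map_mul (hN : IsOrliczFunction N) (hq : 0 < q)
    (h : IsQConcaveFunction q N) {s t : ℝ} (hs : s ∈ Ioc (0 : ℝ) 1) (ht : 0 < t) :
    s ^ q * N t ≤ N (s * t) := by
  have hcont : Continuous fun t : ℝ => N (t ^ (1 / q)) :=
    hN.continuous.comp (Real.continuous_rpow_const (by positivity))
  have hsp : 0 < s ^ q := Real.rpow_pos_of_pos hs.1 _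
  have hsp1 : s ^ q ≤ 1 := Real.rpow_le_one hs.1.le hs.2 hq.le
  have hl : Tendsto (fun e : ℝ => N ((s ^ q * t ^ q + (1 - s ^ q) * e) ^ (1 / q))) (𝓝[>] 0)
      (𝓝 (N ((s ^ q * t ^ q + (1 - s ^ q) * 0) ^ (1 / q)))) :=
    ((hcont.comp (by fun_prop : Continuous fun e : ℝ => s ^ q * t ^ q + (1 - s ^ q) * e)).tendsto
      0).mono_left nhdsWithin_le_nhds
  have hev : ∀ᶠ e in 𝓝[>] (0 : ℝ),
      s ^ q * N t ≤ N ((s ^ q * t ^ q + (1 - s ^ q) * e) ^ (1 / q)) := by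
    filter_upwards [self_mem_nhdsWithin] with e he
    have := h.2 (Real.rpow_pos_of_pos ht q) he hsp.le (sub_nonneg.2 hsp1) (by ring)
    simp only [smul_eq_mul] at this
    rw [← Real.rpow_mul ht.le, mul_one_div_cancel hq.ne', Real.rpow_one] at this
    exact (le_add_of_nonneg_right (mul_nonneg (sub_nonneg.2 hsp1) (hN.nonneg _))).trans this
  have := ge_of_tendsto hl hev
  rwa [mul_zero, add_zero, ← Real.mul_rpow hs.1.le ht.le, ← Real.rpow_mul (mul_pos hs.1 ht).le,
    mul_one_div_cancel hq.ne', Real.rpow_one] at this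

lemma hasPowerGrowth_of_equiv (hp : 0 < p) (hq : 0 < q)
    (hN : IsOrliczFunction N) (hNp : IsPConvexFunction p N) (hNq : IsQConcaveFunction q N)
    (h : EquivOnUnitInterval M N) : HasPowerGrowth M p q := by
  obtain ⟨C, hC, h⟩ := h
  -- `q`-concavity excludes functions vanishing near `0`: it bounds `N t` below by a positive
  -- multiple of a nonzero value `N T`.
  have hNpos : ∀ t ∈ Ioc (0 : ℝ) 1, 0 < N t := by
    intro t ht
    obtain ⟨T, hT1, hT⟩ := hN.exists_gt 0
    have hT0 : 0 < T := zero_lt_one.trans_le hT1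
    have := hNq.le_map_mul hN hq (s := t / T)
      ⟨div_pos ht.1 hT0, div_le_one_of_le₀ (ht.2.trans hT1) hT0.le⟩ hT0
    rw [div_mul_cancel₀ _ hT0.ne'] at this
    exact lt_of_lt_of_le (mul_pos (Real.rpow_pos_of_pos (div_pos ht.1 hT0) _) hT) this
  have h' : ∀ t ∈ Ioc (0 : ℝ) 1, M t ≤ C * N t ∧ N t ≤ C * M t := by
    intro t ht
    have := h t ⟨ht.1.le, ht.2⟩
    rw [inv_mul_le_iff₀ hC] at this
    exact this
  refine ⟨fun t ht => ?_, max 1 (C * C), le_max_left _ _, fun s hs t ht => ?_⟩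
  · have := (hNpos t ht).trans_le (h' t ht).2
    exact (pos_iff_pos_of_mul_pos this).1 hC
  · have hst : s * t ∈ Ioc (0 : ℝ) 1 :=
      ⟨mul_pos hs.1 ht.1, mul_le_one₀ hs.2 ht.1.le ht.2⟩
    have hMpos : ∀ t ∈ Ioc (0 : ℝ) 1, 0 ≤ M t := fun t ht =>
      ((pos_iff_pos_of_mul_pos ((hNpos t ht).trans_le (h' t ht).2)).1 hC).le
    have hspos := Real.rpow_nonneg hs.1.le p
    have hsqos := Real.rpow_nonneg hs.1.le q
    constructor
    · calc M (s * t) ≤ C * N (s * t) := (h' _ hst).1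
        _ ≤ C * (s ^ p * (C * M t)) := by
            gcongr
            exact (hNp.map_mul_le hN hp hs ht.1).trans (by gcongr; exact (h' _ ht).2)
        _ = (C * C) * (s ^ p * M t) := by ring
        _ ≤ _ := by
            gcongr
            exacts [mul_nonneg hspos (hMpos t ht), le_max_right _ _]
    · calc s ^ q * M t ≤ s ^ q * (C * N t) := by gcongr; exact (h' _ ht).1
        _ = C * (s ^ q * N t) := by ring
        _ ≤ C * (C * M (s * t)) := by
            refine mul_le_mul_of_nonneg_left ?_ hC.le
            exact (hNq.le_map_mul hN hq hs ht.1).trans (h' _ hst).2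
        _ = (C * C) * M (s * t) := by ring
        _ ≤ _ := by
            gcongr
            exacts [hMpos _ hst, le_max_right _ _]

end Growth

/-! ### Regularization by a supremum of power kernels -/

/-- `min (x ^ (p - 1)) (x ^ (q - 1))`. -/
noncomputable def powerKernel (p q x : ℝ) : ℝ := min (x ^ (p - 1)) (x ^ (q - 1))

section Kernel

variable {p q : ℝ}

lemma powerKernel_pos {x : ℝ} (hx : 0 < x) : 0 < powerKernel p q x :=
  lt_min (Real.rpow_pos_of_pos hx _) (Real.rpow_pos_of_pos hx _)

lemma powerKernel_mul_le_left (hpq : p ≤ q) {c x : ℝ} (hc0 : 0 < c) (hc : c ≤ 1) (hx : 0 < x) :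
    powerKernel p q (c * x) ≤ c ^ (p - 1) * powerKernel p q x := by
  rw [powerKernel, powerKernel, mul_min_of_nonneg _ _ (by positivity), Real.mul_rpow hc0.le hx.le,
    Real.mul_rpow hc0.le hx.le]
  refine min_le_min le_rfl ?_
  gcongr ?_ * _
  exact Real.rpow_le_rpow_of_exponent_ge hc0 hc (by linarith)

lemma powerKernel_mul_le_right (hpq : p ≤ q) {c x : ℝ} (hc : 1 ≤ c) (hx : 0 < x) :
    powerKernel p q (c * x) ≤ c ^ (q - 1) * powerKernel p q x := by
  have hc0 : 0 < c := zero_lt_one.trans_le hc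
  rw [powerKernel, powerKernel, mul_min_of_nonneg _ _ (by positivity), Real.mul_rpow hc0.le hx.le,
    Real.mul_rpow hc0.le hx.le]
  refine min_le_min ?_ le_rfl
  gcongr ?_ * _
  exact Real.rpow_le_rpow_of_exponent_le hc (by linarith)

end Kernel

/-- The regularized density of an Orlicz function. -/
noncomputable def growthDensity (M : ℝ → ℝ) (p q s : ℝ) : ℝ :=
  ⨆ u : Ioc (0 : ℝ) 1, M u / u * powerKernel p q (s / u)

namespace HasPowerGrowth

variable {M : ℝ → ℝ} {p q : ℝ}

lemma term_le {C : ℝ} (hC : ∀ s ∈ Ioc (0 : ℝ) 1, ∀ t ∈ Ioc (0 : ℝ) 1,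
    M (s * t) ≤ C * (s ^ p * M t)) {s t u : ℝ} (hu : 0 < u) (hut : u ≤ t)
    (ht : t ≤ 1) (hs : 0 < s) :
    M u / u * (s / u) ^ (p - 1) ≤ C * M t * (s / t) ^ (p - 1) / t := by
  have ht0 := hu.trans_le hut
  have h1 := hC (u / t) ⟨by positivity, div_le_one_of_le₀ hut ht0.le⟩ t ⟨ht0, ht⟩
  rw [div_mul_cancel₀ _ ht0.ne'] at h1
  have h2 : (u / t) ^ p = (u / t) ^ (p - 1) * (u / t) := by
    rw [← Real.rpow_add_one (by positivity)]; simp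
  have h3 : (s / t) ^ (p - 1) = (u / t) ^ (p - 1) * (s / u) ^ (p - 1) := by
    rw [← Real.mul_rpow (by positivity) (by positivity)]
    congr 1; field_simp
  calc M u / u * (s / u) ^ (p - 1) ≤ (C * ((u / t) ^ p * M t)) / u * (s / u) ^ (p - 1) := by
        gcongr
    _ = C * M t * (s / t) ^ (p - 1) / t := by
        rw [h2, h3]; field_simp

variable (h : HasPowerGrowth M p q)
include h

lemma bddAbove {s : ℝ} (hs : 0 < s) :
    BddAbove (range fun u : Ioc (0 : ℝ) 1 => M u / u * powerKernel p q (s / u)) := by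
  obtain ⟨hpos, C, hC, hg⟩ := h
  refine ⟨C * M 1 * (s / 1) ^ (p - 1) / 1, ?_⟩
  rintro _ ⟨⟨u, hu⟩, rfl⟩
  refine le_trans ?_ (term_le (fun s hs t ht => (hg s hs t ht).1) hu.1 hu.2 le_rfl hs)
  exact mul_le_mul_of_nonneg_left (min_le_left _ _) (div_pos (hpos u hu) hu.1).le

/-- Each kernel `s ↦ powerKernel p q (s / u)` has both monotonicity properties, and these survive
nonnegative multiples and suprema. -/
lemma isPowerDensity (hpq : p ≤ q) : IsPowerDensity p q (growthDensity M p q) where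
  pos s hs := by
    refine lt_of_lt_of_le ?_ (le_ciSup (h.bddAbove hs) ⟨1, zero_lt_one, le_rfl⟩)
    have := h.1 1 ⟨zero_lt_one, le_rfl⟩
    have := powerKernel_pos (p := p) (q := q) (x := s / 1) (by positivity)
    positivity
  mono s hs t ht hst := by
    have hs : 0 < s := hs
    have ht : 0 < t := ht
    simp only
    rw [div_le_iff₀ (by positivity), div_mul_eq_mul_div, mul_div_assoc, ← Real.div_rpow hs.le ht.le]
    have : Nonempty (Ioc (0 : ℝ) 1) := ⟨⟨1, zero_lt_one, le_rfl⟩⟩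
    refine ciSup_le fun u => ?_
    have hu := u.2.1
    have h1 := powerKernel_mul_le_left hpq (c := s / t) (x := t / u) (by positivity)
      (div_le_one_of_le₀ hst ht.le) (by positivity)
    rw [show s / t * (t / u) = s / u by field_simp] at h1
    calc M u / u * powerKernel p q (s / u)
        ≤ M u / u * ((s / t) ^ (p - 1) * powerKernel p q (t / u)) :=
          mul_le_mul_of_nonneg_left h1 (div_pos (h.1 u u.2) hu).le
      _ = (M u / u * powerKernel p q (t / u)) * (s / t) ^ (p - 1) := by ring
      _ ≤ _ := by
          gcongr
          exact le_ciSup (h.bddAbove ht) u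
  anti s hs t ht hst := by
    have hs : 0 < s := hs
    have ht : 0 < t := ht
    simp only
    rw [div_le_iff₀ (by positivity), div_mul_eq_mul_div, mul_div_assoc, ← Real.div_rpow ht.le hs.le]
    have : Nonempty (Ioc (0 : ℝ) 1) := ⟨⟨1, zero_lt_one, le_rfl⟩⟩
    refine ciSup_le fun u => ?_
    have hu := u.2.1
    have h1 := powerKernel_mul_le_right hpq (c := t / s) (x := s / u)
      ((one_le_div hs).2 hst) (by positivity)
    rw [show t / s * (s / u) = t / u by field_simp] at h1
    calc M u / u * powerKernel p q (t / u)
        ≤ M u / u * ((t / s) ^ (q - 1) * powerKernel p q (s / u)) :=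
          mul_le_mul_of_nonneg_left h1 (div_pos (h.1 u u.2) hu).le
      _ = (M u / u * powerKernel p q (s / u)) * (t / s) ^ (q - 1) := by ring
      _ ≤ _ := by
          gcongr
          exact le_ciSup (h.bddAbove hs) u

lemma le_mul_growthDensity {s : ℝ} (hs : s ∈ Ioc (0 : ℝ) 1) : M s ≤ s * growthDensity M p q s := by
  have := le_ciSup (h.bddAbove hs.1) ⟨s, hs⟩
  simp only [div_self hs.1.ne', powerKernel, Real.one_rpow, min_self, mul_one] at this
  rwa [div_le_iff₀' hs.1] at this

/-- The growth of `M` bounds every term of the supremum by `C * M s / s`: the power `p - 1` of the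
kernel is used for `u ≤ s`, the power `q - 1` for `u ≥ s`. -/
lemma exists_mul_growthDensity_le :
    ∃ C : ℝ, 1 ≤ C ∧ ∀ s ∈ Ioc (0 : ℝ) 1, s * growthDensity M p q s ≤ C * M s := by
  obtain ⟨hpos, C, hC, hg⟩ := h
  refine ⟨C, hC, fun s hs => ?_⟩
  rw [← le_div_iff₀' hs.1]
  have : Nonempty (Ioc (0 : ℝ) 1) := ⟨⟨1, zero_lt_one, le_rfl⟩⟩
  refine ciSup_le fun ⟨u, hu⟩ => ?_
  have hs0 := hs.1
  have hu0 := hu.1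
  have hMu := hpos u hu
  simp only
  rcases le_total u s with hus | hsu
  · have := term_le (fun s hs t ht => (hg s hs t ht).1) hu.1 hus hs.2 hs.1
    rw [div_self hs.1.ne', Real.one_rpow, mul_one] at this
    refine le_trans ?_ this
    gcongr
    exact min_le_left _ _
  · have h1 := (hg (s / u) ⟨by positivity, div_le_one_of_le₀ hsu hu0.le⟩ u hu).2
    rw [div_mul_cancel₀ _ hu0.ne'] at h1
    have h2 : (s / u) ^ q = (s / u) ^ (q - 1) * (s / u) := by
      rw [← Real.rpow_add_one (by positivity)]; simp
    rw [le_div_iff₀ hs0]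
    refine le_trans ?_ h1
    rw [h2]
    calc M u / u * powerKernel p q (s / u) * s ≤ M u / u * (s / u) ^ (q - 1) * s := by
          gcongr; exact min_le_right _ _
      _ = _ := by field_simp

/-- With `n` the density and `N` its primitive, `N t ≤ t n t ≤ C M t`. Conversely `N t ≥ (t / 2) n
(t / 2) ≥ M (t / 2)`, which the lower growth bound compares with `2 ^ (-q) M t`. -/
lemma exists_isPowerDensity (hM : IsOrliczFunction M) (hp : 1 ≤ p) (hpq : p ≤ q) :
    ∃ n, IsPowerDensity p q n ∧ EquivOnUnitInterval M (orliczPrimitive n) := by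
  have hn := h.isPowerDensity hpq
  obtain ⟨C, hC1, hC⟩ := h.exists_mul_growthDensity_le
  obtain ⟨D, hD1, hD⟩ := h.2
  have hC0 : 0 < C := zero_lt_one.trans_le hC1
  have hD0 : 0 < D := zero_lt_one.trans_le hD1
  refine ⟨_, hn, max C (D * 2 ^ q), lt_max_of_lt_left hC0, fun t ht => ?_⟩
  rw [inv_mul_le_iff₀ (lt_max_of_lt_left hC0)]
  rcases ht.1.eq_or_lt with rfl | ht0
  · simp [hM.map_zero, orliczPrimitive]
  have htI : t ∈ Ioc (0 : ℝ) 1 := ⟨ht0, ht.2⟩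
  have hNpos := hn.primitive_pos hp ht0
  constructor
  · have h1 := (hD 2⁻¹ (by norm_num) t htI).2
    rw [Real.inv_rpow (by norm_num), inv_mul_le_iff₀ (by positivity)] at h1
    have h2 := h.le_mul_growthDensity (s := 2⁻¹ * t) ⟨by positivity, by linarith [ht.2]⟩
    have h3 := hn.le_primitive hp (s := 2⁻¹ * t) (t := t) (by positivity) (by linarith)
    rw [show t - 2⁻¹ * t = 2⁻¹ * t by ring] at h3
    calc M t ≤ 2 ^ q * (D * M (2⁻¹ * t)) := h1
      _ = D * 2 ^ q * M (2⁻¹ * t) := by ring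
      _ ≤ D * 2 ^ q * orliczPrimitive (growthDensity M p q) t := by
          gcongr; exact h2.trans h3
      _ ≤ _ := by gcongr; exact le_max_right _ _
  · refine (hn.primitive_le hp ht0).trans ((hC t htI).trans ?_)
    gcongr
    exacts [hM.nonneg t, le_max_left _ _]

end HasPowerGrowth

/-! ### The fundamental function, and growth of the Orlicz function from it -/

/-- The fundamental function of `l_M`: the norm of the indicator of a set of `k` indices. -/
noncomputable def orliczFundamental (M : ℝ → ℝ) (k : ℕ) : ℝ :=
  sInf {r : ℝ | 0 < r ∧ k * M (1 / r) ≤ 1}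

/-- Two-sided power estimates for the fundamental function. -/
def HasFundamentalEstimates (M : ℝ → ℝ) (p q : ℝ) : Prop :=
  ∃ K : ℝ, 0 < K ∧ ∀ n m : ℕ, 0 < n → 0 < m →
    orliczFundamental M (n * m) ≤ K * ((m : ℝ) ^ (1 / p) * orliczFundamental M n) ∧
      (m : ℝ) ^ (1 / q) * orliczFundamental M n ≤ K * orliczFundamental M (n * m)

section Fundamental

variable {M : ℝ → ℝ} {p q : ℝ}

lemma orliczFundamental_pos (hM : IsOrliczFunction M) {k : ℕ} (hk : 0 < k) :
    0 < orliczFundamental M k := by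
  obtain ⟨T, hT1, hT⟩ := hM.exists_gt 1
  have hT0 : 0 < T := zero_lt_one.trans_le hT1
  have hk1 : (1 : ℝ) ≤ k := by exact_mod_cast hk
  refine (inv_pos.2 hT0).trans_le (le_csInf ?_ ?_)
  · set r := max 1 (k * M 1)
    have hr : 1 ≤ r := le_max_left _ _
    have hr0 : 0 < r := zero_lt_one.trans_le hr
    refine ⟨r, hr0, ?_⟩
    have := hM.map_mul_le (c := 1 / r) (by positivity) (div_le_one_of_le₀ hr hr0.le) 1
    rw [mul_one] at this
    calc k * M (1 / r) ≤ k * (1 / r * M 1) := by gcongr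
      _ = (k * M 1) / r := by ring
      _ ≤ 1 := div_le_one_of_le₀ (le_max_right _ _) hr0.le
  · rintro r ⟨hr, h⟩
    by_contra! hlt
    have h1 : T ≤ 1 / r := by
      rw [le_div_iff₀ hr]
      have := mul_lt_mul_of_pos_left hlt hT0
      rw [mul_inv_cancel₀ hT0.ne'] at this
      exact this.le
    have := hM.mono hT0.le h1
    nlinarith [hM.nonneg (1 / r)]

lemma orliczFundamental_le {k : ℕ} {r : ℝ} (hr : 0 < r) (h : k * M (1 / r) ≤ 1) :
    orliczFundamental M k ≤ r :=
  csInf_le ⟨0, fun _ h => h.1.le⟩ ⟨hr, h⟩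

/-- If `M t = 0`, the fundamental function would be bounded by `1 / t`, while the lower estimate
makes it grow at least like `m ^ (1 / q)`. -/
lemma HasFundamentalEstimates.pos (hM : IsOrliczFunction M) (hq : 0 < q)
    (h : HasFundamentalEstimates M p q) {t : ℝ} (ht : 0 < t) : 0 < M t := by
  obtain ⟨K, hK, h⟩ := h
  refine lt_of_le_of_ne (hM.nonneg t) fun h0 => ?_
  have hφ := orliczFundamental_pos hM one_pos
  set b := K / t / orliczFundamental M 1
  have hb : 0 < b := by positivity
  obtain ⟨m, hm⟩ := exists_nat_gt (b ^ q)
  have hm0 : (0 : ℝ) < m := (Real.rpow_pos_of_pos hb q).trans hm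
  have h1 := (h 1 m one_pos (by exact_mod_cast hm0)).2
  have h2 : orliczFundamental M (1 * m) ≤ 1 / t :=
    orliczFundamental_le (by positivity) (by simp [← h0])
  have h3 : b < (m : ℝ) ^ (1 / q) := by
    have := Real.rpow_lt_rpow (by positivity) hm (one_div_pos.2 hq)
    rwa [← Real.rpow_mul hb.le, mul_one_div_cancel hq.ne', Real.rpow_one] at this
  have h4 : b * orliczFundamental M 1 < K * (1 / t) :=
    (mul_lt_mul_of_pos_right h3 hφ).trans_le (h1.trans (by gcongr))
  rw [div_mul_cancel₀ _ hφ.ne', mul_one_div] at h4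
  exact lt_irrefl _ h4

/-- Positivity and convexity make `M` strictly increasing on `[0, ∞)`, so the level `1 / k` is
attained at a single `τ` and the admissible radii form the ray from `1 / τ`. -/
lemma map_inv_orliczFundamental (hM : IsOrliczFunction M) (hpos : ∀ t, 0 < t → 0 < M t) {k : ℕ}
    (hk : 0 < k) : M (1 / orliczFundamental M k) = 1 / k := by
  obtain ⟨T, hT1, hT⟩ := hM.exists_gt 1
  have hT0 : 0 < T := zero_lt_one.trans_le hT1
  have hk1 : (1 : ℝ) ≤ k := by exact_mod_cast hk
  have hk0 : (0 : ℝ) < k := zero_lt_one.trans_le hk1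
  have h1k : 1 / (k : ℝ) ≤ 1 := div_le_one_of_le₀ hk1 hk0.le
  obtain ⟨τ, hτ, hτk⟩ := intermediate_value_Icc hT0.le hM.continuous.continuousOn
    (show 1 / (k : ℝ) ∈ Icc (M 0) (M T) from ⟨by rw [hM.map_zero]; positivity, by linarith⟩)
  have hτ0 : 0 < τ := by
    refine lt_of_le_of_ne hτ.1 fun h => ?_
    rw [← h, hM.map_zero] at hτk
    exact (one_div_pos.2 hk0).ne hτk
  have hset : {r : ℝ | 0 < r ∧ k * M (1 / r) ≤ 1} = Ici (1 / τ) := by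
    ext r
    simp only [mem_ofPred_eq, mem_Ici]
    constructor
    · rintro ⟨hr, h⟩
      by_contra! hlt
      have h1 : τ < 1 / r := by rwa [lt_div_iff₀ hr, ← lt_div_iff₀' hτ0]
      have h2 := hM.map_mul_le (c := τ / (1 / r)) (by positivity)
        (div_le_one_of_le₀ h1.le (by positivity)) (1 / r)
      rw [div_mul_cancel₀ _ (by positivity), hτk] at h2
      have h3 : τ / (1 / r) < 1 := (div_lt_one (by positivity)).2 h1
      have h4 : M (1 / r) ≤ 1 / k := by rwa [le_div_iff₀' hk0]
      have h5 := hpos (1 / r) (by positivity)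
      nlinarith
    · intro h
      have hr : 0 < r := lt_of_lt_of_le (by positivity) h
      refine ⟨hr, ?_⟩
      rw [← le_div_iff₀' hk0, ← hτk]
      refine hM.mono (by positivity) ?_
      rw [div_le_iff₀ hr]
      rwa [div_le_iff₀' hτ0] at h
  rw [orliczFundamental, hset, csInf_Ici, one_div_one_div, hτk]

lemma IsOrliczFunction.lt_of_pos (hM : IsOrliczFunction M) (hpos : ∀ t, 0 < t → 0 < M t) {s t : ℝ}
    (hs : 0 ≤ s) (hst : s < t) : M s < M t := by
  have ht := hs.trans_lt hst
  have h := hM.map_mul_le (c := s / t) (by positivity) (div_le_one_of_le₀ hst.le ht.le) t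
  rw [div_mul_cancel₀ _ ht.ne'] at h
  have h1 : s / t < 1 := (div_lt_one ht).2 hst
  nlinarith [hpos t ht]

/-- The scale `t` is placed between `1 / φ (2 n)` and `1 / φ n`, where `φ` is the fundamental
function, and `s` is matched by an integer `m` of order `s ^ (-p)` or `s ^ (-q)`. The estimates for
`φ` then compare `s t` with `1 / φ (n m)` or `1 / φ (2 n m)`, where `M` is known. The constant `4`
comes from rounding twice. -/
lemma growth_of_fundamental (hM : IsOrliczFunction M) (hpos : ∀ t, 0 < t → 0 < M t) (hp : 0 < p)
    (hq : 0 < q) {K : ℝ} (hK : 1 ≤ K) (h : ∀ n m : ℕ, 0 < n → 0 < m →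
      orliczFundamental M (n * m) ≤ K * ((m : ℝ) ^ (1 / p) * orliczFundamental M n) ∧
        (m : ℝ) ^ (1 / q) * orliczFundamental M n ≤ K * orliczFundamental M (n * m))
    {s t : ℝ} (hs : s ∈ Ioc (0 : ℝ) 1) (ht : 0 < t) (hMt : M t ≤ 1) :
    M (s * t) ≤ 4 * K ^ p * (s ^ p * M t) ∧ s ^ q * M t ≤ 4 * K ^ q * M (s * t) := by
  have hs0 := hs.1
  have hK0 : 0 < K := zero_lt_one.trans_le hK
  have hMt0 := hpos t ht
  have hφ : ∀ k, 0 < k → 0 < orliczFundamental M k := fun k hk => orliczFundamental_pos hM hk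
  have hτ : ∀ k, 0 < k → M (1 / orliczFundamental M k) = 1 / k :=
    fun k hk => map_inv_orliczFundamental hM hpos hk
  obtain ⟨n, hn, hn1, hn2⟩ : ∃ n : ℕ, 0 < n ∧ M t ≤ 1 / n ∧ 1 / (2 * n : ℝ) ≤ M t := by
    have h1 : 1 ≤ 1 / M t := (one_le_div hMt0).2 hMt
    have hn : 0 < ⌊1 / M t⌋₊ := Nat.floor_pos.2 h1
    have hn' : (1 : ℝ) ≤ (⌊1 / M t⌋₊ : ℝ) := by exact_mod_cast hn
    refine ⟨⌊1 / M t⌋₊, hn, ?_, ?_⟩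
    · have := Nat.floor_le (zero_le_one.trans h1)
      rw [le_div_iff₀ hMt0] at this
      rw [le_div_iff₀ (by positivity)]; linarith
    · have := Nat.lt_floor_add_one (1 / M t)
      rw [div_lt_iff₀ hMt0] at this
      rw [div_le_iff₀ (by positivity)]
      nlinarith
  have hn0 : (0 : ℝ) < n := by exact_mod_cast hn
  constructor
  -- For `s > 1 / K` the upper bound is trivial because `(K s) ^ p ≥ 1`. Otherwise `m` is the
  -- largest integer with `m ^ (1 / p) ≤ 1 / (K s)`.
  · rcases le_or_gt s (1 / K) with hsK | hsK
    · set x := (1 / (K * s)) ^ p with hx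
      have hx1 : 1 ≤ x := by
        refine Real.one_le_rpow ?_ hp.le
        rw [one_le_div (by positivity)]
        rwa [le_div_iff₀' hK0] at hsK
      have hx0 : 0 < x := zero_lt_one.trans_le hx1
      set m := ⌊x⌋₊
      have hm : 0 < m := Nat.floor_pos.2 hx1
      have hm0 : (1 : ℝ) ≤ m := by exact_mod_cast hm
      have hmx : (m : ℝ) ≤ x := Nat.floor_le hx0.le
      have hxm : x ≤ 2 * m := by have := Nat.lt_floor_add_one x; linarith
      have hmr : (m : ℝ) ^ (1 / p) ≤ 1 / (K * s) := by
        have := Real.rpow_le_rpow (by positivity) hmx (one_div_pos.2 hp).le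
        rwa [hx, ← Real.rpow_mul (by positivity), mul_one_div_cancel hp.ne', Real.rpow_one] at this
      have htτ : t ≤ 1 / orliczFundamental M n := by
        by_contra! hlt
        have := hM.lt_of_pos hpos (by have := hφ n hn; positivity) hlt
        rw [hτ n hn] at this
        linarith
      have hst : s * t ≤ 1 / orliczFundamental M (n * m) := by
        rw [le_div_iff₀ (hφ _ (Nat.mul_pos hn hm))]
        have h1 := (h n m hn hm).1
        rw [le_div_iff₀ (hφ n hn)] at htτ
        have hφn := hφ n hn
        calc s * t * orliczFundamental M (n * m)
            ≤ s * t * (K * (1 / (K * s) * orliczFundamental M n)) := by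
              gcongr; exact h1.trans (by gcongr)
          _ = t * orliczFundamental M n := by field_simp
          _ ≤ 1 := htτ
      have h2 := hM.mono (by positivity) hst
      rw [hτ _ (Nat.mul_pos hn hm)] at h2
      refine h2.trans ?_
      have hKs : x * (K ^ p * s ^ p) = 1 := by
        rw [hx, ← Real.mul_rpow hK0.le hs0.le, ← Real.mul_rpow (by positivity) (by positivity),
          one_div_mul_cancel (by positivity), Real.one_rpow]
      push_cast
      rw [div_le_iff₀ (by positivity)]
      rw [div_le_iff₀ (by positivity)] at hn2
      have hA : 0 < K ^ p * s ^ p := by positivity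
      calc (1 : ℝ) = x * (K ^ p * s ^ p) * 1 := by rw [hKs, one_mul]
        _ ≤ (2 * m) * (K ^ p * s ^ p) * (M t * (2 * n)) := by gcongr
        _ = _ := by ring
    · have h1 : 1 ≤ (K * s) ^ p := by
        refine Real.one_le_rpow ?_ hp.le
        rw [div_lt_iff₀' hK0] at hsK
        exact hsK.le
      rw [Real.mul_rpow hK0.le hs0.le] at h1
      calc M (s * t) ≤ 1 * M t := by
            rw [one_mul]; exact hM.mono (by positivity) (mul_le_of_le_one_left ht.le hs.2)
        _ ≤ (4 * (K ^ p * s ^ p)) * M t := by gcongr; linarith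
        _ = _ := by ring
  -- For the lower bound `m` is rounded up, so that `m ^ (1 / q) ≥ K / s`, and `2 n` replaces `n`
  -- since now `t` must be bounded from below.
  · set x := (K / s) ^ q with hx
    have hx1 : 1 ≤ x := Real.one_le_rpow ((one_le_div hs0).2 (hs.2.trans hK)) hq.le
    have hx0 : 0 < x := zero_lt_one.trans_le hx1
    set m := ⌈x⌉₊
    have hm : 0 < m := Nat.ceil_pos.2 hx0
    have hm0 : (0 : ℝ) < m := by exact_mod_cast hm
    have hmx : x ≤ m := Nat.le_ceil x
    have hxm : (m : ℝ) ≤ 2 * x := by have := Nat.ceil_lt_add_one hx0.le; linarith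
    have hmr : K / s ≤ (m : ℝ) ^ (1 / q) := by
      have := Real.rpow_le_rpow (by positivity) hmx (one_div_pos.2 hq).le
      rwa [hx, ← Real.rpow_mul (by positivity), mul_one_div_cancel hq.ne', Real.rpow_one] at this
    have h2n : 0 < 2 * n := by lia
    have htτ : 1 / orliczFundamental M (2 * n) ≤ t := by
      by_contra! hlt
      have := hM.lt_of_pos hpos ht.le hlt
      rw [hτ _ h2n] at this
      push_cast at this
      linarith
    have hst : 1 / orliczFundamental M (2 * n * m) ≤ s * t := by
      have hφnm := hφ _ (Nat.mul_pos h2n hm)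
      have hφn := hφ _ h2n
      rw [div_le_iff₀ hφnm]
      have h1 := (h (2 * n) m h2n hm).2
      have h3 : K / s * orliczFundamental M (2 * n) ≤ K * orliczFundamental M (2 * n * m) :=
        le_trans (by gcongr) h1
      rw [div_mul_eq_mul_div, div_le_iff₀ hs0, mul_assoc] at h3
      have h4 := le_of_mul_le_mul_left h3 hK0
      rw [div_le_iff₀ hφn] at htτ
      nlinarith
    have h2 := hM.mono (by have := hφ _ (Nat.mul_pos h2n hm); positivity) hst
    rw [hτ _ (Nat.mul_pos h2n hm)] at h2
    have hKs : x * s ^ q = K ^ q := by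
      rw [hx, ← Real.mul_rpow (by positivity) hs0.le, div_mul_cancel₀ _ hs0.ne']
    push_cast at h2
    calc s ^ q * M t ≤ s ^ q * (1 / n) := by gcongr
      _ = 4 * K ^ q * (1 / (2 * n * (2 * x))) := by
          rw [← hKs]; field_simp; ring
      _ ≤ 4 * K ^ q * (1 / (2 * n * m)) := by gcongr
      _ ≤ _ := by gcongr

lemma HasFundamentalEstimates.hasPowerGrowth (hM : IsOrliczFunction M) (hp : 0 < p) (hq : 0 < q)
    (h : HasFundamentalEstimates M p q) : HasPowerGrowth M p q := by
  have hpos : ∀ t, 0 < t → 0 < M t := fun t ht => h.pos hM hq ht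
  obtain ⟨K, hK, h⟩ := h
  refine ⟨fun t ht => hpos t ht.1, ?_⟩
  -- The growth bounds are available only where `M t ≤ 1`. A point `a` with this property is fixed,
  -- and larger `t` are compared with it at the cost of the factors `M 1 / M a` and `a ^ (-p)`.
  obtain ⟨a, ha0, ha1, hMa⟩ : ∃ a, 0 < a ∧ a ≤ 1 ∧ M a ≤ 1 := by
    refine ⟨min 1 (1 / orliczFundamental M 1), ?_, min_le_left _ _, ?_⟩
    · exact lt_min one_pos (one_div_pos.2 (orliczFundamental_pos hM one_pos))
    · have hφ := orliczFundamental_pos hM one_pos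
      have := map_inv_orliczFundamental hM hpos one_pos
      refine (hM.mono (by positivity) (min_le_right _ _)).trans ?_
      rw [this]; simp
  set K' := max 1 K
  have hK' : 1 ≤ K' := le_max_left _ _
  have hK'0 : 0 < K' := zero_lt_one.trans_le hK'
  have key := fun s (hs : s ∈ Ioc (0 : ℝ) 1) t (ht : 0 < t) (hMt : M t ≤ 1) =>
    growth_of_fundamental hM hpos hp hq hK' (fun n m hn hm => by
      have hφn := orliczFundamental_pos hM hn
      have hφnm := orliczFundamental_pos hM (Nat.mul_pos hn hm)
      exact ⟨(h n m hn hm).1.trans (by gcongr; exact le_max_right _ _),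
        (h n m hn hm).2.trans (by gcongr; exact le_max_right _ _)⟩) hs ht hMt
  have hMa0 := hpos a ha0
  have hM1 : M a ≤ M 1 := hM.mono ha0.le ha1
  set D := 4 * max (K' ^ p) (K' ^ q)
  have hDp : 4 * K' ^ p ≤ D := mul_le_mul_of_nonneg_left (le_max_left _ _) zero_le_four
  have hDq : 4 * K' ^ q ≤ D := mul_le_mul_of_nonneg_left (le_max_right _ _) zero_le_four
  have hD1 : 1 ≤ D := by
    have : 1 ≤ K' ^ p := Real.one_le_rpow hK' hp.le
    linarith
  have hD0 : 0 < D := zero_lt_one.trans_le hD1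
  set R := M 1 / M a
  have hR : 1 ≤ R := (one_le_div hMa0).2 hM1
  have hR0 : 0 < R := zero_lt_one.trans_le hR
  have hRa : R * M a = M 1 := div_mul_cancel₀ _ hMa0.ne'
  set A := (a⁻¹) ^ p
  have hA : 1 ≤ A := Real.one_le_rpow (one_le_inv_iff₀.2 ⟨ha0, ha1⟩) hp.le
  have hDRA : D ≤ D * R * A := by
    rw [mul_assoc]; exact le_mul_of_one_le_right hD0.le (one_le_mul_of_one_le_of_one_le hR hA)
  refine ⟨D * R * A, hD1.trans hDRA, fun s hs t ht => ?_⟩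
  have hs0 := hs.1
  have ht0 := ht.1
  have hMt0 := hpos t ht0
  have hMst0 := hpos _ (mul_pos hs0 ht0)
  rcases le_or_gt t a with hta | hat
  · have := key s hs t ht.1 ((hM.mono ht0.le hta).trans hMa)
    exact ⟨this.1.trans (mul_le_mul_of_nonneg_right (hDp.trans hDRA) (by positivity)),
      this.2.trans (mul_le_mul_of_nonneg_right (hDq.trans hDRA) (by positivity))⟩
  · have hMat : M a ≤ M t := hM.mono ha0.le hat.le
    constructor
    · have h1 : M (s * t) ≤ M s :=
        hM.mono (by positivity) (mul_le_of_le_one_right hs0.le ht.2)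
      refine h1.trans ?_
      have hsa : (s / a) ^ p = A * s ^ p := by
        rw [div_eq_inv_mul, Real.mul_rpow (by positivity) hs0.le]
      rcases le_or_gt s a with hsa' | hsa'
      · have h2 := (key (s / a) ⟨by positivity, div_le_one_of_le₀ hsa' ha0.le⟩ a ha0 hMa).1
        rw [div_mul_cancel₀ _ ha0.ne', hsa] at h2
        calc M s ≤ 4 * K' ^ p * (A * s ^ p * M a) := h2
          _ ≤ (D * R) * (A * s ^ p * M t) := by
              refine mul_le_mul (hDp.trans (le_mul_of_one_le_right hD0.le hR)) ?_
                (by positivity) (by positivity)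
              gcongr
          _ = _ := by ring
      · have h2 : 1 ≤ (s / a) ^ p := Real.one_le_rpow ((one_le_div ha0).2 hsa'.le) hp.le
        rw [hsa] at h2
        calc M s ≤ 1 * (R * M a) * 1 := by
              rw [one_mul, mul_one, hRa]; exact hM.mono hs0.le hs.2
          _ ≤ D * (R * M t) * (A * s ^ p) := by gcongr
          _ = _ := by ring
    · calc s ^ q * M t ≤ s ^ q * M 1 := by gcongr; exact hM.mono ht0.le ht.2
        _ = R * (s ^ q * M a) := by rw [← hRa]; ring
        _ ≤ R * (4 * K' ^ q * M (s * a)) := 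
            mul_le_mul_of_nonneg_left (key s hs a ha0 hMa).2 hR0.le
        _ ≤ R * (D * M (s * t)) := by
            gcongr
            · exact (hpos _ (mul_pos hs0 ha0)).le
            · exact hM.mono (by positivity) (by gcongr)
        _ = D * R * 1 * M (s * t) := by ring
        _ ≤ _ := by gcongr

end Fundamental

/-! ### Jensen's inequality with weights of total mass at most one -/

section Jensen

variable {κ : Type*} {F : ℝ → ℝ}

/-- The missing mass is placed at `0`, where `F` vanishes. -/
lemma ConvexOn.map_finsetSum_mul_le (hF : ConvexOn ℝ (Ici 0) F) (h0 : F 0 = 0) (s : Finset κ)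
    {w v : κ → ℝ} (hw : ∀ k, 0 ≤ w k) (hw1 : ∑ k ∈ s, w k ≤ 1) (hv : ∀ k, 0 ≤ v k) :
    F (∑ k ∈ s, w k * v k) ≤ ∑ k ∈ s, w k * F (v k) := by
  have h := hF.map_add_sum_le (t := s) (w := w) (p := v) (v := 1 - ∑ k ∈ s, w k) (q := 0)
    (fun k _ => hw k) (by ring) (fun k _ => hv k) (sub_nonneg.2 hw1) self_mem_Ici
  simpa [h0] using h

lemma ConcaveOn.finsetSum_mul_le_map (hF : ConcaveOn ℝ (Ici 0) F) (h0 : F 0 = 0) (s : Finset κ)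
    {w v : κ → ℝ} (hw : ∀ k, 0 ≤ w k) (hw1 : ∑ k ∈ s, w k ≤ 1) (hv : ∀ k, 0 ≤ v k) :
    ∑ k ∈ s, w k * F (v k) ≤ F (∑ k ∈ s, w k * v k) := by
  have h := hF.neg.map_finsetSum_mul_le (by simp [h0]) s hw hw1 hv
  simpa using h

lemma sum_le_one_of_tsum_ofReal_le_one {w : κ → ℝ} (hw : ∀ k, 0 ≤ w k)
    (hw1 : ∑' k, ENNReal.ofReal (w k) ≤ 1) (s : Finset κ) : ∑ k ∈ s, w k ≤ 1 := by
  rw [← ENNReal.ofReal_le_one, ENNReal.ofReal_sum_of_nonneg fun k _ => hw k]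
  exact (ENNReal.sum_le_tsum s).trans hw1

lemma ConvexOn.ofReal_map_le_tsum (hF : ConvexOn ℝ (Ici 0) F) (h0 : F 0 = 0)
    (hF0 : ∀ t, 0 ≤ t → 0 ≤ F t) (hFc : ContinuousOn F (Ici 0))
    {w v : κ → ℝ} (hw : ∀ k, 0 ≤ w k) (hw1 : ∑' k, ENNReal.ofReal (w k) ≤ 1) (hv : ∀ k, 0 ≤ v k)
    {b : ℝ} (hb : HasSum (fun k => w k * v k) b) :
    ENNReal.ofReal (F b) ≤ ∑' k, ENNReal.ofReal (w k) * ENNReal.ofReal (F (v k)) := by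
  have hb0 : 0 ≤ b := hb.nonneg fun k => mul_nonneg (hw k) (hv k)
  have hlim : Tendsto (fun s : Finset κ => ENNReal.ofReal (F (∑ k ∈ s, w k * v k))) atTop
      (𝓝 (ENNReal.ofReal (F b))) := by
    refine (ENNReal.continuous_ofReal.tendsto _).comp ((hFc b hb0).tendsto.comp ?_)
    exact tendsto_nhdsWithin_iff.2 ⟨hb, Eventually.of_forall fun s =>
      Finset.sum_nonneg fun k _ => mul_nonneg (hw k) (hv k)⟩
  refine le_of_tendsto' hlim fun s => ?_
  refine le_trans (ENNReal.ofReal_le_ofReal (hF.map_finsetSum_mul_le h0 s hw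
    (sum_le_one_of_tsum_ofReal_le_one hw hw1 s) hv)) ?_
  rw [ENNReal.ofReal_sum_of_nonneg fun k _ => mul_nonneg (hw k) (hF0 _ (hv k))]
  simp only [ENNReal.ofReal_mul (hw _)]
  exact ENNReal.sum_le_tsum s

lemma ConcaveOn.tsum_le_ofReal_map (hF : ConcaveOn ℝ (Ici 0) F) (h0 : F 0 = 0)
    (hF0 : ∀ t, 0 ≤ t → 0 ≤ F t) (hFm : MonotoneOn F (Ici 0))
    {w v : κ → ℝ} (hw : ∀ k, 0 ≤ w k) (hw1 : ∑' k, ENNReal.ofReal (w k) ≤ 1) (hv : ∀ k, 0 ≤ v k)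
    {b : ℝ} (hb : HasSum (fun k => w k * v k) b) :
    ∑' k, ENNReal.ofReal (w k) * ENNReal.ofReal (F (v k)) ≤ ENNReal.ofReal (F b) := by
  have hwv : ∀ k, 0 ≤ w k * v k := fun k => mul_nonneg (hw k) (hv k)
  rw [ENNReal.tsum_eq_iSup_sum]
  refine iSup_le fun s => ?_
  simp only [← ENNReal.ofReal_mul (hw _)]
  rw [← ENNReal.ofReal_sum_of_nonneg fun k _ => mul_nonneg (hw k) (hF0 _ (hv k))]
  refine ENNReal.ofReal_le_ofReal ((hF.finsetSum_mul_le_map h0 s hw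
    (sum_le_one_of_tsum_ofReal_le_one hw hw1 s) hv).trans ?_)
  exact hFm (Finset.sum_nonneg fun k _ => hwv k) (hb.nonneg hwv) (sum_le_hasSum s (fun k _ => hwv k) hb)

end Jensen

/-! ### Auxiliary facts on real powers -/

section Rpow

lemma Real.rpow_rpow_one_div {x s : ℝ} (hx : 0 ≤ x) (hs : s ≠ 0) : (x ^ s) ^ (1 / s) = x := by
  rw [← Real.rpow_mul hx, mul_one_div_cancel hs, Real.rpow_one]

lemma Real.rpow_one_div_rpow {x s : ℝ} (hx : 0 ≤ x) (hs : s ≠ 0) : (x ^ (1 / s)) ^ s = x := by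
  rw [← Real.rpow_mul hx, one_div_mul_cancel hs, Real.rpow_one]

lemma sum_rpow_const {s a : ℝ} (hs : s ≠ 0) (ha : 0 ≤ a) (m : ℕ) :
    (∑ _k : Fin m, a ^ s) ^ (1 / s) = (m : ℝ) ^ (1 / s) * a := by
  rw [Finset.sum_const, Finset.card_univ, Fintype.card_fin, nsmul_eq_mul,
    Real.mul_rpow (Nat.cast_nonneg _) (Real.rpow_nonneg ha _), Real.rpow_rpow_one_div ha hs]

lemma sum_rpow_one_div_le_sum {κ : Type*} (t : Finset κ) {a : κ → ℝ} (ha : ∀ k, 0 ≤ a k) {s : ℝ}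
    (hs : 1 ≤ s) : (∑ k ∈ t, a k ^ s) ^ (1 / s) ≤ ∑ k ∈ t, a k := by
  have hs0 : 0 < s := zero_lt_one.trans_le hs
  have hA := Finset.sum_nonneg fun k (_ : k ∈ t) => ha k
  rw [← Real.rpow_rpow_one_div hA hs0.ne']
  refine Real.rpow_le_rpow (Finset.sum_nonneg fun k _ => Real.rpow_nonneg (ha k) _) ?_
    (by positivity)
  induction t using Finset.cons_induction with
  | empty => simp [Real.zero_rpow hs0.ne']
  | cons k t hk ih =>
    rw [Finset.sum_cons, Finset.sum_cons]
    have hA := Finset.sum_nonneg fun k (_ : k ∈ t) => ha k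
    exact (add_le_add_right (ih hA) _).trans (Real.add_rpow_le_rpow_add (ha k) hA hs)

end Rpow

/-! ### Convexity, concavity and estimates for the sequence space -/

section Sequences

variable {M N : ℝ → ℝ} {p q : ℝ}

lemma IsOrliczFunction.map_zero_rpow (hM : IsOrliczFunction M) (hp : 0 < p) :
    M (0 ^ (1 / p)) = 0 := by
  rw [Real.zero_rpow (one_div_pos.2 hp).ne', hM.map_zero]

lemma memOrliczSeq_of_norm_le_sum (hM : IsOrliczFunction M) {n : ℕ} {x : Fin n → ℕ → ℂ}
    (hx : ∀ k, MemOrliczSeq M (x k)) {S : ℕ → ℂ} (hS : ∀ i, ‖S i‖ ≤ ∑ k, ‖x k i‖) :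
    MemOrliczSeq M S := by
  choose B hB using fun k => (hx k).1
  choose r hr hr1 using fun k => ((memOrliczSeq_iff hM).1 (hx k)).2
  refine ⟨⟨∑ k, B k, ?_⟩, ?_⟩
  · rintro _ ⟨i, rfl⟩
    exact (hS i).trans (Finset.sum_le_sum fun k _ => hB k ⟨i, rfl⟩)
  · set R := ∑ k, r k + 1
    have hR0 : 0 < R := add_pos_of_nonneg_of_pos (Finset.sum_nonneg fun k _ => (hr k).le) one_pos
    have hrR : ∀ k, r k ≤ R := fun k =>
      (Finset.single_le_sum (f := r) (fun k _ => (hr k).le) (Finset.mem_univ k)).trans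
        (le_add_of_nonneg_right zero_le_one)
    -- Dilation by `n + 1` turns the sum of `n` sequences into a combination with weights `1 / (n +
    -- 1)`, also meaningful for `n = 0`.
    refine ⟨(n + 1) * R, by positivity, ?_⟩
    rw [← modular_ne_top_iff hM]
    have hfin : ∑ k, modular M (x k) R ≠ ⊤ := ENNReal.sum_ne_top.2 fun k _ =>
      ne_top_of_le_ne_top ENNReal.one_ne_top ((modular_anti hM _ (hr k) (hrR k)).trans (hr1 k))
    refine ne_top_of_le_ne_top hfin ?_
    simp only [modular]
    rw [← Summable.tsum_finsetSum fun _ _ => ENNReal.summable]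
    refine ENNReal.tsum_le_tsum fun i => ?_
    rw [← ENNReal.ofReal_sum_of_nonneg fun k _ => hM.nonneg _]
    refine ENNReal.ofReal_le_ofReal ?_
    have hn : (n : ℝ) * (1 / (n + 1)) ≤ 1 := by
      rw [mul_one_div]; exact div_le_one_of_le₀ (by linarith) (by positivity)
    have h := (hM.convex.subset (subset_univ _) (convex_Ici 0)).map_finsetSum_mul_le hM.map_zero
      Finset.univ (w := fun _ : Fin n => 1 / ((n : ℝ) + 1)) (v := fun k => ‖x k i‖ / R)
      (fun _ => by positivity) (by simpa using hn) (fun _ => by positivity)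
    refine (hM.mono (by positivity) ?_).trans (h.trans ?_)
    · rw [← Finset.mul_sum, ← Finset.sum_div, one_div_mul_eq_div, div_div, mul_comm R]
      gcongr
      exact hS i
    · refine Finset.sum_le_sum fun k _ => mul_le_of_le_one_left (hM.nonneg _) ?_
      exact div_le_one_of_le₀ (by linarith [(Nat.cast_nonneg n : (0 : ℝ) ≤ n)]) (by positivity)

lemma norm_seqPowerSum {s : ℝ} {n : ℕ} (x : Fin n → ℕ → ℂ) (i : ℕ) :
    ‖seqPowerSum s x i‖ = (∑ k, ‖x k i‖ ^ s) ^ (1 / s) := by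
  rw [seqPowerSum, Complex.norm_real, Real.norm_of_nonneg]
  exact Real.rpow_nonneg (Finset.sum_nonneg fun k _ => Real.rpow_nonneg (norm_nonneg _) _) _

lemma memOrliczSeq_seqPowerSum (hM : IsOrliczFunction M) {s : ℝ} (hs : 1 ≤ s) {n : ℕ}
    {x : Fin n → ℕ → ℂ} (hx : ∀ k, MemOrliczSeq M (x k)) : MemOrliczSeq M (seqPowerSum s x) := by
  refine memOrliczSeq_of_norm_le_sum hM hx fun i => ?_
  rw [norm_seqPowerSum]
  exact sum_rpow_one_div_le_sum _ (fun k => norm_nonneg _) hs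

/-- At each coordinate, `∑ |x k| ^ p / L ^ p = ∑ (l k / L) ^ p * (|x k| / l k) ^ p`, to which
convexity of `t ↦ N (t ^ (1 / p))` applies. -/
lemma modular_seqPowerSum_le (hN : IsOrliczFunction N) (hp : 0 < p)
    (hNp : ConvexOn ℝ (Ici 0) fun t : ℝ => N (t ^ (1 / p))) {n : ℕ} (x : Fin n → ℕ → ℂ)
    {l : Fin n → ℝ} {L : ℝ} (hl : ∀ k, 0 < l k) (hL : 0 < L) (h : ∑ k, (l k / L) ^ p ≤ 1) :
    modular N (seqPowerSum p x) L ≤ ∑ k, ENNReal.ofReal ((l k / L) ^ p) * modular N (x k) (l k) := by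
  simp only [modular, ← ENNReal.tsum_mul_left]
  rw [← Summable.tsum_finsetSum fun _ _ => ENNReal.summable]
  refine ENNReal.tsum_le_tsum fun i => ?_
  have hw : ∀ k, 0 ≤ (l k / L) ^ p := fun k => by have := hl k; positivity
  simp only [← ENNReal.ofReal_mul (hw _)]
  rw [← ENNReal.ofReal_sum_of_nonneg fun k _ => mul_nonneg (hw k) (hN.nonneg _)]
  refine ENNReal.ofReal_le_ofReal ?_
  have hv : ∀ k, 0 ≤ ‖x k i‖ / l k := fun k => div_nonneg (norm_nonneg _) (hl k).le
  have := hNp.map_finsetSum_mul_le (hN.map_zero_rpow hp) Finset.univ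
    hw h (v := fun k => (‖x k i‖ / l k) ^ p) fun k => Real.rpow_nonneg (hv k) _
  simp only [Real.rpow_rpow_one_div (hv _) hp.ne'] at this
  refine le_trans (le_of_eq ?_) this
  rw [norm_seqPowerSum]
  congr 1
  conv_lhs => rw [← Real.rpow_rpow_one_div hL.le hp.ne']
  rw [← Real.div_rpow (Finset.sum_nonneg fun k _ => by positivity) (by positivity), Finset.sum_div]
  congr 1
  refine Finset.sum_congr rfl fun k _ => ?_
  have := hl k
  rw [← Real.mul_rpow (by positivity) (by positivity), ← Real.div_rpow (norm_nonneg _) hL.le]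
  congr 1
  field_simp

lemma le_modular_seqPowerSum (hN : IsOrliczFunction N) (hq : 0 < q)
    (hNq : ConcaveOn ℝ (Ici 0) fun t : ℝ => N (t ^ (1 / q))) {n : ℕ} (x : Fin n → ℕ → ℂ)
    {l : Fin n → ℝ} {L : ℝ} (hl : ∀ k, 0 ≤ l k) (hL : 0 < L) (h : ∑ k, (l k / L) ^ q ≤ 1) :
    ∑ k, ENNReal.ofReal ((l k / L) ^ q) * modular N (x k) (l k) ≤ modular N (seqPowerSum q x) L := by
  simp only [modular, ← ENNReal.tsum_mul_left]
  rw [← Summable.tsum_finsetSum fun _ _ => ENNReal.summable]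
  refine ENNReal.tsum_le_tsum fun i => ?_
  have hw : ∀ k, 0 ≤ (l k / L) ^ q := fun k => by have := hl k; positivity
  simp only [← ENNReal.ofReal_mul (hw _)]
  rw [← ENNReal.ofReal_sum_of_nonneg fun k _ => mul_nonneg (hw k) (hN.nonneg _)]
  refine ENNReal.ofReal_le_ofReal ?_
  have hv : ∀ k, 0 ≤ ‖x k i‖ / l k := fun k => div_nonneg (norm_nonneg _) (hl k)
  have := hNq.finsetSum_mul_le_map (hN.map_zero_rpow hq) Finset.univ
    hw h (v := fun k => (‖x k i‖ / l k) ^ q) fun k => Real.rpow_nonneg (hv k) _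
  simp only [Real.rpow_rpow_one_div (hv _) hq.ne'] at this
  have hsum0 : 0 ≤ ∑ k, (l k / L) ^ q * (‖x k i‖ / l k) ^ q :=
    Finset.sum_nonneg fun k _ => mul_nonneg (hw k) (Real.rpow_nonneg (hv k) _)
  refine this.trans (hN.mono (Real.rpow_nonneg hsum0 _) ?_)
  rw [norm_seqPowerSum]
  conv_rhs => rw [← Real.rpow_rpow_one_div hL.le hq.ne']
  rw [← Real.div_rpow (Finset.sum_nonneg fun k _ => by positivity) (by positivity), Finset.sum_div]
  refine Real.rpow_le_rpow hsum0 (Finset.sum_le_sum fun k _ => ?_) (by positivity)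
  rw [← Real.div_rpow (norm_nonneg _) hL.le]
  -- When `l k = 0` the weight vanishes but `‖x k i‖` need not, so only an inequality survives here.
  rcases (hl k).eq_or_lt with h0 | h0
  · rw [← h0, zero_div, Real.zero_rpow hq.ne', zero_mul]
    positivity
  · rw [← Real.mul_rpow (by positivity) (by positivity)]
    refine le_of_eq ?_
    congr 1
    field_simp

lemma orliczSeqNorm_congr (M : ℝ → ℝ) {x y : ℕ → ℂ} (h : ∀ i, ‖x i‖ = ‖y i‖) :
    orliczSeqNorm M x = orliczSeqNorm M y := by
  simp only [orliczSeqNorm, h]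

lemma memOrliczSeq_congr (M : ℝ → ℝ) {x y : ℕ → ℂ} (h : ∀ i, ‖x i‖ = ‖y i‖) :
    MemOrliczSeq M x ↔ MemOrliczSeq M y := by
  simp only [MemOrliczSeq, h]

lemma norm_sum_eq_seqPowerSum {s : ℝ} (hs : 0 < s) {n : ℕ} {x : Fin n → ℕ → ℂ}
    (hx : ∀ j k, j ≠ k → SeqDisjoint (x j) (x k)) (i : ℕ) :
    ‖(∑ k, x k) i‖ = ‖seqPowerSum s x i‖ := by
  rw [norm_seqPowerSum, Finset.sum_apply]
  by_cases h : ∃ k, x k i ≠ 0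
  · obtain ⟨k, hk⟩ := h
    have h0 : ∀ j ≠ k, x j i = 0 := fun j hj => (hx j k hj i).resolve_right hk
    rw [Fintype.sum_eq_single k h0, Fintype.sum_eq_single k fun j hj => by
      rw [h0 j hj, norm_zero, Real.zero_rpow hs.ne'], Real.rpow_rpow_one_div (norm_nonneg _) hs.ne']
  · push Not at h
    simp [h, Real.zero_rpow hs.ne', Real.zero_rpow (inv_ne_zero hs.ne')]

lemma OrliczSeqPConvex.upperEstimate (hp : 0 < p) (h : OrliczSeqPConvex M p) :
    OrliczSeqUpperEstimate M p := by
  obtain ⟨C, hC, h⟩ := h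
  refine ⟨C, hC, fun n x hx hd => ?_⟩
  rw [memOrliczSeq_congr M (norm_sum_eq_seqPowerSum hp hd),
    orliczSeqNorm_congr M (norm_sum_eq_seqPowerSum hp hd)]
  exact h n x hx

lemma OrliczSeqQConcave.lowerEstimate (hq : 0 < q) (h : OrliczSeqQConcave M q) :
    OrliczSeqLowerEstimate M q := by
  obtain ⟨C, hC, h⟩ := h
  refine ⟨C, hC, fun n x hx hd => ?_⟩
  rw [memOrliczSeq_congr M (norm_sum_eq_seqPowerSum hq hd),
    orliczSeqNorm_congr M (norm_sum_eq_seqPowerSum hq hd)]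
  exact h n x hx

lemma orliczSeqNorm_eq_fundamental (hM : IsOrliczFunction M) {x : ℕ → ℂ} {c : ℕ}
    (h : ∀ r, 0 < r → modular M x r = c * ENNReal.ofReal (M (1 / r))) :
    orliczSeqNorm M x = orliczFundamental M c := by
  rw [orliczSeqNorm_eq hM, orliczFundamental]
  congr 1
  ext r
  refine and_congr_right fun hr => ?_
  rw [h r hr, ← ENNReal.ofReal_natCast, ← ENNReal.ofReal_mul (by positivity), ENNReal.ofReal_le_one]

lemma memOrliczSeq_of_modular_eq (hM : IsOrliczFunction M) {x : ℕ → ℂ} {c : ℕ}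
    (hx : BddAbove (range fun k => ‖x k‖))
    (h : ∀ r, 0 < r → modular M x r = c * ENNReal.ofReal (M (1 / r))) : MemOrliczSeq M x := by
  refine ⟨hx, 1, one_pos, (modular_ne_top_iff hM).1 ?_⟩
  rw [h 1 one_pos]
  exact ENNReal.mul_ne_top (ENNReal.natCast_ne_top c) ENNReal.ofReal_ne_top

lemma tsum_ofReal_indicator (hM : IsOrliczFunction M) {ι : Type*} [DecidableEq ι] (A : Finset ι)
    (r : ℝ) : ∑' i, ENNReal.ofReal (M ((if i ∈ A then 1 else 0) / r)) =
      A.card * ENNReal.ofReal (M (1 / r)) := by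
  rw [tsum_eq_sum (s := A) fun i hi => by simp [hi, hM.map_zero],
    Finset.sum_congr rfl fun i hi => by rw [if_pos hi], Finset.sum_const, nsmul_eq_mul]

lemma modular_indicator (hM : IsOrliczFunction M) (A : Finset ℕ) (r : ℝ) :
    modular M (fun i => if i ∈ A then 1 else 0) r = A.card * ENNReal.ofReal (M (1 / r)) := by
  rw [← tsum_ofReal_indicator hM, modular]
  congr 1
  ext i
  split_ifs <;> simp

lemma hasFundamentalEstimates_of_sum {K₁ K₂ : ℝ} (hM : IsOrliczFunction M) (hp : 0 < p)
    (hq : 0 < q) (hK₁ : 0 < K₁) (h : ∀ n m : ℕ, 0 < n → 0 < m →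
      orliczFundamental M (n * m) ≤ K₁ * (∑ _k : Fin m, orliczFundamental M n ^ p) ^ (1 / p) ∧
      (∑ _k : Fin m, orliczFundamental M n ^ q) ^ (1 / q) ≤ K₂ * orliczFundamental M (n * m)) :
    HasFundamentalEstimates M p q := by
  refine ⟨max K₁ K₂, lt_max_of_lt_left hK₁, fun n m hn hm => ?_⟩
  have hφ := orliczFundamental_pos hM hn
  have hφ' := orliczFundamental_pos hM (Nat.mul_pos hn hm)
  have := h n m hn hm
  rw [sum_rpow_const hp.ne' hφ.le, sum_rpow_const hq.ne' hφ.le] at this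
  exact ⟨this.1.trans (by gcongr; exact le_max_left _ _),
    this.2.trans (by gcongr; exact le_max_right _ _)⟩

/-- The `k`-th block of `n` consecutive indices. -/
def indexBlock (n k : ℕ) : Finset ℕ := Finset.Ico (n * k) (n * (k + 1))

lemma card_indexBlock (n k : ℕ) : (indexBlock n k).card = n := by
  simp [indexBlock, Nat.mul_add]

lemma mem_indexBlock {n k i : ℕ} (hn : 0 < n) : i ∈ indexBlock n k ↔ i / n = k := by
  rw [indexBlock, Finset.mem_Ico, Nat.div_eq_iff hn]
  rw [mul_comm n k, mul_add, mul_one, mul_comm n k]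
  lia

lemma sum_indexBlock {R : Type*} [AddCommMonoid R] {n m : ℕ} (hn : 0 < n) (a : R) (i : ℕ) :
    ∑ k : Fin m, (if i ∈ indexBlock n k then a else 0) =
      if i ∈ Finset.range (n * m) then a else 0 := by
  simp only [mem_indexBlock hn, Finset.mem_range]
  split_ifs with h
  · have hk : i / n < m := by rwa [Nat.div_lt_iff_lt_mul hn, mul_comm]
    rw [Fintype.sum_eq_single ⟨i / n, hk⟩ fun j hj => if_neg fun h => hj (Fin.ext h.symm)]
    simp
  · refine Finset.sum_eq_zero fun k _ => if_neg fun hk => h ?_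
    have := (Nat.div_lt_iff_lt_mul hn).1 (hk.trans_lt k.2)
    rwa [mul_comm]

/-- Tested on indicators of `m` consecutive blocks of length `n`, whose sum is the indicator of `n *
m` indices. -/
lemma hasFundamentalEstimates_of_seqEstimates (hM : IsOrliczFunction M) (hp : 0 < p) (hq : 0 < q)
    (h₁ : OrliczSeqUpperEstimate M p) (h₂ : OrliczSeqLowerEstimate M q) :
    HasFundamentalEstimates M p q := by
  obtain ⟨K₁, hK₁, h₁⟩ := h₁
  obtain ⟨K₂, hK₂, h₂⟩ := h₂
  refine hasFundamentalEstimates_of_sum (K₂ := K₂) hM hp hq hK₁ fun n m hn hm => ?_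
  set x : Fin m → ℕ → ℂ := fun k i => if i ∈ indexBlock n k then 1 else 0
  have hmod : ∀ k r, 0 < r → modular M (x k) r = n * ENNReal.ofReal (M (1 / r)) := fun k r _ => by
    rw [modular_indicator hM, card_indexBlock]
  have hx : ∀ k, MemOrliczSeq M (x k) := fun k => by
    refine memOrliczSeq_of_modular_eq hM ⟨1, ?_⟩ (hmod k)
    rintro _ ⟨i, rfl⟩
    simp only [x]
    split_ifs <;> simp
  have hd : ∀ j k, j ≠ k → SeqDisjoint (x j) (x k) := fun j k hjk i => by
    simp only [x, mem_indexBlock hn]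
    by_contra! h
    have h1 : i / n = j := by by_contra h'; exact h.1 (if_neg h')
    have h2 : i / n = k := by by_contra h'; exact h.2 (if_neg h')
    exact hjk (Fin.ext (h1.symm.trans h2))
  have hS : ∑ k, x k = fun i => if i ∈ Finset.range (n * m) then 1 else 0 := by
    ext i
    rw [Finset.sum_apply]
    exact sum_indexBlock hn 1 i
  have hφ : ∀ k, orliczSeqNorm M (x k) = orliczFundamental M n :=
    fun k => orliczSeqNorm_eq_fundamental hM (hmod k)
  have hφS : orliczSeqNorm M (∑ k, x k) = orliczFundamental M (n * m) := by
    refine orliczSeqNorm_eq_fundamental hM fun r _ => ?_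
    rw [hS, modular_indicator hM, Finset.card_range]
  have e₁ := (h₁ m x hx hd).2
  have e₂ := (h₂ m x hx hd).2
  simp only [hφ, hφS] at e₁ e₂
  exact ⟨e₁, e₂⟩

/-- `N` is an Orlicz function, convex in `t ^ p` and concave in `t ^ q`, whose modular balls are
comparable to those of `M`. -/
structure IsOrliczModel (M : ℝ → ℝ) (p q : ℝ) (N : ℝ → ℝ) (D₁ D₂ : ℝ) : Prop where
  pos : ∀ t, 0 < t → 0 < M t
  orlicz : IsOrliczFunction N
  convex : ConvexOn ℝ (Ici 0) fun t : ℝ => N (t ^ (1 / p))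
  concave : ConcaveOn ℝ (Ici 0) fun t : ℝ => N (t ^ (1 / q))
  pos_left : 0 < D₁
  pos_right : 0 < D₂
  dominates : DominatesModular N M D₁
  dominated : DominatesModular M N D₂

lemma EquivOnUnitInterval.exists_dominatesModular (hM : IsOrliczFunction M)
    (hN : IsOrliczFunction N) (h : EquivOnUnitInterval M N) :
    ∃ D₁ D₂, 0 < D₁ ∧ 0 < D₂ ∧ DominatesModular N M D₁ ∧ DominatesModular M N D₂ := by
  obtain ⟨C, hC, h⟩ := h
  obtain ⟨D₁, h₁, h₁'⟩ := _root_.exists_dominatesModular hM hN (C := C) fun t ht => by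
    have := (h t ht).1
    rwa [inv_mul_le_iff₀ hC] at this
  obtain ⟨D₂, h₂, h₂'⟩ := _root_.exists_dominatesModular hN hM (C := C) fun t ht => (h t ht).2
  exact ⟨D₁, D₂, h₁, h₂, h₁', h₂'⟩

variable {D₁ D₂ : ℝ}

lemma IsOrliczModel.orliczSeqPConvex (hM : IsOrliczFunction M) (hp : 1 ≤ p)
    (h : IsOrliczModel M p q N D₁ D₂) : OrliczSeqPConvex M p := by
  refine ⟨D₁ * 1 * D₂, by have := h.pos_left; have := h.pos_right; positivity, fun n x hx => ?_⟩
  refine norm_le_of_modular_upper hM h.pos_left h.pos_right one_pos hp h.dominates h.dominated hx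
    (memOrliczSeq_seqPowerSum hM hp hx).1 fun l L hl hL hlL => ?_
  rw [one_mul]
  exact modular_seqPowerSum_le h.orlicz (zero_lt_one.trans_le hp) h.convex x hl hL hlL

lemma IsOrliczModel.orliczSeqQConcave (hM : IsOrliczFunction M) (hq : 1 ≤ q)
    (h : IsOrliczModel M p q N D₁ D₂) : OrliczSeqQConcave M q := by
  refine ⟨4 * D₁ * D₂, by have := h.pos_left; have := h.pos_right; positivity, fun n x hx => ?_⟩
  have hS := memOrliczSeq_seqPowerSum hM hq hx
  refine ⟨hS, norm_le_of_modular_lower hM h.orlicz h.pos_left h.pos_right hq h.dominates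
    h.dominated hS fun l L hl hL hlL => ?_⟩
  exact le_modular_seqPowerSum h.orlicz (zero_lt_one.trans_le hq) h.concave x hl hL hlL

end Sequences

/-! ### Singular values through finite-dimensional subspaces -/

section SingularValues

lemma exists_submodule_ge_finrank_le_sum {H : Type*} [NormedAddCommGroup H]
    [InnerProductSpace ℂ H] {n : ℕ} (V : Fin n → Submodule ℂ H)
    [∀ k, FiniteDimensional ℂ (V k)] : ∃ W : Submodule ℂ H, FiniteDimensional ℂ W ∧
      (∀ k, V k ≤ W) ∧ Module.finrank ℂ W ≤ ∑ k, Module.finrank ℂ (V k) := by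
  induction n with
  | zero => exact ⟨⊥, inferInstance, fun k => k.elim0, by simp⟩
  | succ n ih =>
    obtain ⟨W, _, hVW, hW⟩ := ih fun k => V k.succ
    refine ⟨V 0 ⊔ W, inferInstance, Fin.cases le_sup_left fun k => (hVW k).trans le_sup_right, ?_⟩
    rw [Fin.sum_univ_succ]
    exact (Submodule.finrank_add_le_finrank_add_finrank _ _).trans (by gcongr)

variable {H : Type*} [NormedAddCommGroup H] [InnerProductSpace ℂ H] [CompleteSpace H]

lemma singularValue_bddBelow (A : H →L[ℂ] H) (k : ℕ) :
    BddBelow {r : ℝ | ∃ P : H →L[ℂ] H, IsStarProjection P ∧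
      LinearMap.rank (P : H →ₗ[ℂ] H) ≤ (k : Cardinal) ∧ r = ‖A * (1 - P)‖} :=
  ⟨0, by rintro _ ⟨P, -, -, rfl⟩; exact norm_nonneg _⟩

lemma singularValue_nonneg (A : H →L[ℂ] H) (k : ℕ) : 0 ≤ singularValue A k :=
  Real.sInf_nonneg (by rintro _ ⟨P, -, -, rfl⟩; exact norm_nonneg _)

lemma singularValue_le_of_forall_orthogonal {A : H →L[ℂ] H} {k : ℕ} (W : Submodule ℂ H)
    [FiniteDimensional ℂ W] (hW : Module.finrank ℂ W ≤ k) {c : ℝ} (hc : 0 ≤ c)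
    (h : ∀ w ∈ Wᗮ, ‖A w‖ ≤ c * ‖w‖) : singularValue A k ≤ c := by
  refine (csInf_le (singularValue_bddBelow A k) ⟨W.starProjection, isStarProjection_starProjection,
    ?_, rfl⟩).trans ?_
  · rw [LinearMap.rank, show LinearMap.range (W.starProjection : H →ₗ[ℂ] H) = W from
      W.range_starProjection, ← Module.finrank_eq_rank]
    exact_mod_cast hW
  · refine ContinuousLinearMap.opNorm_le_bound _ hc fun v => ?_
    rw [← Submodule.starProjection_orthogonal']
    refine (h _ (Submodule.starProjection_apply_mem _ _)).trans ?_
    gcongr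
    exact Submodule.norm_starProjection_apply_le _ _

lemma exists_submodule_of_singularValue_lt {A : H →L[ℂ] H} {k : ℕ} {c : ℝ}
    (h : singularValue A k < c) : ∃ W : Submodule ℂ H, FiniteDimensional ℂ W ∧
      Module.finrank ℂ W ≤ k ∧ ∀ w ∈ Wᗮ, ‖A w‖ ≤ c * ‖w‖ := by
  obtain ⟨_, ⟨P, hP, hrank, rfl⟩, hlt⟩ := exists_lt_of_csInf_lt
    (s := {r : ℝ | ∃ P : H →L[ℂ] H, IsStarProjection P ∧
      LinearMap.rank (P : H →ₗ[ℂ] H) ≤ (k : Cardinal) ∧ r = ‖A * (1 - P)‖})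
    ⟨_, 0, IsStarProjection.zero _, by simp [LinearMap.rank], rfl⟩ h
  rw [LinearMap.rank] at hrank
  have hfd : FiniteDimensional ℂ (LinearMap.range (P : H →ₗ[ℂ] H)) :=
    Module.rank_lt_aleph0_iff.1 (hrank.trans_lt (Cardinal.natCast_lt_aleph0))
  refine ⟨LinearMap.range (P : H →ₗ[ℂ] H), hfd, ?_, fun w hw => ?_⟩
  · rw [← Module.finrank_eq_rank] at hrank
    exact_mod_cast hrank
  · have hPw : P w = 0 := by
      have h1 : ⟪P (P w), w⟫_ℂ = 0 := hw _ ⟨P w, rfl⟩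
      have h2 : ⟪P w, P w⟫_ℂ = 0 := by
        rw [← h1]
        exact (hP.isSelfAdjoint.isSymmetric (P w) w).symm
      exact inner_self_eq_zero.1 h2
    have := (A * (1 - P)).le_of_opNorm_le hlt.le w
    simpa [hPw] using this

lemma singularValue_antitone (A : H →L[ℂ] H) : Antitone (singularValue A) := fun j k hjk => by
  refine le_of_forall_gt_imp_ge_of_dense fun c hc => ?_
  obtain ⟨W, _, hWj, hW⟩ := exists_submodule_of_singularValue_lt hc
  exact singularValue_le_of_forall_orthogonal W (hWj.trans hjk)
    ((singularValue_nonneg A j).trans hc.le) hW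

lemma singularValue_le_norm (A : H →L[ℂ] H) (k : ℕ) : singularValue A k ≤ ‖A‖ :=
  singularValue_le_of_forall_orthogonal ⊥ (by simp) (norm_nonneg A) fun w _ => A.le_opNorm w

/-- A Ky Fan type inequality. Near-optimal subspaces for the `A' k` have dimension at most `j` each;
their sum together with `V` has dimension at most `n * j + r`, and on its orthogonal complement all
the bounds add up. -/
lemma singularValue_le_sum_add {n : ℕ} {A : H →L[ℂ] H} {A' : Fin n → H →L[ℂ] H}
    (V : Submodule ℂ H) [FiniteDimensional ℂ V] {r : ℕ} (hV : Module.finrank ℂ V ≤ r)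
    {u : ℝ} (hu : 0 ≤ u) (h : ∀ v ∈ Vᗮ, ‖A v‖ ≤ ∑ k, ‖A' k v‖ + u * ‖v‖) (j : ℕ) :
    singularValue A (n * j + r) ≤ ∑ k, singularValue (A' k) j + u := by
  have key : ∀ e : ℝ, 0 < e → singularValue A (n * j + r) ≤
      ∑ k, (singularValue (A' k) j + e) + u := by
    intro e he
    choose W hWf hWj hW using fun k =>
      exists_submodule_of_singularValue_lt (lt_add_of_pos_right (singularValue (A' k) j) he)
    obtain ⟨U, _, hWU, hU⟩ := exists_submodule_ge_finrank_le_sum W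
    have hpos : ∀ k, 0 ≤ singularValue (A' k) j + e := fun k =>
      add_nonneg (singularValue_nonneg _ _) he.le
    refine singularValue_le_of_forall_orthogonal (U ⊔ V) ?_
      (add_nonneg (Finset.sum_nonneg fun k _ => hpos k) hu) fun w hw => ?_
    · refine (Submodule.finrank_add_le_finrank_add_finrank _ _).trans (add_le_add (hU.trans ?_) hV)
      refine (Finset.sum_le_card_nsmul _ _ j fun k _ => hWj k).trans ?_
      simp
    · refine (h w (Submodule.orthogonal_le le_sup_right hw)).trans ?_
      rw [add_mul, Finset.sum_mul]
      gcongr with k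
      exact hW k w (Submodule.orthogonal_le ((hWU k).trans le_sup_left) hw)
  have hlim : Tendsto (fun e : ℝ => ∑ k, (singularValue (A' k) j + e) + u) (𝓝[>] 0)
      (𝓝 (∑ k, (singularValue (A' k) j + 0) + u)) := by
    have : Continuous fun e : ℝ => ∑ k, (singularValue (A' k) j + e) + u := by fun_prop
    exact (this.tendsto 0).mono_left nhdsWithin_le_nhds
  simp only [add_zero] at hlim
  exact ge_of_tendsto hlim (by filter_upwards [self_mem_nhdsWithin] with e he using key e he)

lemma singularValue_add_le {A A' : H →L[ℂ] H} (V : Submodule ℂ H) [FiniteDimensional ℂ V] {r : ℕ}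
    (hV : Module.finrank ℂ V ≤ r) {u : ℝ} (hu : 0 ≤ u)
    (h : ∀ v ∈ Vᗮ, ‖A v‖ ≤ ‖A' v‖ + u * ‖v‖) (j : ℕ) :
    singularValue A (j + r) ≤ singularValue A' j + u := by
  have := singularValue_le_sum_add (n := 1) (A' := fun _ => A') V hV hu (by simpa using h) j
  simpa using this

lemma singularValue_congr {A B : H →L[ℂ] H} (h : ∀ v, ‖A v‖ = ‖B v‖) (k : ℕ) :
    singularValue A k = singularValue B k := by
  refine le_antisymm ?_ ?_
  · simpa using singularValue_add_le (A := A) (A' := B) ⊥ (r := 0) (by simp) le_rfl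
      (fun v _ => by simp [h]) k
  · simpa using singularValue_add_le (A := B) (A' := A) ⊥ (r := 0) (by simp) le_rfl
      (fun v _ => by simp [h]) k

lemma norm_singularSeq (A : H →L[ℂ] H) (k : ℕ) : ‖singularSeq A k‖ = singularValue A k := by
  rw [singularSeq, Complex.norm_real, Real.norm_of_nonneg (singularValue_nonneg A k)]

lemma bddAbove_singularSeq (A : H →L[ℂ] H) : BddAbove (range fun k => ‖singularSeq A k‖) :=
  ⟨‖A‖, by rintro _ ⟨k, rfl⟩; exact (norm_singularSeq A k).trans_le (singularValue_le_norm A k)⟩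

/-- Small singular values make `A` a norm limit of the finite-rank operators obtained by projecting
first onto the approximating subspaces. -/
lemma isCompactOperator_of_singularValue_lt {A : H →L[ℂ] H}
    (h : ∀ e : ℝ, 0 < e → ∃ k, singularValue A k < e) : IsCompactOperator A := by
  have h' : ∀ m : ℕ, ∃ W : Submodule ℂ H, FiniteDimensional ℂ W ∧
      ∀ w ∈ Wᗮ, ‖A w‖ ≤ 1 / ((m : ℝ) + 1) * ‖w‖ := fun m => by
    obtain ⟨k, hk⟩ := h (1 / ((m : ℝ) + 1)) (by positivity)
    obtain ⟨W, hWf, -, hW⟩ := exists_submodule_of_singularValue_lt hk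
    exact ⟨W, hWf, hW⟩
  choose W hWf hW using h'
  have hlim : Tendsto (fun m => A * (W m).starProjection) atTop (𝓝 A) := by
    rw [tendsto_iff_norm_sub_tendsto_zero]
    refine squeeze_zero (fun _ => norm_nonneg _) (fun m => ?_) tendsto_one_div_add_atTop_nhds_zero_nat
    refine ContinuousLinearMap.opNorm_le_bound _ (by positivity) fun v => ?_
    have h1 := hW m _ (Submodule.starProjection_apply_mem (W m)ᗮ v)
    rw [Submodule.starProjection_orthogonal'] at h1
    have h2 : ‖(1 - (W m).starProjection) v‖ ≤ ‖v‖ := by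
      rw [← Submodule.starProjection_orthogonal']
      exact Submodule.norm_starProjection_apply_le _ _
    calc ‖(A * (W m).starProjection - A) v‖ = ‖A ((1 - (W m).starProjection) v)‖ := by
          rw [← norm_neg]; simp
      _ ≤ _ := h1.trans (by gcongr)
  refine isCompactOperator_of_tendsto hlim (Eventually.of_forall fun m => ?_)
  have : ProperSpace (W m) := FiniteDimensional.proper ℂ _
  have hP : IsCompactOperator ((W m).subtypeL ∘L (W m).orthogonalProjectionOnto) :=
    (isCompactOperator_of_locallyCompactSpace_dom
      (W m).orthogonalProjectionOnto).clm_comp (W m).subtypeL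
  exact hP.clm_comp A

end SingularValues

/-! ### Sums depending only on a counting function -/

section Rearrangement

lemma tsum_ofReal_eq_lintegral_encard {ι : Type*} {c : ι → ℝ} (hc : ∀ i, 0 ≤ c i) :
    ∑' i, ENNReal.ofReal (c i) =
      ∫⁻ t in Ioi (0 : ℝ), (({i | t < c i}.encard : ℕ∞) : ℝ≥0∞) := by
  let _ : MeasurableSpace ι := ⊤
  rw [← lintegral_count, lintegral_eq_lintegral_meas_lt _ (ae_of_all _ hc)
    measurable_from_top.aemeasurable]
  refine lintegral_congr fun t => ?_
  rw [Measure.count_apply MeasurableSpace.measurableSet_top]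

/-- By the layer cake formula only superlevel sets of `F` matter. For monotone continuous `F` these
are half-lines `x > c` with `c` the largest solution of `F x ≤ t`, or empty, so the counting
functions of `a` and `b` decide. -/
lemma tsum_ofReal_eq_of_encard_eq {ι κ : Type*} {a : ι → ℝ} {b : κ → ℝ} (ha : ∀ i, 0 ≤ a i)
    (hb : ∀ k, 0 ≤ b k) (h : ∀ t, 0 ≤ t → {i | t < a i}.encard = {k | t < b k}.encard)
    {F : ℝ → ℝ} (hF0 : F 0 = 0) (hFm : MonotoneOn F (Ici 0)) (hFc : ContinuousOn F (Ici 0)) :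
    ∑' i, ENNReal.ofReal (F (a i)) = ∑' k, ENNReal.ofReal (F (b k)) := by
  have hFn : ∀ x, 0 ≤ x → 0 ≤ F x := fun x hx => hF0.symm.le.trans (hFm self_mem_Ici hx hx)
  rw [tsum_ofReal_eq_lintegral_encard fun i => hFn _ (ha i),
    tsum_ofReal_eq_lintegral_encard fun k => hFn _ (hb k)]
  refine setLIntegral_congr_fun measurableSet_Ioi fun t ht => ?_
  have ht : 0 < t := ht
  congr 1
  by_cases hbdd : BddAbove {x | 0 ≤ x ∧ F x ≤ t}
  · set c := sSup {x | 0 ≤ x ∧ F x ≤ t}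
    have hmem0 : (0 : ℝ) ∈ {x | 0 ≤ x ∧ F x ≤ t} := ⟨le_rfl, hF0.trans_le ht.le⟩
    have hc0 : 0 ≤ c := le_csSup hbdd hmem0
    have hclosed : IsClosed {x | 0 ≤ x ∧ F x ≤ t} :=
      hFc.preimage_isClosed_of_isClosed isClosed_Ici isClosed_Iic
    have hc : c ∈ {x | 0 ≤ x ∧ F x ≤ t} := hclosed.csSup_mem ⟨0, hmem0⟩ hbdd
    have hiff : ∀ x, 0 ≤ x → (t < F x ↔ c < x) := fun x hx => by
      constructor
      · intro h
        by_contra! hle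
        exact absurd ((hFm hx hc0 hle).trans hc.2) (not_le.2 h)
      · intro h
        by_contra! hle
        exact absurd (le_csSup hbdd ⟨hx, hle⟩) (not_le.2 h)
    simp only [hiff _ (ha _), hiff _ (hb _)]
    exact h c hc0
  · have hle : ∀ x, 0 ≤ x → ¬ t < F x := fun x hx hlt => hbdd ⟨x, fun y hy => by
      by_contra! hxy
      exact absurd ((hFm hx hy.1 hxy.le).trans hy.2) (not_le.2 hlt)⟩
    simp only [hle _ (ha _), hle _ (hb _)]
    simp

end Rearrangement

/-! ### Eigenbases of the modulus of a compact operator -/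

section SingularBasis

universe u

variable {H : Type u} [NormedAddCommGroup H] [InnerProductSpace ℂ H]

lemma HilbertBasis.hasSum_norm_sq {ι : Type*} (e : HilbertBasis ι ℂ H) (v : H) :
    HasSum (fun i => ‖⟪e i, v⟫_ℂ‖ ^ 2) (‖v‖ ^ 2) := by
  have h := e.hasSum_inner_mul_inner v v
  have h1 : ∀ i, ⟪v, e i⟫_ℂ * ⟪e i, v⟫_ℂ = ((‖⟪e i, v⟫_ℂ‖ ^ 2 : ℝ) : ℂ) := fun i => by
    rw [← inner_conj_symm, ← Complex.normSq_eq_conj_mul_self, Complex.normSq_eq_norm_sq]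
  have h2 : ⟪v, v⟫_ℂ = ((‖v‖ ^ 2 : ℝ) : ℂ) := by
    rw [inner_self_eq_norm_sq_to_K]; simp
  simp only [h1, h2] at h
  exact Complex.hasSum_ofReal.1 h

lemma HilbertBasis.tsum_ofReal_norm_sq {ι : Type*} (e : HilbertBasis ι ℂ H) (v : H) :
    ∑' i, ENNReal.ofReal (‖⟪e i, v⟫_ℂ‖ ^ 2) = ENNReal.ofReal (‖v‖ ^ 2) := by
  rw [← (e.hasSum_norm_sq v).tsum_eq,
    ENNReal.ofReal_tsum_of_nonneg (fun _ => by positivity) (e.hasSum_norm_sq v).summable]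

variable [CompleteSpace H]

/-- Orthonormal bases of the eigenspaces are put together; they are total because the eigenspaces of
a compact self-adjoint operator span a dense subspace. -/
lemma exists_hilbertBasis_of_isCompactOperator {T : H →L[ℂ] H} (hT : IsCompactOperator T)
    (hT' : IsSelfAdjoint T) : ∃ (ι : Type u) (e : HilbertBasis ι ℂ H) (b : ι → ℝ),
      ∀ i, T (e i) = (b i : ℂ) • e i := by
  have hsym : (T : H →ₗ[ℂ] H).IsSymmetric := hT'.isSymmetric
  set E : ℂ → Submodule ℂ H := fun μ => Module.End.eigenspace (T : H →ₗ[ℂ] H) μ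
  have hcl : ∀ μ, IsClosed (E μ : Set H) := fun μ => by
    have : (E μ : Set H) = {v | T v = μ • v} := by
      ext v; exact Module.End.mem_eigenspace_iff
    rw [this]
    exact isClosed_eq T.continuous (continuous_const_smul μ)
  have hcomp : ∀ μ, CompleteSpace (E μ) := fun μ => (hcl μ).completeSpace_coe
  choose w b hb using fun μ => exists_hilbertBasis ℂ (E μ)
  have hfam := hsym.orthogonalFamily_eigenspaces
  have hon : Orthonormal ℂ fun a : Σ μ, w μ => ((b a.1 a.2 : E a.1) : H) :=
    hfam.orthonormal_sigma_orthonormal fun μ => (b μ).orthonormal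
  have hbot : (Submodule.span ℂ (range fun a : Σ μ, w μ => ((b a.1 a.2 : E a.1) : H)))ᗮ = ⊥ := by
    rw [eq_bot_iff, ← ContinuousLinearMap.orthogonalComplement_iSup_eigenspaces_eq_bot hT hsym,
      ← Submodule.iInf_orthogonal]
    intro v hv
    rw [Submodule.mem_iInf]
    intro μ x hx
    have h1 : ∀ i : w μ, ⟪((b μ i : E μ) : H), v⟫_ℂ = 0 := fun i =>
      hv _ (Submodule.subset_span ⟨⟨μ, i⟩, rfl⟩)
    have h2 : ((E μ).orthogonalProjectionOnto v) = 0 := by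
      have := (b μ).hasSum_orthogonalProjectionOnto v
      simp only [h1, zero_smul] at this
      exact this.unique hasSum_zero
    exact ((Submodule.orthogonalProjectionOnto_eq_zero_iff).1 h2) x hx
  refine ⟨_, HilbertBasis.mkOfOrthogonalEqBot hon hbot,
    fun a => RCLike.re ⟪((b a.1 a.2 : E a.1) : H), T (b a.1 a.2 : E a.1)⟫_ℂ, fun a => ?_⟩
  rw [HilbertBasis.coe_mkOfOrthogonalEqBot]
  have h1 : T ((b a.1 a.2 : E a.1) : H) = a.1 • ((b a.1 a.2 : E a.1) : H) :=
    Module.End.mem_eigenspace_iff.1 (b a.1 a.2).2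
  have h3 : ⟪((b a.1 a.2 : E a.1) : H), ((b a.1 a.2 : E a.1) : H)⟫_ℂ = 1 := by
    rw [inner_self_eq_norm_sq_to_K, hon.1 a]; simp
  have h2 : ((RCLike.re ⟪((b a.1 a.2 : E a.1) : H), T (b a.1 a.2 : E a.1)⟫_ℂ : ℝ) : ℂ) =
      ⟪((b a.1 a.2 : E a.1) : H), T (b a.1 a.2 : E a.1)⟫_ℂ := hsym.coe_re_inner_self_apply _
  rw [h2]
  conv_rhs => rw [h1, inner_smul_right, h3, mul_one]
  exact h1

/-- `e` is an orthonormal basis of eigenvectors of `|A|`, with eigenvalues `s`. -/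
structure IsSingularBasis {ι : Type*} (A : H →L[ℂ] H) (e : HilbertBasis ι ℂ H) (s : ι → ℝ) :
    Prop where
  nonneg : ∀ i, 0 ≤ s i
  apply : ∀ i, (star A * A) (e i) = ((s i ^ 2 : ℝ) : ℂ) • e i

lemma exists_isSingularBasis {A : H →L[ℂ] H} (hA : IsCompactOperator A) :
    ∃ (ι : Type u) (e : HilbertBasis ι ℂ H) (s : ι → ℝ), IsSingularBasis A e s := by
  obtain ⟨ι, e, b, hb⟩ := exists_hilbertBasis_of_isCompactOperator (T := star A * A)
    (hA.clm_comp (star A)) (IsSelfAdjoint.star_mul_self A)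
  refine ⟨ι, e, fun i => ‖A (e i)‖, fun i => norm_nonneg _, fun i => ?_⟩
  rw [hb i]
  congr 1
  have h1 : ⟪e i, (star A * A) (e i)⟫_ℂ = ((‖A (e i)‖ ^ 2 : ℝ) : ℂ) := by
    rw [mul_apply_eq_comp, ContinuousLinearMap.star_eq_adjoint,
      ContinuousLinearMap.adjoint_inner_right, inner_self_eq_norm_sq_to_K]
    simp
  rw [hb i, inner_smul_right, inner_self_eq_norm_sq_to_K, e.orthonormal.1 i] at h1
  simpa using h1

namespace IsSingularBasis

variable {ι : Type*} {A : H →L[ℂ] H} {e : HilbertBasis ι ℂ H} {s : ι → ℝ}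

lemma of_isSelfAdjoint {T : H →L[ℂ] H} (hT : IsSelfAdjoint T) (hs : ∀ i, 0 ≤ s i)
    (h : ∀ i, T (e i) = (s i : ℂ) • e i) : IsSingularBasis T e s where
  nonneg := hs
  apply i := by
    rw [hT.star_eq, mul_apply_eq_comp, h, map_smul, h, smul_smul]
    push_cast
    ring_nf

variable (h : IsSingularBasis A e s)
include h

/-- Parseval for `⟪v, |A| ^ 2 v⟫`. Applying Jensen to the weights `‖⟪e i, v⟫‖ ^ 2` is how the
exponent `2` separates the roles of `p` and `q`. -/
lemma hasSum_norm_sq (v : H) :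
    HasSum (fun i => s i ^ 2 * ‖⟪e i, v⟫_ℂ‖ ^ 2) (‖A v‖ ^ 2) := by
  have hs := e.hasSum_inner_mul_inner v ((star A * A) v)
  have hadj : ∀ x y, ⟪x, (star A * A) y⟫_ℂ = ⟪A x, A y⟫_ℂ := fun x y => by
    rw [mul_apply_eq_comp, ContinuousLinearMap.star_eq_adjoint,
      ContinuousLinearMap.adjoint_inner_right]
  have hadj' : ∀ x y, ⟪(star A * A) x, y⟫_ℂ = ⟪A x, A y⟫_ℂ := fun x y => by
    rw [mul_apply_eq_comp, ContinuousLinearMap.star_eq_adjoint,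
      ContinuousLinearMap.adjoint_inner_left]
  have h1 : ∀ i, ⟪v, e i⟫_ℂ * ⟪e i, (star A * A) v⟫_ℂ =
      ((s i ^ 2 * ‖⟪e i, v⟫_ℂ‖ ^ 2 : ℝ) : ℂ) := fun i => by
    rw [hadj, ← hadj', h.apply, inner_smul_left, Complex.conj_ofReal, mul_left_comm,
      ← inner_conj_symm v, ← Complex.normSq_eq_conj_mul_self, Complex.normSq_eq_norm_sq]
    push_cast
    rfl
  have h2 : ⟪v, (star A * A) v⟫_ℂ = ((‖A v‖ ^ 2 : ℝ) : ℂ) := by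
    rw [hadj, inner_self_eq_norm_sq_to_K]; simp
  simp only [h1, h2] at hs
  exact Complex.hasSum_ofReal.1 hs

lemma norm_apply (i : ι) : ‖A (e i)‖ = s i := by
  have h1 : ⟪e i, (star A * A) (e i)⟫_ℂ = ((‖A (e i)‖ ^ 2 : ℝ) : ℂ) := by
    rw [mul_apply_eq_comp, ContinuousLinearMap.star_eq_adjoint,
      ContinuousLinearMap.adjoint_inner_right, inner_self_eq_norm_sq_to_K]
    simp
  rw [h.apply i, inner_smul_right, inner_self_eq_norm_sq_to_K, e.orthonormal.1 i] at h1
  have h2 : s i ^ 2 = ‖A (e i)‖ ^ 2 := by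
    have : ((s i ^ 2 : ℝ) : ℂ) = ((‖A (e i)‖ ^ 2 : ℝ) : ℂ) := by simpa using h1
    exact_mod_cast this
  exact ((sq_eq_sq₀ (h.nonneg i) (norm_nonneg _)).1 h2).symm

/-- The span of the `k + 1` basis vectors meets the orthogonal complement of any subspace of
dimension at most `k`. On that span `A` expands norms by at least the smallest of the `s i`. -/
lemma lt_singularValue {t : ℝ} {k : ℕ} (J : Finset ι) (hJ : J.card = k + 1)
    (ht : ∀ i ∈ J, t < s i) : t < singularValue A k := by
  have hne : J.Nonempty := Finset.card_pos.1 (by lia)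
  obtain ⟨i₀, hi₀, hmin⟩ := J.exists_min_image s hne
  refine (ht i₀ hi₀).trans_le (le_of_forall_gt_imp_ge_of_dense fun c hc => ?_)
  obtain ⟨W, _, hWk, hW⟩ := exists_submodule_of_singularValue_lt hc
  set U := Submodule.span ℂ (range fun i : J => e i)
  have : FiniteDimensional ℂ U := FiniteDimensional.span_of_finite ℂ (finite_range _)
  have hUlin : LinearIndependent ℂ fun i : J => e i :=
    e.orthonormal.linearIndependent.comp _ Subtype.val_injective
  have hU : Module.finrank ℂ U = k + 1 := by
    rw [finrank_span_eq_card hUlin, Fintype.card_coe, hJ]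
  have : ∃ v ∈ U, v ≠ 0 ∧ v ∈ Wᗮ := by
    let f : U →ₗ[ℂ] W := (W.orthogonalProjectionOnto : H →ₗ[ℂ] W) ∘ₗ U.subtype
    have hlt : Module.finrank ℂ W < Module.finrank ℂ U := by lia
    obtain ⟨x, hx, hx0⟩ := (Submodule.ne_bot_iff _).1 (LinearMap.ker_ne_bot_of_finrank_lt (f := f) hlt)
    refine ⟨x, x.2, by simpa using hx0, ?_⟩
    exact (Submodule.orthogonalProjectionOnto_eq_zero_iff).1 hx
  obtain ⟨v, hvU, hv0, hvW⟩ := this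
  have hout : ∀ i ∉ J, ⟪e i, v⟫_ℂ = 0 := fun i hi => by
    have hle : U ≤ (Submodule.span ℂ {e i})ᗮ := by
      rw [Submodule.span_le]
      rintro _ ⟨j, rfl⟩
      exact Submodule.mem_orthogonal_singleton_iff_inner_right.2
        (e.orthonormal.2 fun h => hi (h ▸ j.2))
    exact Submodule.mem_orthogonal_singleton_iff_inner_right.1 (hle hvU)
  have hlow : s i₀ ^ 2 * ‖v‖ ^ 2 ≤ ‖A v‖ ^ 2 := by
    refine hasSum_le (fun i => ?_) ((e.hasSum_norm_sq v).mul_left _) (h.hasSum_norm_sq v)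
    by_cases hi : i ∈ J
    · have := h.nonneg i₀
      gcongr
      exact hmin i hi
    · simp [hout i hi]
  rw [← mul_pow] at hlow
  have h1 := (sq_le_sq₀ (mul_nonneg (h.nonneg i₀) (norm_nonneg v)) (norm_nonneg _)).1 hlow
  exact le_of_mul_le_mul_right (h1.trans (hW v hvW)) (norm_pos_iff.2 hv0)

lemma singularValue_le {t : ℝ} (ht : 0 ≤ t) {k : ℕ} (J : Finset ι) (hJ : J.card ≤ k)
    (hs : ∀ i ∉ J, s i ≤ t) : singularValue A k ≤ t := by
  classical
  set W := Submodule.span ℂ ((J.image e : Finset H) : Set H)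
  have hW : Module.finrank ℂ W ≤ k :=
    (finrank_span_finset_le_card _).trans (Finset.card_image_le.trans hJ)
  refine singularValue_le_of_forall_orthogonal W hW ht fun w hw => ?_
  have hin : ∀ i ∈ J, ⟪e i, w⟫_ℂ = 0 := fun i hi =>
    hw _ (Submodule.subset_span (Finset.mem_coe.2 (Finset.mem_image_of_mem _ hi)))
  have hle : ‖A w‖ ^ 2 ≤ t ^ 2 * ‖w‖ ^ 2 := by
    refine hasSum_le (fun i => ?_) (h.hasSum_norm_sq w) ((e.hasSum_norm_sq w).mul_left _)
    by_cases hi : i ∈ J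
    · simp [hin i hi]
    · have := h.nonneg i
      gcongr
      exact hs i hi
  rw [← mul_pow] at hle
  exact (sq_le_sq₀ (norm_nonneg _) (mul_nonneg ht (norm_nonneg w))).1 hle

/-- Either cardinality is at least `k + 1` exactly when `t < singularValue A k`. Comparing counting
functions avoids ordering the family `s`, whose index type is arbitrary. -/
lemma encard_singularValue {t : ℝ} (ht : 0 ≤ t) :
    {k | t < singularValue A k}.encard = {i | t < s i}.encard := by
  have h1 : ∀ k : ℕ, t < singularValue A k ↔ ((k + 1 : ℕ) : ℕ∞) ≤ {i | t < s i}.encard := by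
    intro k
    constructor
    · intro hk
      by_contra! hlt
      have hfin : {i | t < s i}.Finite := finite_of_encard_le_coe hlt.le
      refine absurd (h.singularValue_le ht hfin.toFinset (k := k) ?_ ?_) (not_le.2 hk)
      · rw [hfin.encard_eq_coe_toFinset_card] at hlt
        have : hfin.toFinset.card < k + 1 := by exact_mod_cast hlt
        lia
      · intro i hi
        simpa using hi
    · intro hk
      obtain ⟨J, hJ, hJc⟩ := exists_subset_encard_eq hk
      have hfin : J.Finite := finite_of_encard_eq_coe hJc
      refine h.lt_singularValue hfin.toFinset ?_ fun i hi => hJ (by simpa using hi)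
      rw [hfin.encard_eq_coe_toFinset_card] at hJc
      exact_mod_cast hJc
  have h2 : ∀ k : ℕ, t < singularValue A k ↔
      ((k + 1 : ℕ) : ℕ∞) ≤ {k | t < singularValue A k}.encard := by
    intro k
    constructor
    · intro hk
      have hsub : (Finset.range (k + 1) : Set ℕ) ⊆ {k | t < singularValue A k} := fun j hj => by
        have hj : j < k + 1 := by simpa using hj
        exact lt_of_lt_of_le hk (singularValue_antitone A (by lia))
      have := encard_le_encard hsub
      rwa [encard_coe_eq_coe_finsetCard, Finset.card_range] at this
    · intro hk
      by_contra hlt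
      have hsub : {k | t < singularValue A k} ⊆ (Finset.range k : Set ℕ) := fun j hj => by
        rw [Finset.coe_range, mem_Iio]
        by_contra! hkj
        exact hlt (lt_of_lt_of_le hj (singularValue_antitone A hkj))
      have := hk.trans (encard_le_encard hsub)
      rw [encard_coe_eq_coe_finsetCard, Finset.card_range] at this
      have : k + 1 ≤ k := by exact_mod_cast this
      lia
  refine ENat.eq_of_forall_natCast_le_iff fun m => ?_
  cases m with
  | zero => simp
  | succ k => rw [← h1, ← h2]

lemma tsum_singularValue {F : ℝ → ℝ} (hF0 : F 0 = 0) (hFm : MonotoneOn F (Ici 0))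
    (hFc : ContinuousOn F (Ici 0)) :
    ∑' k, ENNReal.ofReal (F (singularValue A k)) = ∑' i, ENNReal.ofReal (F (s i)) :=
  tsum_ofReal_eq_of_encard_eq (singularValue_nonneg A) h.nonneg
    (fun _ ht => h.encard_singularValue ht) hF0 hFm hFc

lemma modular_singularSeq {N : ℝ → ℝ} (hN : IsOrliczFunction N) {r : ℝ} (hr : 0 < r) :
    modular N (singularSeq A) r = ∑' i, ENNReal.ofReal (N (s i / r)) := by
  simp only [modular, norm_singularSeq]
  refine h.tsum_singularValue (F := fun x => N (x / r)) (by simp [hN.map_zero]) ?_ ?_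
  · intro x hx y _ hxy
    have hx : 0 ≤ x := hx
    exact hN.mono (by positivity) (by gcongr)
  · exact (hN.continuous.comp (continuous_id.div_const r)).continuousOn

end IsSingularBasis

end SingularBasis

/-! ### Functional calculus on eigenvectors -/

section FunctionalCalculus

variable {H : Type*} [NormedAddCommGroup H] [InnerProductSpace ℂ H]

lemma mem_spectrum_of_apply_eq_smul {A : H →L[ℂ] H} {v : H} (hv0 : v ≠ 0) {a : ℝ}
    (hv : A v = (a : ℂ) • v) : a ∈ spectrum ℝ A := by
  rw [spectrum.mem_iff]
  rintro ⟨U, hU⟩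
  have h1 : (U : H →L[ℂ] H) v = 0 := by
    rw [hU, Algebra.algebraMap_eq_smul_one]
    simp [hv]
  apply hv0
  have h2 : ((U⁻¹ : (H →L[ℂ] H)ˣ) : H →L[ℂ] H) ((U : H →L[ℂ] H) v) = v := by
    rw [← mul_apply_eq_comp, Units.inv_mul]
    rfl
  rw [← h2, h1, map_zero]

variable [CompleteSpace H]

/-- The claim is stable under sums, products and uniform limits, hence follows from the
Stone–Weierstrass induction. -/
lemma cfc_apply_of_apply_eq_smul {A : H →L[ℂ] H} (hA : IsSelfAdjoint A) {v : H} {a : ℝ}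
    (hv : A v = (a : ℂ) • v) {f : ℝ → ℝ} (hf : ContinuousOn f (spectrum ℝ A)) :
    cfc f A v = (f a : ℂ) • v := by
  rcases eq_or_ne v 0 with rfl | hv0
  · simp
  have ha := mem_spectrum_of_apply_eq_smul hv0 hv
  rw [cfc_apply f A hA hf]
  have key : ∀ g : C(spectrum ℝ A, ℝ), cfcHom hA g v = ((g ⟨a, ha⟩ : ℝ) : ℂ) • v := by
    intro g
    induction g using ContinuousMap.induction_on_of_compact with
    | const r =>
      have : (ContinuousMap.const (spectrum ℝ A) r) = algebraMap ℝ C(spectrum ℝ A, ℝ) r := rfl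
      rw [this, AlgHomClass.commutes, Algebra.algebraMap_eq_smul_one]
      simp
    | id =>
      rw [cfcHom_id hA, hv]
      rfl
    | star_id =>
      rw [map_star, cfcHom_id hA, hA.star_eq, hv]
      rfl
    | add f g hf hg => simp [hf, hg, add_smul]
    | mul f g hf hg =>
      rw [map_mul, mul_apply_eq_comp, hg, map_smul, hf, smul_smul, ContinuousMap.mul_apply,
        Complex.ofReal_mul, mul_comm]
    | frequently f h =>
      refine h.mem_of_closed (isClosed_eq ?_ ?_)
      · exact ((ContinuousLinearMap.apply ℂ H v).continuous).comp (cfcHom_continuous hA)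
      · exact (Complex.continuous_ofReal.comp (ContinuousEvalConst.continuous_eval_const _)).smul
          continuous_const
  exact key _

lemma rpow_apply_of_apply_eq_smul {A : H →L[ℂ] H} (hA : 0 ≤ A) {v : H} {a y : ℝ} (hy : 0 ≤ y)
    (hv : A v = (a : ℂ) • v) : CFC.rpow A y v = ((a ^ y : ℝ) : ℂ) • v := by
  rw [CFC.rpow_eq_pow, CFC.rpow_eq_cfc_real hA]
  exact cfc_apply_of_apply_eq_smul (IsSelfAdjoint.of_nonneg hA) hv
    (Real.continuous_rpow_const hy).continuousOn

lemma abs_apply_of_star_mul_self_apply {A : H →L[ℂ] H} {v : H} {s : ℝ} (hs : 0 ≤ s)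
    (hv : (star A * A) v = ((s ^ 2 : ℝ) : ℂ) • v) : CFC.abs A v = (s : ℂ) • v := by
  rw [CFC.abs, CFC.sqrt_eq_rpow, ← CFC.rpow_eq_pow,
    rpow_apply_of_apply_eq_smul (star_mul_self_nonneg A) (by norm_num) hv, ← Real.sqrt_eq_rpow,
    Real.sqrt_sq hs]

lemma norm_abs_apply (A : H →L[ℂ] H) (v : H) : ‖CFC.abs A v‖ = ‖A v‖ := by
  have h : ∀ B : H →L[ℂ] H, ((‖B v‖ ^ 2 : ℝ) : ℂ) = ⟪v, (star B * B) v⟫_ℂ := fun B => by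
    rw [mul_apply_eq_comp, ContinuousLinearMap.star_eq_adjoint,
      ContinuousLinearMap.adjoint_inner_right, inner_self_eq_norm_sq_to_K]
    simp
  have h1 := h (CFC.abs A)
  have h0 : (0 : H →L[ℂ] H) ≤ CFC.abs A := CFC.abs_nonneg A
  rw [(IsSelfAdjoint.of_nonneg h0).star_eq, CFC.abs_mul_abs, ← h A] at h1
  have h2 : ‖CFC.abs A v‖ ^ 2 = ‖A v‖ ^ 2 := by exact_mod_cast h1
  exact (sq_eq_sq₀ (norm_nonneg _) (norm_nonneg _)).1 h2

/-- For `s ≥ 1` the power factors as `A * A ^ (s - 1)`, and compact operators form an ideal. -/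
lemma isCompactOperator_rpow {A : H →L[ℂ] H} (hA : 0 ≤ A) (h : IsCompactOperator A) {s : ℝ}
    (hs : 1 ≤ s) : IsCompactOperator (CFC.rpow A s : H →L[ℂ] H) := by
  have h1 : CFC.rpow A s = A * CFC.rpow A (s - 1) := by
    have hc : Continuous fun x : ℝ≥0 => x ^ (s - 1) :=
      NNReal.continuous_rpow_const (by linarith)
    calc CFC.rpow A s = cfc (fun x : ℝ≥0 => x * x ^ (s - 1)) A := by
          rw [CFC.rpow]
          congr 1
          ext x
          rcases eq_or_ne x 0 with rfl | hx
          · simp [NNReal.zero_rpow (by linarith : s ≠ 0)]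
          · rw [← NNReal.rpow_one_add' (by linarith), add_sub_cancel]
      _ = cfc (fun x : ℝ≥0 => x) A * cfc (fun x : ℝ≥0 => x ^ (s - 1)) A :=
          cfc_mul _ _ A continuousOn_id hc.continuousOn
      _ = A * CFC.rpow A (s - 1) := by rw [cfc_id' ℝ≥0 A]; rfl
  rw [h1]
  exact h.comp_clm (CFC.rpow A (s - 1))

end FunctionalCalculus

/-! ### Jensen's inequality for diagonal entries -/

section TraceJensen

variable {H : Type*} [NormedAddCommGroup H] [InnerProductSpace ℂ H]

lemma hasSum_re_inner_of_isSymmetric {κ : Type*} {Y : H →L[ℂ] H} (hY : (Y : H →ₗ[ℂ] H).IsSymmetric)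
    {f : HilbertBasis κ ℂ H} {t : κ → ℝ} (h : ∀ j, Y (f j) = (t j : ℂ) • f j) (v : H) :
    HasSum (fun j => ‖⟪f j, v⟫_ℂ‖ ^ 2 * t j) (RCLike.re ⟪v, Y v⟫_ℂ) := by
  have hs := f.hasSum_inner_mul_inner v (Y v)
  have h1 : ∀ j, ⟪v, f j⟫_ℂ * ⟪f j, Y v⟫_ℂ = ((‖⟪f j, v⟫_ℂ‖ ^ 2 * t j : ℝ) : ℂ) := fun j => by
    have h2 : ⟪f j, Y v⟫_ℂ = (t j : ℂ) * ⟪f j, v⟫_ℂ := by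
      have := hY (f j) v
      simp only [ContinuousLinearMap.coe_coe] at this
      rw [← this, h, inner_smul_left, Complex.conj_ofReal]
    rw [h2, ← inner_conj_symm v, mul_left_comm, ← Complex.normSq_eq_conj_mul_self,
      Complex.normSq_eq_norm_sq]
    push_cast
    ring
  simp only [h1] at hs
  have h3 := Complex.hasSum_re hs
  simp only [Complex.ofReal_re] at h3
  exact h3

lemma HilbertBasis.tsum_ofReal_norm_sq_symm {ι : Type*} (e : HilbertBasis ι ℂ H) (v : H) :
    ∑' i, ENNReal.ofReal (‖⟪v, e i⟫_ℂ‖ ^ 2) = ENNReal.ofReal (‖v‖ ^ 2) := by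
  rw [← e.tsum_ofReal_norm_sq v]
  simp only [norm_inner_symm v]

variable {ι κ : Type*} {Y : H →L[ℂ] H} {f : HilbertBasis κ ℂ H} {t : κ → ℝ} {F : ℝ → ℝ}

/-- The diagonal entry is `∑ j, ‖⟪f j, e i⟫‖ ^ 2 * t j`, and these weights form a doubly stochastic
matrix: Jensen uses the row sums, interchanging the summations uses the column sums. -/
lemma ConvexOn.tsum_inner_le (hF : ConvexOn ℝ (Ici 0) F) (h0 : F 0 = 0)
    (hF0 : ∀ t, 0 ≤ t → 0 ≤ F t) (hFc : ContinuousOn F (Ici 0))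
    (hY : (Y : H →ₗ[ℂ] H).IsSymmetric) (ht : ∀ j, 0 ≤ t j) (h : ∀ j, Y (f j) = (t j : ℂ) • f j)
    (e : HilbertBasis ι ℂ H) {c : ℝ} (hc : 0 ≤ c) :
    ∑' i, ENNReal.ofReal (F (c * RCLike.re ⟪e i, Y (e i)⟫_ℂ)) ≤
      ∑' j, ENNReal.ofReal (F (c * t j)) := by
  calc _ ≤ ∑' i, ∑' j, ENNReal.ofReal (‖⟪f j, e i⟫_ℂ‖ ^ 2) * ENNReal.ofReal (F (c * t j)) := by
        refine ENNReal.tsum_le_tsum fun i => hF.ofReal_map_le_tsum h0 hF0 hFc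
          (fun _ => by positivity) ?_ (fun j => mul_nonneg hc (ht j)) ?_
        · rw [f.tsum_ofReal_norm_sq, e.orthonormal.1 i]; simp
        · have := (hasSum_re_inner_of_isSymmetric hY h (e i)).mul_left c
          simpa only [mul_left_comm] using this
    _ = ∑' j, ENNReal.ofReal (F (c * t j)) := by
        rw [ENNReal.tsum_comm]
        refine tsum_congr fun j => ?_
        rw [ENNReal.tsum_mul_right, e.tsum_ofReal_norm_sq_symm, f.orthonormal.1 j]; simp

lemma ConcaveOn.le_tsum_inner (hF : ConcaveOn ℝ (Ici 0) F) (h0 : F 0 = 0)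
    (hF0 : ∀ t, 0 ≤ t → 0 ≤ F t) (hFm : MonotoneOn F (Ici 0))
    (hY : (Y : H →ₗ[ℂ] H).IsSymmetric) (ht : ∀ j, 0 ≤ t j) (h : ∀ j, Y (f j) = (t j : ℂ) • f j)
    (e : HilbertBasis ι ℂ H) {c : ℝ} (hc : 0 ≤ c) :
    ∑' j, ENNReal.ofReal (F (c * t j)) ≤
      ∑' i, ENNReal.ofReal (F (c * RCLike.re ⟪e i, Y (e i)⟫_ℂ)) := by
  calc ∑' j, ENNReal.ofReal (F (c * t j))
      = ∑' i, ∑' j, ENNReal.ofReal (‖⟪f j, e i⟫_ℂ‖ ^ 2) * ENNReal.ofReal (F (c * t j)) := by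
        rw [ENNReal.tsum_comm]
        refine tsum_congr fun j => ?_
        rw [ENNReal.tsum_mul_right, e.tsum_ofReal_norm_sq_symm, f.orthonormal.1 j]; simp
    _ ≤ _ := by
        refine ENNReal.tsum_le_tsum fun i => hF.tsum_le_ofReal_map h0 hF0 hFm
          (fun _ => by positivity) ?_ (fun j => mul_nonneg hc (ht j)) ?_
        · rw [f.tsum_ofReal_norm_sq, e.orthonormal.1 i]; simp
        · have := (hasSum_re_inner_of_isSymmetric hY h (e i)).mul_left c
          simpa only [mul_left_comm] using this

end TraceJensen

/-! ### Convexity and concavity of the Orlicz ideal -/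

section IdealConvexity

universe u

variable {H : Type u} [NormedAddCommGroup H] [InnerProductSpace ℂ H]

lemma isCompactOperator_sum {n : ℕ} {B : Fin n → H →L[ℂ] H} (h : ∀ k, IsCompactOperator (B k)) :
    IsCompactOperator (∑ k, B k : H →L[ℂ] H) := by
  have : (∑ k, B k) ∈ compactOperator (RingHom.id ℂ) H H := Submodule.sum_mem _ fun k _ => h k
  exact this

variable [CompleteSpace H]
variable {M N : ℝ → ℝ} {p q : ℝ}

/-- Singular values bounded below by `e` would contribute infinitely many terms at least `M (e / r)
> 0` to a finite modular. -/
lemma MemOrliczIdeal.exists_singularValue_lt (hM : IsOrliczFunction M)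
    (hpos : ∀ t, 0 < t → 0 < M t) {A : H →L[ℂ] H} (hA : MemOrliczIdeal M A) {e : ℝ} (he : 0 < e) :
    ∃ k, singularValue A k < e := by
  obtain ⟨-, r, hr, h⟩ := (memOrliczSeq_iff hM).1 hA
  by_contra! hle
  have h1 : ∑' _ : ℕ, ENNReal.ofReal (M (e / r)) ≤ 1 := by
    refine le_trans (ENNReal.tsum_le_tsum fun k => ENNReal.ofReal_le_ofReal ?_) h
    rw [norm_singularSeq]
    exact hM.mono (by positivity) (by gcongr; exact hle k)
  rw [ENNReal.tsum_const_eq_top_of_ne_zero] at h1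
  · exact absurd h1 (by simp)
  · simpa using hpos _ (by positivity)

lemma MemOrliczIdeal.isCompactOperator (hM : IsOrliczFunction M)
    (hpos : ∀ t, 0 < t → 0 < M t) {A : H →L[ℂ] H} (hA : MemOrliczIdeal M A) :
    IsCompactOperator A :=
  isCompactOperator_of_singularValue_lt fun _ he => hA.exists_singularValue_lt hM hpos he

lemma isCompactOperator_abs_of_singularValue_lt {A : H →L[ℂ] H}
    (h : ∀ e : ℝ, 0 < e → ∃ k, singularValue A k < e) :
    IsCompactOperator (CFC.abs A : H →L[ℂ] H) :=
  isCompactOperator_of_singularValue_lt fun e he => by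
    simpa only [singularValue_congr (norm_abs_apply A)] using h e he

/-- The operator `|x| ^ s`. -/
noncomputable def absRpow (s : ℝ) (x : H →L[ℂ] H) : H →L[ℂ] H := CFC.rpow (CFC.abs x) s

lemma absRpow_nonneg (s : ℝ) (x : H →L[ℂ] H) : 0 ≤ absRpow s x := CFC.rpow_nonneg

lemma absRpow_isSymmetric (s : ℝ) (x : H →L[ℂ] H) : (absRpow s x : H →ₗ[ℂ] H).IsSymmetric :=
  (IsSelfAdjoint.of_nonneg (absRpow_nonneg s x)).isSymmetric

lemma IsSingularBasis.absRpow_apply {κ : Type*} {x : H →L[ℂ] H} {f : HilbertBasis κ ℂ H}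
    {t : κ → ℝ} (h : IsSingularBasis x f t) {s : ℝ} (hs : 0 ≤ s) (j : κ) :
    absRpow s x (f j) = ((t j ^ s : ℝ) : ℂ) • f j :=
  rpow_apply_of_apply_eq_smul (CFC.abs_nonneg x) hs
    (abs_apply_of_star_mul_self_apply (h.nonneg j) (h.apply j))

lemma isCompactOperator_absRpow {s : ℝ} (hs : 1 ≤ s) {x : H →L[ℂ] H}
    (hx : ∀ e : ℝ, 0 < e → ∃ j, singularValue x j < e) :
    IsCompactOperator (absRpow s x : H →L[ℂ] H) := by
  have h0 : (0 : H →L[ℂ] H) ≤ CFC.abs x := CFC.abs_nonneg x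
  have h1 := isCompactOperator_abs_of_singularValue_lt hx
  exact isCompactOperator_rpow h0 h1 hs

lemma re_inner_absRpow_nonneg (s : ℝ) (x : H →L[ℂ] H) (v : H) :
    0 ≤ RCLike.re ⟪v, absRpow s x v⟫_ℂ :=
  ((ContinuousLinearMap.nonneg_iff_isPositive _).1 (absRpow_nonneg s x)).re_inner_nonneg_right v

lemma exists_eigenbasis_sum_absRpow {s : ℝ} (hs : 1 ≤ s) {n : ℕ} {x : Fin n → H →L[ℂ] H}
    (hx : ∀ k, ∀ e : ℝ, 0 < e → ∃ j, singularValue (x k) j < e) :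
    ∃ (ι : Type u) (e : HilbertBasis ι ℂ H), ∀ i, (∑ k, absRpow s (x k)) (e i) =
      ((∑ k, RCLike.re ⟪e i, absRpow s (x k) (e i)⟫_ℂ : ℝ) : ℂ) • e i := by
  have hc : IsCompactOperator (∑ k, absRpow s (x k) : H →L[ℂ] H) :=
    isCompactOperator_sum fun k => isCompactOperator_absRpow hs (hx k)
  have h0 : 0 ≤ ∑ k, absRpow s (x k) := Finset.sum_nonneg fun k _ => absRpow_nonneg s (x k)
  obtain ⟨ι, e, b, hb⟩ := exists_hilbertBasis_of_isCompactOperator hc (IsSelfAdjoint.of_nonneg h0)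
  refine ⟨ι, e, fun i => ?_⟩
  have h1 : ⟪e i, (∑ k, absRpow s (x k)) (e i)⟫_ℂ = (b i : ℂ) := by
    rw [hb, inner_smul_right, inner_self_eq_norm_sq_to_K, e.orthonormal.1 i]; simp
  have h2 := congrArg RCLike.re h1
  rw [sum_apply, inner_sum, map_sum] at h2
  rw [hb, h2]
  simp

lemma opPowerSum_apply {s a : ℝ} (hs : 0 ≤ s) {n : ℕ} {x : Fin n → H →L[ℂ] H} {v : H}
    (h : (∑ k, absRpow s (x k)) v = (a : ℂ) • v) :
    opPowerSum s x v = ((a ^ (1 / s) : ℝ) : ℂ) • v := by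
  have h0 : 0 ≤ ∑ k, absRpow s (x k) := Finset.sum_nonneg fun k _ => absRpow_nonneg s (x k)
  exact rpow_apply_of_apply_eq_smul h0 (one_div_nonneg.2 hs) h

/-- In an eigenbasis of `∑ |x k| ^ s` each eigenvalue is the sum over `k` of the diagonal entries of
`|x k| ^ s`. Although the `|x k|` need not commute, Jensen can thus be applied to numbers. -/
lemma exists_eigenbasis_opPowerSum {s : ℝ} (hs : 1 ≤ s) {n : ℕ} {x : Fin n → H →L[ℂ] H}
    (hx : ∀ k, ∀ e : ℝ, 0 < e → ∃ j, singularValue (x k) j < e) :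
    ∃ (ι : Type u) (e : HilbertBasis ι ℂ H),
      (∀ k i, 0 ≤ RCLike.re ⟪e i, absRpow s (x k) (e i)⟫_ℂ) ∧
      IsSingularBasis (∑ k, absRpow s (x k)) e
        (fun i => ∑ k, RCLike.re ⟪e i, absRpow s (x k) (e i)⟫_ℂ) ∧
      IsSingularBasis (opPowerSum s x) e
        (fun i => (∑ k, RCLike.re ⟪e i, absRpow s (x k) (e i)⟫_ℂ) ^ (1 / s)) := by
  obtain ⟨ι, e, he⟩ := exists_eigenbasis_sum_absRpow hs hx
  have hnn : ∀ k i, 0 ≤ RCLike.re ⟪e i, absRpow s (x k) (e i)⟫_ℂ := fun k i =>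
    re_inner_absRpow_nonneg s (x k) (e i)
  have hnn' : ∀ i, 0 ≤ ∑ k, RCLike.re ⟪e i, absRpow s (x k) (e i)⟫_ℂ := fun i =>
    Finset.sum_nonneg fun k _ => hnn k i
  have hB0 : 0 ≤ ∑ k, absRpow s (x k) := Finset.sum_nonneg fun k _ => absRpow_nonneg s (x k)
  have hT0 : (0 : H →L[ℂ] H) ≤ opPowerSum s x := CFC.rpow_nonneg
  exact ⟨ι, e, hnn, .of_isSelfAdjoint (IsSelfAdjoint.of_nonneg hB0) hnn' he,
    .of_isSelfAdjoint (IsSelfAdjoint.of_nonneg hT0) (fun i => Real.rpow_nonneg (hnn' i) _)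
      fun i => opPowerSum_apply (zero_le_one.trans hs) (he i)⟩

lemma tsum_nat_le_mul_tsum_mul {g : ℕ → ℝ≥0∞} (hg : Antitone g) (n : ℕ) [NeZero n] :
    ∑' m, g m ≤ n * ∑' j, g (n * j) := by
  rw [← (Nat.divModEquiv n).symm.tsum_eq, ENNReal.tsum_prod', ← ENNReal.tsum_mul_left]
  refine ENNReal.tsum_le_tsum fun j => ?_
  rw [tsum_fintype]
  refine (Finset.sum_le_card_nsmul _ _ (g (n * j)) fun i _ => hg ?_).trans (by simp)
  simp [Nat.divModEquiv, mul_comm]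

/-- The modular lower bound for `q`-concavity does not give membership, which is proved here. The Ky
Fan inequality bounds the singular value of `∑ |x k| ^ s` at index `(n + 1) * j` by the sum of those
of the `|x k| ^ s` at `j`. The power `1 / s` is subadditive, and spreading the indices only
multiplies the modular by `n + 1`. -/
lemma memOrliczIdeal_opPowerSum (hM : IsOrliczFunction M) (hpos : ∀ t, 0 < t → 0 < M t)
    {s : ℝ} (hs : 1 ≤ s) {n : ℕ} {x : Fin n → H →L[ℂ] H} (hx : ∀ k, MemOrliczIdeal M (x k)) :
    MemOrliczIdeal M (opPowerSum s x) := by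
  have hs0 : 0 < s := zero_lt_one.trans_le hs
  have hs1 : 0 ≤ 1 / s := by positivity
  have hsmall := fun k (e : ℝ) (he : 0 < e) => (hx k).exists_singularValue_lt hM hpos he
  obtain ⟨ι, e, hnn, hB, hT⟩ := exists_eigenbasis_opPowerSum hs hsmall
  set B : H →L[ℂ] H := ∑ k, absRpow s (x k) with hBdef
  have hFm : ∀ r : ℝ, 0 < r → MonotoneOn (fun u : ℝ => M (u ^ (1 / s) / r)) (Ici 0) := by
    intro r hr u hu v _ huv
    have hu : 0 ≤ u := hu
    exact hM.mono (by positivity) (by gcongr)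
  have hFc : ∀ r : ℝ, ContinuousOn (fun u : ℝ => M (u ^ (1 / s) / r)) (Ici 0) := fun r =>
    (hM.continuous.comp ((Real.continuous_rpow_const hs1).div_const r)).continuousOn
  have hF0 : ∀ r : ℝ, M ((0 : ℝ) ^ (1 / s) / r) = 0 := fun r => by
    rw [Real.zero_rpow (one_div_pos.2 hs0).ne', zero_div, hM.map_zero]
  set y : Fin n → ℕ → ℂ := fun k j => ((singularValue (absRpow s (x k)) j ^ (1 / s) : ℝ) : ℂ)
  have hynorm : ∀ k j, ‖y k j‖ = singularValue (absRpow s (x k)) j ^ (1 / s) := fun k j => by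
    rw [Complex.norm_real, Real.norm_of_nonneg (Real.rpow_nonneg (singularValue_nonneg _ _) _)]
  have hy : ∀ k, MemOrliczSeq M (y k) := fun k => by
    rw [memOrliczSeq_iff hM]
    refine ⟨⟨‖absRpow s (x k)‖ ^ (1 / s), ?_⟩, ?_⟩
    · rintro _ ⟨j, rfl⟩
      simp only [hynorm]
      exact Real.rpow_le_rpow (singularValue_nonneg _ _) (singularValue_le_norm _ _) hs1
    · obtain ⟨r, hr, hr1⟩ := ((memOrliczSeq_iff hM).1 (hx k)).2
      refine ⟨r, hr, le_trans (le_of_eq ?_) hr1⟩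
      obtain ⟨κ, f, t, hf⟩ := exists_isSingularBasis ((hx k).isCompactOperator hM hpos)
      have hY : IsSingularBasis (absRpow s (x k)) f fun j => t j ^ s :=
        IsSingularBasis.of_isSelfAdjoint (IsSelfAdjoint.of_nonneg (absRpow_nonneg s (x k)))
          (fun j => Real.rpow_nonneg (hf.nonneg j) _) fun j => hf.absRpow_apply hs0.le j
      rw [hf.modular_singularSeq hM hr, modular]
      simp only [hynorm]
      rw [hY.tsum_singularValue (F := fun u => M (u ^ (1 / s) / r)) (hF0 r) (hFm r hr) (hFc r)]
      simp only [Real.rpow_rpow_one_div (hf.nonneg _) hs0.ne']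
  set z : ℕ → ℂ := fun j => ((∑ k, singularValue (absRpow s (x k)) j ^ (1 / s) : ℝ) : ℂ)
  have hznn : ∀ j, 0 ≤ ∑ k, singularValue (absRpow s (x k)) j ^ (1 / s) := fun j =>
    Finset.sum_nonneg fun k _ => Real.rpow_nonneg (singularValue_nonneg _ _) _
  have hznorm : ∀ j, ‖z j‖ = ∑ k, singularValue (absRpow s (x k)) j ^ (1 / s) := fun j => by
    rw [Complex.norm_real, Real.norm_of_nonneg (hznn j)]
  have hz : MemOrliczSeq M z := memOrliczSeq_of_norm_le_sum hM hy fun j => by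
    simp only [hznorm, hynorm, le_refl]
  obtain ⟨-, r, hr, hr1⟩ := (memOrliczSeq_iff hM).1 hz
  refine ⟨bddAbove_singularSeq _, r, hr, (modular_ne_top_iff hM).1 ?_⟩
  rw [hT.modular_singularSeq hM hr,
    ← hB.tsum_singularValue (F := fun u => M (u ^ (1 / s) / r)) (hF0 r) (hFm r hr) (hFc r)]
  have hanti : Antitone fun m => ENNReal.ofReal (M (singularValue B m ^ (1 / s) / r)) :=
    fun a b hab => ENNReal.ofReal_le_ofReal (hFm r hr (singularValue_nonneg B b)
      (singularValue_nonneg B a) (singularValue_antitone B hab))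
  -- Index step `n + 1` instead of `n` keeps the step nonzero for an empty family.
  refine ne_top_of_le_ne_top ?_ (tsum_nat_le_mul_tsum_mul hanti (n + 1))
  refine ENNReal.mul_ne_top (ENNReal.natCast_ne_top _) (ne_top_of_le_ne_top ENNReal.one_ne_top
    (le_trans (ENNReal.tsum_le_tsum fun j => ENNReal.ofReal_le_ofReal ?_) hr1))
  have hsum : singularValue B ((n + 1) * j) ≤ ∑ k, singularValue (absRpow s (x k)) j := by
    have := singularValue_le_sum_add (A := B) (A' := fun k => absRpow s (x k)) ⊥ (r := 0) (by simp)
      le_rfl (fun v _ => by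
        rw [hBdef, sum_apply, zero_mul, add_zero]; exact norm_sum_le _ _) j
    rw [add_zero, add_zero] at this
    exact (singularValue_antitone B (by gcongr; lia)).trans this
  refine hM.mono (div_nonneg (Real.rpow_nonneg (singularValue_nonneg _ _) _) hr.le) ?_
  rw [hznorm]
  gcongr
  refine (Real.rpow_le_rpow (singularValue_nonneg _ _) hsum hs1).trans ?_
  have := sum_rpow_one_div_le_sum Finset.univ
    (fun k => Real.rpow_nonneg (singularValue_nonneg (absRpow s (x k)) j) (1 / s)) hs
  simpa only [Real.rpow_one_div_rpow (singularValue_nonneg _ _) hs0.ne'] using this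

/-- Jensen is used twice: over `k`, at the eigenvalue of `∑ |x k| ^ p` attached to each `e i`, and
then for each `k`, comparing the diagonal entries of `|x k| ^ p` in the basis `e` with its own
eigenvalues. -/
lemma modular_opPowerSum_le (hN : IsOrliczFunction N) (hp : 1 ≤ p)
    (hNp : ConvexOn ℝ (Ici 0) fun t : ℝ => N (t ^ (1 / p))) {n : ℕ} {x : Fin n → H →L[ℂ] H}
    (hx : ∀ k, ∀ e : ℝ, 0 < e → ∃ j, singularValue (x k) j < e)
    {l : Fin n → ℝ} {L : ℝ} (hl : ∀ k, 0 < l k) (hL : 0 < L) (h : ∑ k, (l k / L) ^ p ≤ 1) :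
    modular N (singularSeq (opPowerSum p x)) L ≤
      ∑ k, ENNReal.ofReal ((l k / L) ^ p) * modular N (singularSeq (x k)) (l k) := by
  have hp0 : 0 < p := zero_lt_one.trans_le hp
  obtain ⟨ι, e, hnn, -, hT⟩ := exists_eigenbasis_opPowerSum hp hx
  have hF0 := hN.map_zero_rpow hp0
  have hw : ∀ k, 0 ≤ (l k / L) ^ p := fun k => Real.rpow_nonneg (div_pos (hl k) hL).le _
  have hlp : ∀ k, 0 < (l k ^ p)⁻¹ := fun k => inv_pos.2 (Real.rpow_pos_of_pos (hl k) _)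
  have hterm : ∀ k, ∑' i, ENNReal.ofReal (N (((l k ^ p)⁻¹ *
      RCLike.re ⟪e i, absRpow p (x k) (e i)⟫_ℂ) ^ (1 / p))) ≤
        modular N (singularSeq (x k)) (l k) := fun k => by
    obtain ⟨κ, f, t, hf⟩ := exists_isSingularBasis (isCompactOperator_of_singularValue_lt (hx k))
    rw [hf.modular_singularSeq hN (hl k)]
    refine (hNp.tsum_inner_le hF0 (fun _ _ => hN.nonneg _)
      (hN.continuous.comp (Real.continuous_rpow_const (by positivity))).continuousOn
      (absRpow_isSymmetric p (x k)) (fun j => Real.rpow_nonneg (hf.nonneg j) p)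
      (hf.absRpow_apply hp0.le) e (hlp k).le).trans (le_of_eq (tsum_congr fun j => ?_))
    rw [inv_mul_eq_div, ← Real.div_rpow (hf.nonneg j) (hl k).le,
      Real.rpow_rpow_one_div (div_nonneg (hf.nonneg j) (hl k).le) hp0.ne']
  rw [hT.modular_singularSeq hN hL]
  refine le_trans ?_ (Finset.sum_le_sum fun k _ => mul_le_mul_right (hterm k) _)
  simp only [← ENNReal.tsum_mul_left]
  rw [← Summable.tsum_finsetSum fun _ _ => ENNReal.summable]
  refine ENNReal.tsum_le_tsum fun i => ?_
  simp only [← ENNReal.ofReal_mul (hw _)]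
  rw [← ENNReal.ofReal_sum_of_nonneg fun k _ => mul_nonneg (hw k) (hN.nonneg _)]
  refine ENNReal.ofReal_le_ofReal ?_
  have := hNp.map_finsetSum_mul_le hF0 Finset.univ hw h fun k => mul_nonneg (hlp k).le (hnn k i)
  refine le_trans (le_of_eq ?_) this
  congr 1
  conv_lhs => rw [← Real.rpow_rpow_one_div hL.le hp0.ne']
  rw [← Real.div_rpow (Finset.sum_nonneg fun k _ => hnn k i) (by positivity), Finset.sum_div]
  congr 1
  refine Finset.sum_congr rfl fun k _ => ?_
  have := Real.rpow_pos_of_pos (hl k) p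
  rw [Real.div_rpow (hl k).le hL.le]
  field_simp

lemma le_modular_opPowerSum (hN : IsOrliczFunction N) (hq : 1 ≤ q)
    (hNq : ConcaveOn ℝ (Ici 0) fun t : ℝ => N (t ^ (1 / q))) {n : ℕ} {x : Fin n → H →L[ℂ] H}
    (hx : ∀ k, ∀ e : ℝ, 0 < e → ∃ j, singularValue (x k) j < e)
    {l : Fin n → ℝ} {L : ℝ} (hl : ∀ k, 0 ≤ l k) (hL : 0 < L) (h : ∑ k, (l k / L) ^ q ≤ 1) :
    ∑ k, ENNReal.ofReal ((l k / L) ^ q) * modular N (singularSeq (x k)) (l k) ≤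
      modular N (singularSeq (opPowerSum q x)) L := by
  have hq0 : 0 < q := zero_lt_one.trans_le hq
  obtain ⟨ι, e, hnn, -, hT⟩ := exists_eigenbasis_opPowerSum hq hx
  have hF0 := hN.map_zero_rpow hq0
  have hFm : MonotoneOn (fun t : ℝ => N (t ^ (1 / q))) (Ici 0) := fun a ha b _ hab => by
    have ha : 0 ≤ a := ha
    exact hN.mono (by positivity) (by gcongr)
  have hw : ∀ k, 0 ≤ (l k / L) ^ q := fun k => Real.rpow_nonneg (div_nonneg (hl k) hL.le) _
  have hlq : ∀ k, 0 ≤ (l k ^ q)⁻¹ := fun k => inv_nonneg.2 (Real.rpow_nonneg (hl k) _)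
  have hterm : ∀ k, 0 < l k → modular N (singularSeq (x k)) (l k) ≤
      ∑' i, ENNReal.ofReal (N (((l k ^ q)⁻¹ *
        RCLike.re ⟪e i, absRpow q (x k) (e i)⟫_ℂ) ^ (1 / q))) := fun k hlk => by
    obtain ⟨κ, f, t, hf⟩ := exists_isSingularBasis (isCompactOperator_of_singularValue_lt (hx k))
    rw [hf.modular_singularSeq hN hlk]
    refine le_trans (le_of_eq (tsum_congr fun j => ?_))
      (hNq.le_tsum_inner hF0 (fun _ _ => hN.nonneg _) hFm
      (absRpow_isSymmetric q (x k)) (fun j => Real.rpow_nonneg (hf.nonneg j) q)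
      (hf.absRpow_apply hq0.le) e (hlq k))
    rw [inv_mul_eq_div, ← Real.div_rpow (hf.nonneg j) hlk.le,
      Real.rpow_rpow_one_div (div_nonneg (hf.nonneg j) hlk.le) hq0.ne']
  rw [hT.modular_singularSeq hN hL]
  have hterm' : ∀ k, ENNReal.ofReal ((l k / L) ^ q) * modular N (singularSeq (x k)) (l k) ≤
      ENNReal.ofReal ((l k / L) ^ q) * ∑' i, ENNReal.ofReal (N (((l k ^ q)⁻¹ *
        RCLike.re ⟪e i, absRpow q (x k) (e i)⟫_ℂ) ^ (1 / q))) := fun k => by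
    rcases (hl k).eq_or_lt with h0 | h0
    · simp [← h0, Real.zero_rpow hq0.ne']
    · exact mul_le_mul_right (hterm k h0) _
  refine (Finset.sum_le_sum fun k _ => hterm' k).trans ?_
  simp only [← ENNReal.tsum_mul_left]
  rw [← Summable.tsum_finsetSum fun _ _ => ENNReal.summable]
  refine ENNReal.tsum_le_tsum fun i => ?_
  simp only [← ENNReal.ofReal_mul (hw _)]
  rw [← ENNReal.ofReal_sum_of_nonneg fun k _ => mul_nonneg (hw k) (hN.nonneg _)]
  refine ENNReal.ofReal_le_ofReal ?_
  have := hNq.finsetSum_mul_le_map hF0 Finset.univ hw h fun k => mul_nonneg (hlq k) (hnn k i)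
  have hsum0 : 0 ≤ ∑ k, (l k / L) ^ q * ((l k ^ q)⁻¹ *
      RCLike.re ⟪e i, absRpow q (x k) (e i)⟫_ℂ) :=
    Finset.sum_nonneg fun k _ => mul_nonneg (hw k) (mul_nonneg (hlq k) (hnn k i))
  refine this.trans (hN.mono (Real.rpow_nonneg hsum0 _) ?_)
  conv_rhs => rw [← Real.rpow_rpow_one_div hL.le hq0.ne']
  rw [← Real.div_rpow (Finset.sum_nonneg fun k _ => hnn k i) (by positivity), Finset.sum_div]
  refine Real.rpow_le_rpow hsum0 (Finset.sum_le_sum fun k _ => ?_) (by positivity)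
  rcases (hl k).eq_or_lt with h0 | h0
  · rw [← h0, zero_div, Real.zero_rpow hq0.ne', zero_mul]
    exact div_nonneg (hnn k i) (by positivity)
  · have := Real.rpow_pos_of_pos h0 q
    rw [Real.div_rpow h0.le hL.le]
    refine le_of_eq ?_
    field_simp

variable {D₁ D₂ : ℝ}

lemma IsOrliczModel.orliczIdealPConvex (hM : IsOrliczFunction M) (hp : 1 ≤ p)
    (h : IsOrliczModel M p q N D₁ D₂) : OrliczIdealPConvex H M p := by
  refine ⟨D₁ * 1 * D₂, by have := h.pos_left; have := h.pos_right; positivity, fun n x hx => ?_⟩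
  refine norm_le_of_modular_upper hM h.pos_left h.pos_right one_pos hp h.dominates h.dominated hx
    (bddAbove_singularSeq _) fun l L hl hL hlL => ?_
  rw [one_mul]
  exact modular_opPowerSum_le h.orlicz hp h.convex
    (fun k e he => (hx k).exists_singularValue_lt hM h.pos he) hl hL hlL

lemma IsOrliczModel.orliczIdealQConcave (hM : IsOrliczFunction M) (hq : 1 ≤ q)
    (h : IsOrliczModel M p q N D₁ D₂) : OrliczIdealQConcave H M q := by
  refine ⟨4 * D₁ * D₂, by have := h.pos_left; have := h.pos_right; positivity, fun n x hx => ?_⟩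
  have hS := memOrliczIdeal_opPowerSum hM h.pos hq hx
  refine ⟨hS, norm_le_of_modular_lower hM h.orlicz h.pos_left h.pos_right hq h.dominates
    h.dominated hS fun l L hl hL hlL => ?_⟩
  exact le_modular_opPowerSum h.orlicz hq h.concave
    (fun k e he => (hx k).exists_singularValue_lt hM h.pos he) hl hL hlL

end IdealConvexity

/-! ### Comparison of measures on half-lines and representation of the primitive -/

section MeasureComparison

lemma lintegral_ofReal_mono_of_meas_lt {α : Type*} [MeasurableSpace α] {μ ν : Measure α} {f : α → ℝ}
    (hf : Measurable f) (h0 : ∀ x, 0 ≤ f x) (h : ∀ t, 0 < t → μ {x | t < f x} ≤ ν {x | t < f x}) :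
    ∫⁻ x, ENNReal.ofReal (f x) ∂μ ≤ ∫⁻ x, ENNReal.ofReal (f x) ∂ν := by
  rw [lintegral_eq_lintegral_meas_lt μ (ae_of_all _ h0) hf.aemeasurable,
    lintegral_eq_lintegral_meas_lt ν (ae_of_all _ h0) hf.aemeasurable]
  exact setLIntegral_mono' measurableSet_Ioi h

variable {φ : ℝ → ℝ} {t : ℝ}

lemma isOpen_lt_indicator_Ioi (hφ : ContinuousOn φ (Ioi 0)) (ht : 0 < t) :
    {s | t < (Ioi (0 : ℝ)).indicator φ s} = Ioi 0 ∩ φ ⁻¹' Ioi t ∧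
      IsOpen (Ioi (0 : ℝ) ∩ φ ⁻¹' Ioi t) := by
  refine ⟨?_, hφ.isOpen_inter_preimage isOpen_Ioi isOpen_Ioi⟩
  ext s
  by_cases hs : s ∈ Ioi (0 : ℝ)
  · simp only [mem_ofPred_eq, indicator_of_mem hs, mem_inter_iff, hs, mem_preimage, mem_Ioi, true_and]
  · simp [ht.le, show ¬ 0 < s from hs]

lemma lt_indicator_Ioi_of_monotoneOn (hφ : ContinuousOn φ (Ioi 0)) (hm : MonotoneOn φ (Ioi 0))
    (ht : 0 < t) : {s | t < (Ioi (0 : ℝ)).indicator φ s} = ∅ ∨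
      ∃ c, 0 ≤ c ∧ {s | t < (Ioi (0 : ℝ)).indicator φ s} = Ioi c := by
  obtain ⟨hA, hopen⟩ := isOpen_lt_indicator_Ioi hφ ht
  rw [hA]
  set A := Ioi (0 : ℝ) ∩ φ ⁻¹' Ioi t
  rcases A.eq_empty_or_nonempty with h0 | hne
  · exact Or.inl h0
  have hbdd : BddBelow A := ⟨0, fun s hs => le_of_lt hs.1⟩
  have hc0 : 0 ≤ sInf A := le_csInf hne fun s hs => le_of_lt hs.1
  refine Or.inr ⟨sInf A, hc0, ?_⟩
  ext s
  constructor
  · intro hs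
    obtain ⟨l, hl, hls⟩ := exists_Ioc_subset_of_mem_nhds (hopen.mem_nhds hs) ⟨s - 1, by simp⟩
    have hmid : (l + s) / 2 ∈ A := hls ⟨by linarith, by linarith⟩
    exact lt_of_le_of_lt (csInf_le hbdd hmid) (by linarith)
  · intro hs
    obtain ⟨s', hs', hlt⟩ := exists_lt_of_csInf_lt hne hs
    exact ⟨lt_of_le_of_lt hc0 hs, lt_of_lt_of_le hs'.2 (hm hs'.1 (lt_of_le_of_lt hc0 hs) hlt.le)⟩

lemma lt_indicator_Ioi_of_antitoneOn (hφ : ContinuousOn φ (Ioi 0)) (hm : AntitoneOn φ (Ioi 0))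
    (ht : 0 < t) : {s | t < (Ioi (0 : ℝ)).indicator φ s} = Ioi 0 ∨
      ∃ c, {s | t < (Ioi (0 : ℝ)).indicator φ s} = Ioo 0 c := by
  obtain ⟨hA, hopen⟩ := isOpen_lt_indicator_Ioi hφ ht
  rw [hA]
  set A := Ioi (0 : ℝ) ∩ φ ⁻¹' Ioi t
  have hlow : ∀ s s', 0 < s → s ≤ s' → s' ∈ A → s ∈ A := fun s s' hs hss hs' =>
    ⟨hs, lt_of_lt_of_le hs'.2 (hm hs hs'.1 hss)⟩
  by_cases hbdd : BddAbove A
  · refine Or.inr ⟨sSup A, ?_⟩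
    ext s
    constructor
    · intro hs
      obtain ⟨l, hl, hls⟩ := exists_Ico_subset_of_mem_nhds (hopen.mem_nhds hs) ⟨s + 1, by simp⟩
      have hmid : (s + l) / 2 ∈ A := hls ⟨by linarith, by linarith⟩
      exact ⟨hs.1, lt_of_lt_of_le (by linarith) (le_csSup hbdd hmid)⟩
    · rintro ⟨hs0, hs⟩
      rcases A.eq_empty_or_nonempty with h0 | hne
      · rw [h0, Real.sSup_empty] at hs
        exact absurd hs0 hs.not_gt
      obtain ⟨s', hs', hlt⟩ := exists_lt_of_lt_csSup hne hs
      exact hlow s s' hs0 hlt.le hs'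
  · left
    ext s
    refine ⟨fun hs => hs.1, fun hs => ?_⟩
    obtain ⟨s', hs', hlt⟩ := not_bddAbove_iff.1 hbdd s
    exact hlow s s' hs hlt.le hs'

variable {μ ν : Measure ℝ}

/-- Superlevel sets of a continuous increasing `φ` are open half-lines, so comparing the measures on
these is enough. -/
lemma lintegral_indicator_Ioi_mono_of_monotoneOn (hφ : ContinuousOn φ (Ioi 0))
    (hφ0 : ∀ s, 0 < s → 0 ≤ φ s) (hm : MonotoneOn φ (Ioi 0))
    (h : ∀ c, 0 ≤ c → μ (Ioi c) ≤ ν (Ioi c)) :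
    ∫⁻ s, ENNReal.ofReal ((Ioi (0 : ℝ)).indicator φ s) ∂μ ≤
      ∫⁻ s, ENNReal.ofReal ((Ioi (0 : ℝ)).indicator φ s) ∂ν := by
  classical
  refine lintegral_ofReal_mono_of_meas_lt ?_ (indicator_nonneg hφ0) fun t ht => ?_
  · rw [← piecewise_eq_indicator]
    exact hφ.measurable_piecewise continuousOn_const measurableSet_Ioi
  · rcases lt_indicator_Ioi_of_monotoneOn hφ hm ht with h0 | ⟨c, hc, h0⟩ <;> rw [h0]
    · simp
    · exact h c hc

lemma lintegral_indicator_Ioi_mono_of_antitoneOn (hφ : ContinuousOn φ (Ioi 0))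
    (hφ0 : ∀ s, 0 < s → 0 ≤ φ s) (hm : AntitoneOn φ (Ioi 0))
    (h : ∀ c, μ (Ioo 0 c) ≤ ν (Ioo 0 c)) :
    ∫⁻ s, ENNReal.ofReal ((Ioi (0 : ℝ)).indicator φ s) ∂μ ≤
      ∫⁻ s, ENNReal.ofReal ((Ioi (0 : ℝ)).indicator φ s) ∂ν := by
  classical
  refine lintegral_ofReal_mono_of_meas_lt ?_ (indicator_nonneg hφ0) fun t ht => ?_
  · rw [← piecewise_eq_indicator]
    exact hφ.measurable_piecewise continuousOn_const measurableSet_Ioi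
  · rcases lt_indicator_Ioi_of_antitoneOn hφ hm ht with h0 | ⟨c, h0⟩ <;> rw [h0]
    -- A superlevel set may be the whole half-line, which is exhausted by bounded intervals.
    · have hU : Ioi (0 : ℝ) = ⋃ n : ℕ, Ioo (0 : ℝ) n := by
        ext s
        simp only [mem_Ioi, mem_iUnion, mem_Ioo, exists_and_left]
        exact ⟨fun hs => ⟨hs, exists_nat_gt s⟩, fun hs => hs.1⟩
      have hmono : Monotone fun n : ℕ => Ioo (0 : ℝ) n := fun m n hmn =>
        Ioo_subset_Ioo_right (by exact_mod_cast hmn)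
      rw [hU, hmono.measure_iUnion, hmono.measure_iUnion]
      exact iSup_mono fun n => h n
    · exact h c

/-- The measure `s ^ (r - 1) ds` on `(0, ∞)`. -/
noncomputable def powerMeasure (r : ℝ) : Measure ℝ :=
  (volume.restrict (Ioi 0)).withDensity fun s => ENNReal.ofReal (s ^ (r - 1))

lemma powerMeasure_Ioo {r u a : ℝ} (hr : 1 ≤ r) (hu : 0 ≤ u) (ha : 0 ≤ a) :
    powerMeasure r (Ioo u a) = ENNReal.ofReal ((a ^ r - u ^ r) / r) := by
  have hr0 : 0 < r := zero_lt_one.trans_le hr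
  rcases le_total a u with hau | hua
  · rw [Ioo_eq_empty (not_lt.2 hau), measure_empty, eq_comm, ENNReal.ofReal_eq_zero]
    exact div_nonpos_of_nonpos_of_nonneg
      (sub_nonpos.2 (Real.rpow_le_rpow ha hau hr0.le)) hr0.le
  have hsub : Ioo u a ⊆ Ioi 0 := fun s hs => lt_of_le_of_lt hu hs.1
  have hint : IntervalIntegrable (fun s : ℝ => s ^ (r - 1)) volume u a :=
    intervalIntegral.intervalIntegrable_rpow' (by linarith)
  rw [powerMeasure, withDensity_apply _ measurableSet_Ioo, Measure.restrict_restrict measurableSet_Ioo,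
    inter_eq_self_of_subset_left hsub, ← ofReal_integral_eq_lintegral_ofReal]
  · rw [← integral_Ioc_eq_integral_Ioo, ← intervalIntegral.integral_of_le hua,
      integral_rpow (Or.inl (by linarith))]
    simp
  · exact ((intervalIntegrable_iff_integrableOn_Ioc_of_le hua).1 hint).mono_set Ioo_subset_Ioc_self
  · exact (ae_restrict_mem measurableSet_Ioo).mono fun _ hs =>
      Real.rpow_nonneg (le_of_lt (hsub hs)) _

namespace IsPowerDensity

variable {p q r : ℝ} {n : ℝ → ℝ}

lemma continuousOn_div_rpow (h : IsPowerDensity p q n) (r : ℝ) :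
    ContinuousOn (fun s => n s / s ^ r) (Ioi 0) :=
  h.continuousOn.div (fun s hs => (Real.continuousAt_rpow_const s r
    (Or.inl (ne_of_gt hs))).continuousWithinAt) fun _ hs => (Real.rpow_pos_of_pos hs r).ne'

/-- The density is split as `(n s / s ^ (r - 1)) * s ^ (r - 1)`. The first factor is increasing for
`r = p` and decreasing for `r = q`. -/
lemma ofReal_primitive (h : IsPowerDensity p q n) (hp : 1 ≤ p) {a : ℝ} (ha : 0 ≤ a) :
    ENNReal.ofReal (orliczPrimitive n a) = ∫⁻ s in Iio a,
      ENNReal.ofReal ((Ioi (0 : ℝ)).indicator (fun s => n s / s ^ (r - 1)) s) ∂(powerMeasure r) := by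
  classical
  have hsub : Ioo 0 a ⊆ Ioi (0 : ℝ) := fun s hs => hs.1
  have hmeas : Measurable ((Ioi (0 : ℝ)).indicator (fun s => n s / s ^ (r - 1))) := by
    rw [← piecewise_eq_indicator]
    exact (h.continuousOn_div_rpow _).measurable_piecewise continuousOn_const measurableSet_Ioi
  have hpow : Measurable fun s : ℝ => ENNReal.ofReal (s ^ (r - 1)) := by fun_prop
  rw [powerMeasure, restrict_withDensity measurableSet_Iio,
    Measure.restrict_restrict measurableSet_Iio,
    lintegral_withDensity_eq_lintegral_mul _ hpow hmeas.ennreal_ofReal,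
    orliczPrimitive, abs_of_nonneg ha, intervalIntegral.integral_of_le ha,
    integral_Ioc_eq_integral_Ioo, show Iio a ∩ Ioi 0 = Ioo 0 a by rw [inter_comm]; rfl,
    ofReal_integral_eq_lintegral_ofReal]
  · refine setLIntegral_congr_fun measurableSet_Ioo fun s hs => ?_
    have hs0 : 0 < s := hs.1
    have := Real.rpow_pos_of_pos hs0 (r - 1)
    rw [Pi.mul_apply, indicator_of_mem (hsub hs), ← ENNReal.ofReal_mul this.le,
      mul_div_cancel₀ _ this.ne']
  · exact ((intervalIntegrable_iff_integrableOn_Ioc_of_le ha).1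
      (h.intervalIntegrable hp ha)).mono_set Ioo_subset_Ioc_self
  · exact (ae_restrict_mem measurableSet_Ioo).mono fun s hs => (h.pos s hs.1).le

variable {ι κ : Type*} {c a : ι → ℝ} {d b : κ → ℝ}

/-- The measure `∑ c i 1_{(0, a i)} s ^ (r - 1) ds`. -/
noncomputable def _root_.familyMeasure {ι : Type*} (r : ℝ) (c a : ι → ℝ) : Measure ℝ :=
  Measure.sum fun i => ENNReal.ofReal (c i) • (powerMeasure r).restrict (Iio (a i))

lemma lintegral_familyMeasure (h : IsPowerDensity p q n) (hp : 1 ≤ p) (ha : ∀ i, 0 ≤ a i) :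
    ∫⁻ s, ENNReal.ofReal ((Ioi (0 : ℝ)).indicator (fun s => n s / s ^ (r - 1)) s)
        ∂(familyMeasure r c a) =
      ∑' i, ENNReal.ofReal (c i) * ENNReal.ofReal (orliczPrimitive n (a i)) := by
  rw [familyMeasure, lintegral_sum_measure]
  refine tsum_congr fun i => ?_
  rw [lintegral_smul_measure, h.ofReal_primitive hp (ha i), smul_eq_mul]

lemma _root_.familyMeasure_apply {A : Set ℝ} (hA : MeasurableSet A) :
    familyMeasure r c a A = ∑' i, ENNReal.ofReal (c i) * powerMeasure r (A ∩ Iio (a i)) := by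
  rw [familyMeasure, Measure.sum_apply _ hA]
  refine tsum_congr fun i => ?_
  rw [Measure.smul_apply, Measure.restrict_apply hA, smul_eq_mul]

lemma _root_.familyMeasure_Ioi (hr : 1 ≤ r) (ha : ∀ i, 0 ≤ a i) {u : ℝ} (hu : 0 ≤ u) :
    familyMeasure r c a (Ioi u) =
      (∑' i, ENNReal.ofReal (c i) * ENNReal.ofReal (a i ^ r - u ^ r)) * ENNReal.ofReal r⁻¹ := by
  rw [familyMeasure_apply measurableSet_Ioi, ← ENNReal.tsum_mul_right]
  refine tsum_congr fun i => ?_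
  rw [show Ioi u ∩ Iio (a i) = Ioo u (a i) from rfl, powerMeasure_Ioo hr hu (ha i), mul_assoc,
    div_eq_mul_inv, ENNReal.ofReal_mul' (inv_nonneg.2 (zero_le_one.trans hr))]

lemma _root_.familyMeasure_Ioo (hr : 1 ≤ r) (ha : ∀ i, 0 ≤ a i) {u : ℝ} (hu : 0 ≤ u) :
    familyMeasure r c a (Ioo 0 u) =
      (∑' i, ENNReal.ofReal (c i) * ENNReal.ofReal (min (a i) u ^ r)) * ENNReal.ofReal r⁻¹ := by
  rw [familyMeasure_apply measurableSet_Ioo, ← ENNReal.tsum_mul_right]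
  refine tsum_congr fun i => ?_
  rw [show Ioo 0 u ∩ Iio (a i) = Ioo 0 (min (a i) u) by
      rw [inter_comm, Iio_inter_Ioo],
    powerMeasure_Ioo hr le_rfl (le_min (ha i) hu), mul_assoc,
    Real.zero_rpow (zero_lt_one.trans_le hr).ne', sub_zero, div_eq_mul_inv,
    ENNReal.ofReal_mul' (inv_nonneg.2 (zero_le_one.trans hr))]

/-- The measure `p s ^ (p - 1) ds` of `(u, a)` is `(a ^ p - u ^ p)₊`, the positive part being
supplied by `ENNReal.ofReal`. The primitive integrates an increasing function against such measures,
so tails decide. -/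
lemma tsum_primitive_le_of_excess (h : IsPowerDensity p q n) (hp : 1 ≤ p)
    (ha : ∀ i, 0 ≤ a i) (hb : ∀ k, 0 ≤ b k)
    (H : ∀ u, 0 ≤ u → ∑' i, ENNReal.ofReal (c i) * ENNReal.ofReal (a i ^ p - u ^ p) ≤
      ∑' k, ENNReal.ofReal (d k) * ENNReal.ofReal (b k ^ p - u ^ p)) :
    ∑' i, ENNReal.ofReal (c i) * ENNReal.ofReal (orliczPrimitive n (a i)) ≤
      ∑' k, ENNReal.ofReal (d k) * ENNReal.ofReal (orliczPrimitive n (b k)) := by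
  rw [← h.lintegral_familyMeasure (r := p) hp ha, ← h.lintegral_familyMeasure (r := p) hp hb]
  refine lintegral_indicator_Ioi_mono_of_monotoneOn (h.continuousOn_div_rpow _)
    (fun s hs => div_nonneg (h.pos s hs).le (Real.rpow_nonneg (le_of_lt hs) _)) h.mono
    fun u hu => ?_
  rw [familyMeasure_Ioi hp ha hu, familyMeasure_Ioi hp hb hu]
  gcongr
  exact H u hu

/-- Dual to the excess criterion: `n s / s ^ (q - 1)` is decreasing, so initial intervals decide,
and the measure `q s ^ (q - 1) ds` of `(0, u) ∩ (0, a)` is `min a u ^ q`. -/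
lemma tsum_primitive_le_of_truncation (h : IsPowerDensity p q n) (hp : 1 ≤ p) (hq : 1 ≤ q)
    (ha : ∀ i, 0 ≤ a i) (hb : ∀ k, 0 ≤ b k)
    (H : ∀ u, 0 < u → ∑' i, ENNReal.ofReal (c i) * ENNReal.ofReal (min (a i) u ^ q) ≤
      ∑' k, ENNReal.ofReal (d k) * ENNReal.ofReal (min (b k) u ^ q)) :
    ∑' i, ENNReal.ofReal (c i) * ENNReal.ofReal (orliczPrimitive n (a i)) ≤
      ∑' k, ENNReal.ofReal (d k) * ENNReal.ofReal (orliczPrimitive n (b k)) := by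
  rw [← h.lintegral_familyMeasure (r := q) hp ha, ← h.lintegral_familyMeasure (r := q) hp hb]
  refine lintegral_indicator_Ioi_mono_of_antitoneOn (h.continuousOn_div_rpow _)
    (fun s hs => div_nonneg (h.pos s hs).le (Real.rpow_nonneg (le_of_lt hs) _)) h.anti
    fun u => ?_
  rcases le_or_gt u 0 with hu | hu
  · simp [Ioo_eq_empty (not_lt.2 hu)]
  rw [familyMeasure_Ioo hq ha hu.le, familyMeasure_Ioo hq hb hu.le]
  gcongr
  exact H u hu

end IsPowerDensity

end MeasureComparison

/-! ### Spectral projections and pinching inequalities -/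

section Projections

variable {H : Type*} [NormedAddCommGroup H] [InnerProductSpace ℂ H]

lemma HilbertBasis.ext_clm {ι : Type*} (e : HilbertBasis ι ℂ H) {A B : H →L[ℂ] H}
    (h : ∀ i, A (e i) = B (e i)) : A = B := by
  refine ContinuousLinearMap.ext_on (s := range e) ?_ ?_
  · rw [Submodule.dense_iff_topologicalClosure_eq_top]
    exact e.dense_span
  · rintro _ ⟨i, rfl⟩
    exact h i

variable [CompleteSpace H]

/-- The orthogonal projection onto the closed span of the basis vectors with index in `J`. -/
noncomputable def HilbertBasis.spanProjection {ι : Type*} (e : HilbertBasis ι ℂ H) (J : Set ι) :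
    H →L[ℂ] H :=
  (Submodule.span ℂ (e '' J)).topologicalClosure.starProjection

lemma HilbertBasis.isStarProjection_spanProjection {ι : Type*} (e : HilbertBasis ι ℂ H)
    (J : Set ι) : IsStarProjection (e.spanProjection J) := isStarProjection_starProjection

lemma HilbertBasis.spanProjection_apply_of_mem {ι : Type*} (e : HilbertBasis ι ℂ H) {J : Set ι}
    {i : ι} (hi : i ∈ J) : e.spanProjection J (e i) = e i :=
  Submodule.starProjection_eq_self_iff.2
    (Submodule.le_topologicalClosure _ (Submodule.subset_span (mem_image_of_mem e hi)))

lemma HilbertBasis.spanProjection_apply_of_notMem {ι : Type*} (e : HilbertBasis ι ℂ H) {J : Set ι}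
    {i : ι} (hi : i ∉ J) : e.spanProjection J (e i) = 0 := by
  refine (Submodule.starProjection_apply_eq_zero_iff _).2 ?_
  rw [Submodule.orthogonal_closure]
  have hle : Submodule.span ℂ (e '' J) ≤ (Submodule.span ℂ {e i})ᗮ := by
    rw [Submodule.span_le]
    rintro _ ⟨j, hj, rfl⟩
    exact Submodule.mem_orthogonal_singleton_iff_inner_right.2
      (e.orthonormal.2 fun h => hi (h ▸ hj))
  exact fun v hv => inner_eq_zero_symm.1
    (Submodule.mem_orthogonal_singleton_iff_inner_left.1 (hle hv) |> inner_eq_zero_symm.1)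

lemma IsStarProjection.norm_apply_le {P : H →L[ℂ] H} (hP : IsStarProjection P) (v : H) :
    ‖P v‖ ≤ ‖v‖ := (P.le_of_opNorm_le hP.norm_le v).trans_eq (one_mul _)

lemma IsStarProjection.inner_apply {P : H →L[ℂ] H} (hP : IsStarProjection P) (v w : H) :
    ⟪P v, w⟫_ℂ = ⟪v, P w⟫_ℂ := hP.isSelfAdjoint.isSymmetric v w

lemma IsStarProjection.norm_sq_apply {P : H →L[ℂ] H} (hP : IsStarProjection P) (v : H) :
    ‖P v‖ ^ 2 = RCLike.re ⟪v, P v⟫_ℂ := by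
  rw [← hP.isIdempotentElem.eq, mul_apply_eq_comp, ← hP.inner_apply, ← mul_apply_eq_comp,
    hP.isIdempotentElem.eq, inner_self_eq_norm_sq]

/-- If `A Q = A`, the range of `star A * A` lies in that of `Q`, and `e i` is in that range when `s
i ≠ 0`. -/
lemma IsSingularBasis.apply_eq_of_mul_eq {ι : Type*} {A Q : H →L[ℂ] H} {e : HilbertBasis ι ℂ H}
    {s : ι → ℝ} (h : IsSingularBasis A e s) (hQ : IsStarProjection Q) (hAQ : A * Q = A) {i : ι}
    (hi : s i ≠ 0) : Q (e i) = e i := by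
  have h1 : Q ((star A * A) (e i)) = (star A * A) (e i) := by
    have h2 : Q * star A = star A := by
      have := congrArg star hAQ
      rwa [star_mul, hQ.isSelfAdjoint.star_eq] at this
    rw [← mul_apply_eq_comp, ← mul_assoc, h2]
  rw [h.apply, map_smul] at h1
  have h3 : ((s i ^ 2 : ℝ) : ℂ) ≠ 0 := by exact_mod_cast pow_ne_zero 2 hi
  exact smul_right_injective H h3 h1

lemma IsSingularBasis.norm_apply_le {ι : Type*} {A : H →L[ℂ] H} {e : HilbertBasis ι ℂ H}
    {s : ι → ℝ} (h : IsSingularBasis A e s) {c : ℝ} (hc : 0 ≤ c) (hs : ∀ i, s i ≤ c) (v : H) :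
    ‖A v‖ ≤ c * ‖v‖ := by
  have hle : ‖A v‖ ^ 2 ≤ c ^ 2 * ‖v‖ ^ 2 := by
    refine hasSum_le (fun i => ?_) (h.hasSum_norm_sq v) ((e.hasSum_norm_sq v).mul_left _)
    have := h.nonneg i
    gcongr
    exact hs i
  rw [← mul_pow] at hle
  exact (sq_le_sq₀ (norm_nonneg _) (mul_nonneg hc (norm_nonneg v))).1 hle

lemma IsSingularBasis.mul_spanProjection {ι : Type*} {A : H →L[ℂ] H} {e : HilbertBasis ι ℂ H}
    {s : ι → ℝ} (h : IsSingularBasis A e s) (J : Set ι)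
    [DecidablePred (· ∈ J)] :
    IsSingularBasis (A * e.spanProjection J) e (fun i => if i ∈ J then s i else 0) where
  nonneg i := by
    split_ifs
    exacts [h.nonneg i, le_rfl]
  apply i := by
    rw [star_mul, (e.isStarProjection_spanProjection J).isSelfAdjoint.star_eq, mul_assoc,
      ← mul_assoc (star A), mul_apply_eq_comp, mul_apply_eq_comp]
    split_ifs with hi
    · rw [e.spanProjection_apply_of_mem hi, h.apply, map_smul, e.spanProjection_apply_of_mem hi]
    · simp [e.spanProjection_apply_of_notMem hi]

lemma HilbertBasis.spanProjection_add_compl {ι : Type*} (e : HilbertBasis ι ℂ H) (J : Set ι) :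
    e.spanProjection J + e.spanProjection Jᶜ = 1 := by
  refine e.ext_clm fun i => ?_
  by_cases hi : i ∈ J
  · have hi' : i ∉ Jᶜ := fun h => h hi
    simp [e.spanProjection_apply_of_mem hi, e.spanProjection_apply_of_notMem hi']
  · have hi' : i ∈ Jᶜ := hi
    simp [e.spanProjection_apply_of_notMem hi, e.spanProjection_apply_of_mem hi']

lemma HilbertBasis.spanProjection_apply_eq_zero {ι : Type*} (e : HilbertBasis ι ℂ H) {J : Set ι}
    {v : H} (hv : v ∈ (Submodule.span ℂ (e '' J))ᗮ) : e.spanProjection J v = 0 := by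
  refine (Submodule.starProjection_apply_eq_zero_iff _).2 ?_
  rwa [Submodule.orthogonal_closure]

variable {n : ℕ} {P : Fin n → H →L[ℂ] H} (hP : ∀ k, IsStarProjection (P k))
  (hPo : ∀ j k, j ≠ k → P j * P k = 0)
include hP hPo

lemma sum_mul_of_orthogonal (k : Fin n) : (∑ j, P j) * P k = P k := by
  rw [Finset.sum_mul, Fintype.sum_eq_single k fun j hj => hPo j k hj, (hP k).isIdempotentElem.eq]

lemma isStarProjection_sum : IsStarProjection (∑ k, P k) where
  isIdempotentElem := by
    rw [IsIdempotentElem, Finset.mul_sum]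
    exact Finset.sum_congr rfl fun k _ => sum_mul_of_orthogonal hP hPo k
  isSelfAdjoint := by
    rw [IsSelfAdjoint, star_sum]
    exact Finset.sum_congr rfl fun k _ => (hP k).isSelfAdjoint

lemma sum_norm_sq_apply (v : H) : ∑ k, ‖P k v‖ ^ 2 = ‖(∑ k, P k) v‖ ^ 2 := by
  rw [(isStarProjection_sum hP hPo).norm_sq_apply, sum_apply, inner_sum, map_sum]
  exact Finset.sum_congr rfl fun k _ => (hP k).norm_sq_apply v

lemma sum_norm_sq_apply_le (v : H) : ∑ k, ‖P k v‖ ^ 2 ≤ ‖v‖ ^ 2 := by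
  rw [sum_norm_sq_apply hP hPo]
  gcongr
  exact (isStarProjection_sum hP hPo).norm_apply_le v

variable {ι : Type*} {κ : Fin n → Type*} {S : H →L[ℂ] H} {e : HilbertBasis ι ℂ H} {s : ι → ℝ}
  {f : ∀ k, HilbertBasis (κ k) ℂ H} {t : ∀ k, κ k → ℝ}

/-- Here `t k j ^ 2 = ∑ i, ‖⟪e i, P k (f k j)⟫‖ ^ 2 * s i ^ 2` with weights of total mass at most
one, and `x ↦ x ^ (q / 2)` is convex. Summed over `j` and `k`, the weight of `s i ^ q` is `∑ k, ‖P k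
(e i)‖ ^ 2 ≤ 1`. -/
lemma tsum_rpow_pinching_le {q : ℝ} (hq : 2 ≤ q) (hS : IsSingularBasis S e s)
    (hf : ∀ k, IsSingularBasis (S * P k) (f k) (t k)) :
    ∑ k, ∑' j, ENNReal.ofReal (t k j ^ q) ≤ ∑' i, ENNReal.ofReal (s i ^ q) := by
  have hq2 : 0 < q / 2 := by linarith
  have hpow : ∀ x : ℝ, 0 ≤ x → (x ^ 2) ^ (q / 2) = x ^ q := fun x hx => by
    rw [← Real.rpow_natCast x 2, ← Real.rpow_mul hx]; congr 1; push_cast; ring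
  have hjensen : ∀ k j, ENNReal.ofReal (t k j ^ q) ≤
      ∑' i, ENNReal.ofReal (‖⟪e i, P k (f k j)⟫_ℂ‖ ^ 2) * ENNReal.ofReal (s i ^ q) := fun k j => by
    have hsum := hS.hasSum_norm_sq (P k (f k j))
    rw [← mul_apply_eq_comp, (hf k).norm_apply] at hsum
    simp only [mul_comm (s _ ^ 2)] at hsum
    have := (convexOn_rpow (p := q / 2) (by linarith)).ofReal_map_le_tsum
      (Real.zero_rpow hq2.ne') (fun x hx => Real.rpow_nonneg hx _)
      (Real.continuous_rpow_const hq2.le).continuousOn (fun i => by positivity)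
      (w := fun i => ‖⟪e i, P k (f k j)⟫_ℂ‖ ^ 2) (by
        rw [e.tsum_ofReal_norm_sq, ENNReal.ofReal_le_one]
        refine pow_le_one₀ (norm_nonneg _) (((hP k).norm_apply_le _).trans_eq ?_)
        exact (f k).orthonormal.1 j) (fun i => sq_nonneg (s i)) hsum
    simpa only [hpow _ (hS.nonneg _), hpow _ ((hf k).nonneg _)] using this
  calc _ ≤ ∑ k, ∑' j, ∑' i, ENNReal.ofReal (‖⟪e i, P k (f k j)⟫_ℂ‖ ^ 2) *
        ENNReal.ofReal (s i ^ q) :=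
        Finset.sum_le_sum fun k _ => ENNReal.tsum_le_tsum fun j => hjensen k j
    _ = ∑ k, ∑' i, ENNReal.ofReal (‖P k (e i)‖ ^ 2) * ENNReal.ofReal (s i ^ q) := by
        refine Finset.sum_congr rfl fun k _ => ?_
        rw [ENNReal.tsum_comm]
        refine tsum_congr fun i => ?_
        simp only [← (hP k).inner_apply]
        rw [ENNReal.tsum_mul_right, (f k).tsum_ofReal_norm_sq_symm]
    _ = ∑' i, (∑ k, ENNReal.ofReal (‖P k (e i)‖ ^ 2)) * ENNReal.ofReal (s i ^ q) := by
        rw [← Summable.tsum_finsetSum fun _ _ => ENNReal.summable]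
        simp only [Finset.sum_mul]
    _ ≤ _ := by
        refine ENNReal.tsum_le_tsum fun i => mul_le_of_le_one_left' ?_
        rw [← ENNReal.ofReal_sum_of_nonneg fun k _ => by positivity, ENNReal.ofReal_le_one]
        refine (sum_norm_sq_apply_le hP hPo (e i)).trans_eq ?_
        rw [e.orthonormal.1 i, one_pow]

/-- Now `x ↦ x ^ (p / 2)` is concave and Jensen is reversed. The total weight of `s i ^ p` must
equal one, which holds for `s i ≠ 0` because `S * ∑ k, P k = S`. -/
lemma tsum_rpow_le_pinching {p : ℝ} (hp : 0 < p) (hp2 : p ≤ 2) (hS : IsSingularBasis S e s)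
    (hf : ∀ k, IsSingularBasis (S * P k) (f k) (t k)) (hSP : S * ∑ k, P k = S) :
    ∑' i, ENNReal.ofReal (s i ^ p) ≤ ∑ k, ∑' j, ENNReal.ofReal (t k j ^ p) := by
  have hp2' : 0 < p / 2 := by linarith
  have hpow : ∀ x : ℝ, 0 ≤ x → (x ^ 2) ^ (p / 2) = x ^ p := fun x hx => by
    rw [← Real.rpow_natCast x 2, ← Real.rpow_mul hx]; congr 1; push_cast; ring
  have hQ := isStarProjection_sum hP hPo
  have hone : ∀ i, s i ≠ 0 → ‖(∑ k, P k) (e i)‖ = 1 := fun i hi => by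
    rw [hS.apply_eq_of_mul_eq hQ hSP hi, e.orthonormal.1 i]
  have hjensen : ∀ k j, ∑' i, ENNReal.ofReal (‖⟪e i, P k (f k j)⟫_ℂ‖ ^ 2) *
      ENNReal.ofReal (s i ^ p) ≤ ENNReal.ofReal (t k j ^ p) := fun k j => by
    have hsum := hS.hasSum_norm_sq (P k (f k j))
    rw [← mul_apply_eq_comp, (hf k).norm_apply] at hsum
    simp only [mul_comm (s _ ^ 2)] at hsum
    have := (Real.concaveOn_rpow (p := p / 2) (by linarith) (by linarith)).tsum_le_ofReal_map
      (Real.zero_rpow hp2'.ne') (fun x hx => Real.rpow_nonneg hx _)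
      (fun x hx y _ hxy => Real.rpow_le_rpow hx hxy hp2'.le) (fun i => by positivity)
      (w := fun i => ‖⟪e i, P k (f k j)⟫_ℂ‖ ^ 2) (by
        rw [e.tsum_ofReal_norm_sq, ENNReal.ofReal_le_one]
        refine pow_le_one₀ (norm_nonneg _) (((hP k).norm_apply_le _).trans_eq ?_)
        exact (f k).orthonormal.1 j) (fun i => sq_nonneg (s i)) hsum
    simpa only [hpow _ (hS.nonneg _), hpow _ ((hf k).nonneg _)] using this
  calc _ ≤ ∑' i, (∑ k, ENNReal.ofReal (‖P k (e i)‖ ^ 2)) * ENNReal.ofReal (s i ^ p) := by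
        refine ENNReal.tsum_le_tsum fun i => ?_
        by_cases hi : s i = 0
        · rw [hi, Real.zero_rpow hp.ne']; simp
        rw [← ENNReal.ofReal_sum_of_nonneg fun k _ => by positivity, sum_norm_sq_apply hP hPo,
          hone i hi]
        simp
    _ = ∑ k, ∑' i, ENNReal.ofReal (‖P k (e i)‖ ^ 2) * ENNReal.ofReal (s i ^ p) := by
        rw [← Summable.tsum_finsetSum fun _ _ => ENNReal.summable]
        simp only [Finset.sum_mul]
    _ = ∑ k, ∑' j, ∑' i, ENNReal.ofReal (‖⟪e i, P k (f k j)⟫_ℂ‖ ^ 2) *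
        ENNReal.ofReal (s i ^ p) := by
        refine Finset.sum_congr rfl fun k _ => ?_
        rw [ENNReal.tsum_comm]
        refine tsum_congr fun i => ?_
        simp only [← (hP k).inner_apply]
        rw [ENNReal.tsum_mul_right, (f k).tsum_ofReal_norm_sq_symm]
    _ ≤ _ := Finset.sum_le_sum fun k _ => ENNReal.tsum_le_tsum fun j => hjensen k j

end Projections

/-! ### Truncated power sums of compressions -/

section Truncation

universe u

variable {H : Type u} [NormedAddCommGroup H] [InnerProductSpace ℂ H] [CompleteSpace H]
variable {n : ℕ} {P : Fin n → H →L[ℂ] H} {S : H →L[ℂ] H} {l : Fin n → ℝ} {L u : ℝ}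

lemma IsSingularBasis.tsum_rpow_singularValue {ι : Type*} {A : H →L[ℂ] H} {e : HilbertBasis ι ℂ H}
    {s : ι → ℝ} (h : IsSingularBasis A e s) {r : ℝ} (hr : 0 < r) :
    ∑' j, ENNReal.ofReal (singularValue A j ^ r) = ∑' i, ENNReal.ofReal (s i ^ r) :=
  h.tsum_singularValue (F := fun x => x ^ r) (Real.zero_rpow hr.ne')
    (fun _ hx _ _ hxy => Real.rpow_le_rpow hx hxy hr.le)
    (Real.continuous_rpow_const hr.le).continuousOn

lemma sum_tsum_rpow_singularValue_le {q : ℝ} (hq : 2 ≤ q) (hP : ∀ k, IsStarProjection (P k))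
    (hPo : ∀ j k, j ≠ k → P j * P k = 0) (hS : IsCompactOperator S) :
    ∑ k, ∑' j, ENNReal.ofReal (singularValue (S * P k) j ^ q) ≤
      ∑' j, ENNReal.ofReal (singularValue S j ^ q) := by
  have hq0 : 0 < q := by linarith
  obtain ⟨ι, e, s, hs⟩ := exists_isSingularBasis hS
  choose κ f t hf using fun k => exists_isSingularBasis (A := S * P k) (hS.comp_clm (P k))
  rw [hs.tsum_rpow_singularValue hq0]
  refine le_trans (le_of_eq ?_) (tsum_rpow_pinching_le hP hPo hq hs hf)
  exact Finset.sum_congr rfl fun k _ => (hf k).tsum_rpow_singularValue hq0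

/-- Vectors orthogonal to `Q (span e J)` are mapped by `Q` into the complement of `span e J`, where
the projection is invisible; this excludes at most `J.card` dimensions. -/
lemma singularValue_mul_add_card_le {ι : Type*} {e : HilbertBasis ι ℂ H} (J : Finset ι)
    {Q : H →L[ℂ] H} (hQ : IsStarProjection Q) (j : ℕ) :
    singularValue (S * Q) (j + J.card) ≤
      singularValue (S * e.spanProjection ((J : Set ι)ᶜ) * Q) j := by
  classical
  have himg : (e '' (J : Set ι)) = ((J.image e : Finset H) : Set H) := by simp
  have hfd : FiniteDimensional ℂ (Submodule.span ℂ (e '' (J : Set ι))) := by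
    rw [himg]; infer_instance
  have hrank : Module.finrank ℂ (Submodule.span ℂ (e '' (J : Set ι))) ≤ J.card := by
    rw [himg]
    exact (finrank_span_finset_le_card _).trans Finset.card_image_le
  have := singularValue_add_le (A := S * Q) (A' := S * e.spanProjection ((J : Set ι)ᶜ) * Q)
    ((Submodule.span ℂ (e '' (J : Set ι))).map (Q : H →ₗ[ℂ] H))
    ((Submodule.finrank_map_le _ _).trans hrank) le_rfl (fun v hv => ?_) j
  · simpa using this
  · have h0 : e.spanProjection (J : Set ι) (Q v) = 0 := by
      refine e.spanProjection_apply_eq_zero fun x hx => ?_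
      rw [← hQ.inner_apply]
      exact hv _ (Submodule.mem_map_of_mem hx)
    have h1 : e.spanProjection ((J : Set ι)ᶜ) (Q v) = Q v := by
      have := congrArg (fun T : H →L[ℂ] H => T (Q v)) (e.spanProjection_add_compl (J : Set ι))
      simpa [h0] using this
    rw [zero_mul, add_zero, mul_apply_eq_comp, mul_apply_eq_comp, mul_apply_eq_comp, h1]

/-- Let `J` index the finitely many `s i > u * L`, and let `S'` be `S` with these removed. For each
`k` the first `J.card` terms are at most `u ^ q`; the later ones are controlled by `S' P k`, for
which pinching applies. As the weights sum to at most one, the total is at most `J.card * u ^ q + L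
^ (-q) * ∑ s i ^ q` over `i ∉ J`, which is the right-hand side. -/
lemma tsum_truncation_le {q : ℝ} (hq : 2 ≤ q) (hP : ∀ k, IsStarProjection (P k))
    (hPo : ∀ j k, j ≠ k → P j * P k = 0)
    (hS : ∀ e : ℝ, 0 < e → ∃ k, singularValue S k < e) (hl : ∀ k, 0 ≤ l k) (hL : 0 < L)
    (h : ∑ k, (l k / L) ^ q ≤ 1) (hu : 0 < u) :
    ∑ k, ∑' j, ENNReal.ofReal ((l k / L) ^ q) *
        ENNReal.ofReal (min (singularValue (S * P k) j / l k) u ^ q) ≤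
      ∑' i, ENNReal.ofReal (min (singularValue S i / L) u ^ q) := by
  classical
  have hq0 : 0 < q := by linarith
  have hθ : ∀ k, 0 ≤ (l k / L) ^ q := fun k => Real.rpow_nonneg (div_nonneg (hl k) hL.le) _
  have hSc := isCompactOperator_of_singularValue_lt hS
  obtain ⟨ι, e, s, hs⟩ := exists_isSingularBasis hSc
  have hfin : {i | u * L < s i}.Finite := by
    rw [← encard_lt_top_iff, ← hs.encard_singularValue (by positivity), encard_lt_top_iff]
    obtain ⟨k, hk⟩ := hS (u * L) (by positivity)
    refine (Finset.range k).finite_toSet.subset fun j hj => ?_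
    rw [Finset.coe_range, mem_Iio]
    by_contra! hkj
    exact absurd (hk.trans hj) (not_lt.2 (singularValue_antitone S hkj))
  set J := hfin.toFinset
  have hJ : ∀ i, i ∈ J ↔ u * L < s i := fun i => by simp [J]
  set S' := S * e.spanProjection ((J : Set ι)ᶜ)
  have hs' : IsSingularBasis S' e fun i => if i ∈ (J : Set ι)ᶜ then s i else 0 :=
    hs.mul_spanProjection _
  have hS'c : IsCompactOperator S' := hSc.comp_clm _
  have hblock : ∀ k, ∑' j, ENNReal.ofReal ((l k / L) ^ q) *
      ENNReal.ofReal (min (singularValue (S * P k) j / l k) u ^ q) ≤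
      ENNReal.ofReal ((l k / L) ^ q) * (J.card * ENNReal.ofReal (u ^ q)) +
        ENNReal.ofReal ((1 / L) ^ q) * ∑' j, ENNReal.ofReal (singularValue (S' * P k) j ^ q) := by
    intro k
    rw [← Summable.sum_add_tsum_nat_add' (k := J.card) ENNReal.summable, ← ENNReal.tsum_mul_left]
    refine add_le_add ?_ (ENNReal.tsum_le_tsum fun j => ?_)
    · rw [← Finset.mul_sum]
      gcongr
      refine (Finset.sum_le_card_nsmul _ _ (ENNReal.ofReal (u ^ q)) fun j _ =>
        ENNReal.ofReal_le_ofReal ?_).trans_eq (by simp)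
      exact Real.rpow_le_rpow (le_min (div_nonneg (singularValue_nonneg _ _) (hl k)) hu.le)
        (min_le_right _ _) hq0.le
    · rw [← ENNReal.ofReal_mul (hθ k), ← ENNReal.ofReal_mul (by positivity)]
      refine ENNReal.ofReal_le_ofReal ?_
      have h1 := singularValue_nonneg (S * P k) (j + J.card)
      have h2 := singularValue_mul_add_card_le (S := S) (e := e) J (hP k) j
      rw [← Real.mul_rpow (div_nonneg (hl k) hL.le)
        (le_min (div_nonneg h1 (hl k)) hu.le),
        ← Real.mul_rpow (by positivity) (singularValue_nonneg _ _)]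
      have h3 := div_nonneg h1 (hl k)
      have h4 := hl k
      refine Real.rpow_le_rpow (by positivity) ?_ hq0.le
      rcases h4.eq_or_lt with h0 | h0
      · rw [← h0, zero_div, zero_mul]
        exact mul_nonneg (by positivity) (singularValue_nonneg _ _)
      · calc l k / L * min (singularValue (S * P k) (j + J.card) / l k) u
            ≤ l k / L * (singularValue (S * P k) (j + J.card) / l k) := by
              gcongr; exact min_le_left _ _
          _ = 1 / L * singularValue (S * P k) (j + J.card) := by field_simp
          _ ≤ _ := by gcongr
  refine (Finset.sum_le_sum fun k _ => hblock k).trans ?_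
  rw [Finset.sum_add_distrib, ← Finset.sum_mul, ← Finset.mul_sum]
  have hF : MonotoneOn (fun x : ℝ => min (x / L) u ^ q) (Ici 0) := fun x hx y hy hxy => by
    have hx : 0 ≤ x := hx
    exact Real.rpow_le_rpow (by positivity) (by gcongr) hq0.le
  have hFc : ContinuousOn (fun x : ℝ => min (x / L) u ^ q) (Ici 0) := by
    refine Continuous.continuousOn ?_
    exact (((continuous_id.div_const L).min continuous_const).rpow_const fun _ => Or.inr hq0.le)
  rw [hs.tsum_singularValue (F := fun x => min (x / L) u ^ q)
    (by rw [zero_div, min_eq_left hu.le, Real.zero_rpow hq0.ne']) hF hFc]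
  calc _ ≤ 1 * (J.card * ENNReal.ofReal (u ^ q)) + ENNReal.ofReal ((1 / L) ^ q) *
        ∑' i, ENNReal.ofReal ((if i ∈ (J : Set ι)ᶜ then s i else 0) ^ q) := by
        gcongr
        · rw [← ENNReal.ofReal_sum_of_nonneg fun k _ => hθ k]
          exact ENNReal.ofReal_le_one.2 h
        · refine (sum_tsum_rpow_singularValue_le hq hP hPo hS'c).trans_eq ?_
          exact hs'.tsum_rpow_singularValue hq0
    _ = ∑' i, ((if i ∈ J then ENNReal.ofReal (u ^ q) else 0) + ENNReal.ofReal ((1 / L) ^ q) *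
        ENNReal.ofReal ((if i ∈ (J : Set ι)ᶜ then s i else 0) ^ q)) := by
        rw [ENNReal.tsum_add, ENNReal.tsum_mul_left, one_mul,
          tsum_eq_sum (s := J) fun i hi => if_neg hi, Finset.sum_ite_mem, Finset.inter_self,
          Finset.sum_const, nsmul_eq_mul]
    _ ≤ _ := by
        refine ENNReal.tsum_le_tsum fun i => ?_
        have hsi := hs.nonneg i
        by_cases hi : i ∈ J
        · have hi' : i ∉ (J : Set ι)ᶜ := fun h => h hi
          rw [if_pos hi, if_neg hi', Real.zero_rpow hq0.ne', ENNReal.ofReal_zero, mul_zero, add_zero,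
            min_eq_right ((le_div_iff₀ hL).2 ((hJ i).1 hi).le)]
        · have hi' : i ∈ (J : Set ι)ᶜ := hi
          rw [if_neg hi, if_pos hi', zero_add, ← ENNReal.ofReal_mul (by positivity),
            ← Real.mul_rpow (by positivity) hsi, one_div_mul_eq_div,
            min_eq_left ((div_le_iff₀ hL).2 (not_lt.1 (mt (hJ i).2 hi)))]

end Truncation

/-! ### Excess power sums of compressions -/

section Excess

universe u

variable {H : Type u} [NormedAddCommGroup H] [InnerProductSpace ℂ H] [CompleteSpace H]
variable {n : ℕ} {P : Fin n → H →L[ℂ] H} {S : H →L[ℂ] H} {l : Fin n → ℝ} {L u : ℝ}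

lemma sum_sq_le_of_sum_rpow_le {p : ℝ} (hp : 0 < p) (hp2 : p ≤ 2) (hl : ∀ k, 0 < l k) (hL : 0 < L)
    (h : ∑ k, (l k / L) ^ p ≤ 1) : ∑ k, l k ^ 2 ≤ L ^ 2 := by
  have h0 : ∀ k, 0 < l k / L := fun k => div_pos (hl k) hL
  have h1 : ∀ k, (l k / L) ^ 2 ≤ (l k / L) ^ p := fun k => by
    have hle : (l k / L) ^ p ≤ 1 := (Finset.single_le_sum
      (fun j _ => Real.rpow_nonneg (h0 j).le p) (Finset.mem_univ k)).trans h
    have hle1 : l k / L ≤ 1 := by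
      by_contra! hlt
      exact absurd (Real.one_lt_rpow hlt hp) (not_lt.2 hle)
    rw [← Real.rpow_natCast]
    exact Real.rpow_le_rpow_of_exponent_ge (h0 k) hle1 (by exact_mod_cast hp2)
  have h2 : ∑ k, (l k / L) ^ 2 ≤ 1 := (Finset.sum_le_sum fun k _ => h1 k).trans h
  simp only [div_pow] at h2
  rwa [← Finset.sum_div, div_le_one (by positivity)] at h2

/-- Cauchy–Schwarz together with `∑ ‖P k v‖ ^ 2 ≤ ‖v‖ ^ 2`. -/
lemma norm_sum_mul_le (hP : ∀ k, IsStarProjection (P k)) (hPo : ∀ j k, j ≠ k → P j * P k = 0)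
    {A : Fin n → H →L[ℂ] H} (hl : ∀ k, 0 ≤ l k) (hL : 0 ≤ L) (h : ∑ k, l k ^ 2 ≤ L ^ 2)
    (hA : ∀ k v, ‖A k v‖ ≤ l k * ‖P k v‖) (v : H) : ‖(∑ k, A k) v‖ ≤ L * ‖v‖ := by
  have h1 : ‖(∑ k, A k) v‖ ≤ ∑ k, l k * ‖P k v‖ := by
    rw [sum_apply]
    exact (norm_sum_le _ _).trans (Finset.sum_le_sum fun k _ => hA k v)
  have h2 : (∑ k, l k * ‖P k v‖) ^ 2 ≤ (L * ‖v‖) ^ 2 := by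
    refine (Finset.sum_mul_sq_le_sq_mul_sq _ _ _).trans ?_
    rw [mul_pow]
    exact mul_le_mul h (sum_norm_sq_apply_le hP hPo v)
      (Finset.sum_nonneg fun k _ => by positivity) (by positivity)
  exact h1.trans ((sq_le_sq₀ (Finset.sum_nonneg fun k _ => mul_nonneg (hl k) (norm_nonneg _))
    (by positivity)).1 h2)

/-- Cutting off the small singular values of the compressions `S P_k` costs little in operator
norm, and leaves an operator controlled by the large singular values. -/
lemma exists_cutoff {p : ℝ} (hp : 0 < p) (hp2 : p ≤ 2) (hP : ∀ k, IsStarProjection (P k))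
    (hPo : ∀ j k, j ≠ k → P j * P k = 0) (hSP : S * ∑ k, P k = S) (hS : IsCompactOperator S)
    {κ : Fin n → Type*} {f : ∀ k, HilbertBasis (κ k) ℂ H} {t : ∀ k, κ k → ℝ}
    (hf : ∀ k, IsSingularBasis (S * P k) (f k) (t k)) (hl : ∀ k, 0 ≤ l k) (hL : 0 ≤ L)
    (h : ∑ k, l k ^ 2 ≤ L ^ 2) :
    ∃ S' : H →L[ℂ] H, (∀ v, ‖S v‖ ≤ ‖S' v‖ + L * ‖v‖) ∧
      ∑' j, ENNReal.ofReal (singularValue S' j ^ p) ≤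
        ∑ k, ∑' j, ENNReal.ofReal ((if l k < t k j then t k j else 0) ^ p) := by
  classical
  -- `Q k` is the spectral projection of `|S P k|` for singular values above `l k`. It lies under `P
  -- k`, so the `Q k` are again mutually orthogonal.
  set Q : Fin n → H →L[ℂ] H := fun k => (f k).spanProjection {j | l k < t k j}
  have hQ : ∀ k, IsStarProjection (Q k) := fun k => (f k).isStarProjection_spanProjection _
  have hSPP : ∀ k, S * P k * P k = S * P k := fun k => by
    rw [mul_assoc, (hP k).isIdempotentElem.eq]
  have hPQ : ∀ k, P k * Q k = Q k := fun k => by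
    refine (f k).ext_clm fun j => ?_
    rw [mul_apply_eq_comp]
    by_cases hj : j ∈ {j | l k < t k j}
    · have hj' : l k < t k j := hj
      rw [(f k).spanProjection_apply_of_mem hj]
      exact (hf k).apply_eq_of_mul_eq (hP k) (hSPP k) ((hl k).trans_lt hj').ne'
    · rw [(f k).spanProjection_apply_of_notMem hj, map_zero]
  have hQP : ∀ k, Q k * P k = Q k := fun k => by
    have := congrArg star (hPQ k)
    rwa [star_mul, (hP k).isSelfAdjoint.star_eq, (hQ k).isSelfAdjoint.star_eq] at this
  have hQo : ∀ j k, j ≠ k → Q j * Q k = 0 := fun j k hjk => by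
    rw [← hQP j, ← hPQ k, mul_assoc, ← mul_assoc (P j), hPo j k hjk, zero_mul, mul_zero]
  set S' := S * ∑ k, Q k
  have hS'Q : ∀ k, S' * Q k = S * P k * Q k := fun k => by
    rw [mul_assoc, sum_mul_of_orthogonal hQ hQo, mul_assoc, hPQ]
  have hS'S' : S' * ∑ k, Q k = S' := by
    rw [mul_assoc, (isStarProjection_sum hQ hQo).isIdempotentElem.eq]
  have hcompl : ∀ k, Q k + (f k).spanProjection ({j | l k < t k j}ᶜ) = 1 := fun k =>
    (f k).spanProjection_add_compl _
  refine ⟨S', fun v => ?_, ?_⟩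
  -- What is removed splits into blocks `S P k (1 - Q k) P k`, each of norm at most `l k` and
  -- supported under `P k`.
  · have hdiff : S = S' + ∑ k, S * P k * (f k).spanProjection ({j | l k < t k j}ᶜ) * P k := by
      have h1 : ∀ k, S * P k * (f k).spanProjection ({j | l k < t k j}ᶜ) * P k =
          S * P k - S * Q k := fun k => by
        rw [eq_sub_of_add_eq' (hcompl k), mul_sub, sub_mul, mul_one, hSPP, mul_assoc, mul_assoc S,
          hQP, hPQ]
      simp only [h1]
      rw [Finset.sum_sub_distrib, ← Finset.mul_sum, ← Finset.mul_sum, hSP]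
      simp [S']
    have h2 := norm_sum_mul_le hP hPo
      (A := fun k => S * P k * (f k).spanProjection ({j | l k < t k j}ᶜ) * P k) hl hL h
      (fun k v => ?_) v
    · calc ‖S v‖ = ‖S' v + (∑ k, S * P k * (f k).spanProjection ({j | l k < t k j}ᶜ) * P k) v‖ := by
            conv_lhs => rw [hdiff]
            rfl
        _ ≤ _ := (norm_add_le _ _).trans (by gcongr)
    · rw [mul_apply_eq_comp]
      refine ((hf k).mul_spanProjection _).norm_apply_le (hl k) (fun j => ?_) _
      split_ifs with hj
      · exact not_lt.1 hj
      · exact hl k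
  -- The second claim is pinching with the family `Q k`, since `S' Q k = S P k Q k` carries exactly
  -- the singular values above the threshold.
  · obtain ⟨ι, e, s, hs⟩ := exists_isSingularBasis (A := S') (hS.comp_clm _)
    rw [hs.tsum_rpow_singularValue hp]
    refine tsum_rpow_le_pinching (f := f) hQ hQo hp hp2 hs (fun k => ?_) hS'S'
    rw [hS'Q]
    exact (hf k).mul_spanProjection {j | l k < t k j}

/-- Singular values of `S P k` below `2 u l k` are discarded, an error of operator norm at most `2 u
L`. Where `S` exceeds `4 u L` this is at most half of its singular value, so twice that of `S'`
dominates. On the other side the retained `t k j` have excess at least half of `(t k j / l k) ^ p`.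
-/
lemma tsum_excess_le {p : ℝ} (hp : 1 ≤ p) (hp2 : p ≤ 2) (hP : ∀ k, IsStarProjection (P k))
    (hPo : ∀ j k, j ≠ k → P j * P k = 0) (hSP : S * ∑ k, P k = S) (hS : IsCompactOperator S)
    (hl : ∀ k, 0 < l k) (hL : 0 < L) (h : ∑ k, (l k / L) ^ p ≤ 1) (hu : 0 ≤ u) :
    ∑' j, ENNReal.ofReal ((singularValue S j / (4 * L)) ^ p - u ^ p) ≤
      ∑ k, ∑' j, ENNReal.ofReal ((l k / L) ^ p) *
        ENNReal.ofReal ((singularValue (S * P k) j / l k) ^ p - u ^ p) := by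
  have hp0 : 0 < p := zero_lt_one.trans_le hp
  choose κ f t hf using fun k => exists_isSingularBasis (A := S * P k) (hS.comp_clm (P k))
  have hsq := sum_sq_le_of_sum_rpow_le hp0 hp2 hl hL h
  obtain ⟨S', hle, hsum⟩ := exists_cutoff (l := fun k => 2 * u * l k) (L := 2 * u * L) hp0 hp2 hP hPo
    hSP hS hf (fun k => by have := hl k; positivity) (by positivity) (by
      simp only [mul_pow]
      rw [← Finset.mul_sum]
      gcongr)
  have hterm : ∀ j, ENNReal.ofReal ((singularValue S j / (4 * L)) ^ p - u ^ p) ≤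
      ENNReal.ofReal ((1 / (2 * L)) ^ p) * ENNReal.ofReal (singularValue S' j ^ p) := fun j => by
    have h1 : singularValue S j ≤ singularValue S' j + 2 * u * L := by
      simpa using singularValue_add_le (A := S) (A' := S') ⊥ (r := 0) (by simp) (by positivity)
        (fun v _ => hle v) j
    have h2 := singularValue_nonneg S j
    have h3 := singularValue_nonneg S' j
    rw [← ENNReal.ofReal_mul (by positivity), ← Real.mul_rpow (by positivity) h3]
    refine ENNReal.ofReal_le_ofReal ?_
    rcases le_or_gt (singularValue S j / (4 * L)) u with h4 | h4
    · exact (sub_nonpos.2 (Real.rpow_le_rpow (by positivity) h4 hp0.le)).trans (by positivity)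
    · refine (sub_le_self _ (by positivity)).trans (Real.rpow_le_rpow (by positivity) ?_ hp0.le)
      rw [lt_div_iff₀ (by positivity)] at h4
      rw [div_le_iff₀ (by positivity), show 1 / (2 * L) * singularValue S' j * (4 * L) =
        2 * singularValue S' j by field_simp; ring]
      linarith
  have hterm' : ∀ k j, ENNReal.ofReal ((1 / (2 * L)) ^ p) *
      ENNReal.ofReal ((if 2 * u * l k < t k j then t k j else 0) ^ p) ≤
      ENNReal.ofReal ((l k / L) ^ p) * ENNReal.ofReal ((t k j / l k) ^ p - u ^ p) := fun k j => by
    split_ifs with hj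
    · have hlk := hl k
      have ht := (hf k).nonneg j
      rw [← ENNReal.ofReal_mul (by positivity), ← ENNReal.ofReal_mul (by positivity)]
      refine ENNReal.ofReal_le_ofReal ?_
      -- Because `p ≥ 1`, the factor `2` in the threshold gives `2 ^ (-p) ≤ 1 / 2`; the same bound
      -- absorbs the spare factor in `4 L`.
      have h1 : u ^ p ≤ (1 / 2) * (t k j / l k) ^ p := by
        have h2 : u ≤ 1 / 2 * (t k j / l k) := by
          rw [div_mul_div_comm, le_div_iff₀ (by positivity)]; linarith
        refine (Real.rpow_le_rpow hu h2 hp0.le).trans ?_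
        rw [Real.mul_rpow (by norm_num) (by positivity)]
        gcongr
        simpa using Real.rpow_le_rpow_of_exponent_ge (x := 1 / 2) (by norm_num) (by norm_num) hp
      have h3 : (1 / (2 * L)) ^ p * t k j ^ p ≤ (l k / L) ^ p * (1 / 2 * (t k j / l k) ^ p) := by
        rw [mul_left_comm, ← Real.mul_rpow (by positivity) ht,
          ← Real.mul_rpow (by positivity) (by positivity),
          show 1 / (2 * L) * t k j = 1 / 2 * (l k / L * (t k j / l k)) by field_simp,
          Real.mul_rpow (by norm_num) (by positivity)]
        gcongr
        simpa using Real.rpow_le_rpow_of_exponent_ge (x := 1 / 2) (by norm_num) (by norm_num) hp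
      refine h3.trans ?_
      gcongr
      linarith
    · rw [Real.zero_rpow hp0.ne', ENNReal.ofReal_zero, mul_zero]
      exact zero_le
  calc _ ≤ ∑' j, ENNReal.ofReal ((1 / (2 * L)) ^ p) * ENNReal.ofReal (singularValue S' j ^ p) :=
        ENNReal.tsum_le_tsum hterm
    _ ≤ ENNReal.ofReal ((1 / (2 * L)) ^ p) *
        ∑ k, ∑' j, ENNReal.ofReal ((if 2 * u * l k < t k j then t k j else 0) ^ p) := by
        rw [ENNReal.tsum_mul_left]
        gcongr
    _ ≤ ∑ k, ∑' j, ENNReal.ofReal ((l k / L) ^ p) *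
        ENNReal.ofReal ((t k j / l k) ^ p - u ^ p) := by
        rw [Finset.mul_sum]
        refine Finset.sum_le_sum fun k _ => ?_
        rw [← ENNReal.tsum_mul_left]
        exact ENNReal.tsum_le_tsum (hterm' k)
    _ = _ := by
        refine Finset.sum_congr rfl fun k _ => ?_
        rw [ENNReal.tsum_mul_left, ENNReal.tsum_mul_left]
        congr 1
        have hlk := hl k
        -- Transfer to the eigenbasis needs a function vanishing at `0`, so the positive part is
        -- made explicit; `ENNReal.ofReal` does not see the difference.
        have hmax : ∀ x : ℝ, ENNReal.ofReal (max x 0) = ENNReal.ofReal x := fun x => by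
          rcases le_total x 0 with hx | hx
          · rw [max_eq_right hx, ENNReal.ofReal_zero, ENNReal.ofReal_of_nonpos hx]
          · rw [max_eq_left hx]
        have := (hf k).tsum_singularValue (F := fun x => max ((x / l k) ^ p - u ^ p) 0)
          (by rw [zero_div, Real.zero_rpow hp0.ne']; exact max_eq_right (by simpa using by positivity))
          (fun x hx y _ hxy => by
            have hx : 0 ≤ x := hx
            simp only
            gcongr)
          (((((continuous_id.div_const (l k)).rpow_const fun _ => Or.inr hp0.le).sub
            continuous_const).max continuous_const).continuousOn)
        simp only [hmax] at this
        exact this.symm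

end Excess

/-! ### Upper and lower estimates for left disjoint operators -/

section IdealEstimates

universe u

variable {H : Type u} [NormedAddCommGroup H] [InnerProductSpace ℂ H] [CompleteSpace H]

lemma isStarProjection_rightSupport (x : H →L[ℂ] H) : IsStarProjection (rightSupport x) :=
  isStarProjection_starProjection

lemma mul_rightSupport (x : H →L[ℂ] H) : x * rightSupport x = x := by
  ext v
  have hcl : IsClosed (LinearMap.ker (x : H →ₗ[ℂ] H) : Set H) := x.isClosed_ker
  have hmem : v - rightSupport x v ∈ LinearMap.ker (x : H →ₗ[ℂ] H) := by
    rw [← hcl.submodule_topologicalClosure_eq, ← Submodule.orthogonal_orthogonal_eq_closure]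
    exact Submodule.sub_starProjection_mem_orthogonal _
  have h1 : x (v - rightSupport x v) = 0 := hmem
  rw [map_sub, sub_eq_zero] at h1
  rw [mul_apply_eq_comp, ← h1]

lemma IsStarProjection.rightSupport_eq {Q : H →L[ℂ] H} (hQ : IsStarProjection Q) :
    rightSupport Q = Q := by
  have h1 : rightSupport Q * Q = Q := by
    have := congrArg star (mul_rightSupport Q)
    rwa [star_mul, hQ.isSelfAdjoint.star_eq,
      (isStarProjection_rightSupport Q).isSelfAdjoint.star_eq] at this
  suffices rightSupport Q - rightSupport Q * Q = 0 by rwa [h1, sub_eq_zero] at this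
  ext v
  have hmem : v - Q v ∈ LinearMap.ker (Q : H →ₗ[ℂ] H) := by
    have h2 : Q (Q v) = Q v := by rw [← mul_apply_eq_comp, hQ.isIdempotentElem.eq]
    rw [LinearMap.mem_ker]
    simp [h2]
  have h3 : rightSupport Q (v - Q v) = 0 := Submodule.starProjection_orthogonal_apply_eq_zero hmem
  simpa using h3

variable {n : ℕ} {x : Fin n → H →L[ℂ] H}

/-- Disjointness kills `x j * r (x k) = x j * r (x j) * r (x k)` for `j ≠ k`. Hence each summand is
a compression of the sum, as pinching requires. -/
lemma sum_mul_rightSupport (hx : ∀ j k, j ≠ k → LeftDisjoint (x j) (x k)) (k : Fin n) :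
    (∑ j, x j) * rightSupport (x k) = x k := by
  rw [Finset.sum_mul, Fintype.sum_eq_single k fun j hj => ?_, mul_rightSupport]
  rw [← mul_rightSupport (x j), mul_assoc, hx j k hj, mul_zero]

lemma sum_mul_sum_rightSupport (hx : ∀ j k, j ≠ k → LeftDisjoint (x j) (x k)) :
    (∑ j, x j) * ∑ k, rightSupport (x k) = ∑ j, x j := by
  rw [Finset.mul_sum]
  exact Finset.sum_congr rfl fun k _ => sum_mul_rightSupport hx k

variable {p q : ℝ} {d : ℝ → ℝ} {l : Fin n → ℝ} {L : ℝ}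

lemma modular_sum_le_of_leftDisjoint (hd : IsPowerDensity p q d) (hp : 1 ≤ p) (hp2 : p ≤ 2)
    (hx : ∀ j k, j ≠ k → LeftDisjoint (x j) (x k)) (hc : ∀ k, IsCompactOperator (x k))
    (hl : ∀ k, 0 < l k) (hL : 0 < L) (h : ∑ k, (l k / L) ^ p ≤ 1) :
    modular (orliczPrimitive d) (singularSeq (∑ k, x k)) (4 * L) ≤
      ∑ k, ENNReal.ofReal ((l k / L) ^ p) *
        modular (orliczPrimitive d) (singularSeq (x k)) (l k) := by
  have hexc := fun u (hu : 0 ≤ u) => tsum_excess_le hp hp2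
    (fun k => isStarProjection_rightSupport (x k)) hx (sum_mul_sum_rightSupport hx)
    (isCompactOperator_sum hc) hl hL h hu
  simp only [sum_mul_rightSupport hx] at hexc
  have := hd.tsum_primitive_le_of_excess (ι := ℕ) (κ := Fin n × ℕ) hp (c := fun _ => 1)
    (a := fun j => singularValue (∑ k, x k) j / (4 * L)) (d := fun i => (l i.1 / L) ^ p)
    (b := fun i => singularValue (x i.1) i.2 / l i.1)
    (fun j => div_nonneg (singularValue_nonneg _ _) (by positivity))
    (fun i => div_nonneg (singularValue_nonneg _ _) (hl i.1).le)
    (fun u hu => by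
      simp only [ENNReal.tsum_prod', tsum_fintype, ENNReal.ofReal_one, one_mul]
      exact hexc u hu)
  simp only [ENNReal.tsum_prod', tsum_fintype, ENNReal.ofReal_one, one_mul,
    ENNReal.tsum_mul_left] at this
  simpa only [modular, norm_singularSeq] using this

lemma le_modular_sum_of_leftDisjoint (hd : IsPowerDensity p q d) (hp : 1 ≤ p) (hq : 2 ≤ q)
    (hx : ∀ j k, j ≠ k → LeftDisjoint (x j) (x k))
    (hS : ∀ e : ℝ, 0 < e → ∃ j, singularValue (∑ k, x k) j < e)
    (hl : ∀ k, 0 ≤ l k) (hL : 0 < L) (h : ∑ k, (l k / L) ^ q ≤ 1) :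
    ∑ k, ENNReal.ofReal ((l k / L) ^ q) * modular (orliczPrimitive d) (singularSeq (x k)) (l k) ≤
      modular (orliczPrimitive d) (singularSeq (∑ k, x k)) L := by
  have htr := fun u (hu : 0 < u) => tsum_truncation_le hq
    (fun k => isStarProjection_rightSupport (x k)) hx hS hl hL h hu
  simp only [sum_mul_rightSupport hx] at htr
  have := hd.tsum_primitive_le_of_truncation (ι := Fin n × ℕ) (κ := ℕ) hp (by linarith)
    (c := fun i => (l i.1 / L) ^ q) (a := fun i => singularValue (x i.1) i.2 / l i.1)
    (d := fun _ => 1) (b := fun j => singularValue (∑ k, x k) j / L)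
    (fun i => div_nonneg (singularValue_nonneg _ _) (hl i.1))
    (fun j => div_nonneg (singularValue_nonneg _ _) hL.le)
    (fun u hu => by
      simp only [ENNReal.tsum_prod', tsum_fintype, ENNReal.ofReal_one, one_mul]
      exact htr u hu)
  simp only [ENNReal.tsum_prod', tsum_fintype, ENNReal.ofReal_one, one_mul,
    ENNReal.tsum_mul_left] at this
  simpa only [modular, norm_singularSeq] using this

variable {M : ℝ → ℝ} {D₁ D₂ : ℝ}

lemma IsOrliczModel.sum_of_leftDisjoint (hM : IsOrliczFunction M) (hd : IsPowerDensity p q d)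
    (hp : 1 ≤ p) (hp2 : p ≤ 2) (h : IsOrliczModel M p q (orliczPrimitive d) D₁ D₂)
    (hx : ∀ k, MemOrliczIdeal M (x k)) (hdis : ∀ j k, j ≠ k → LeftDisjoint (x j) (x k)) :
    MemOrliczIdeal M (∑ k, x k) ∧ orliczIdealNorm M (∑ k, x k) ≤
      D₁ * 4 * D₂ * (∑ k, orliczIdealNorm M (x k) ^ p) ^ (1 / p) :=
  norm_le_of_modular_upper hM h.pos_left h.pos_right four_pos hp h.dominates h.dominated hx
    (bddAbove_singularSeq _) fun _ _ hl hL hlL => modular_sum_le_of_leftDisjoint hd hp hp2 hdis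
      (fun k => (hx k).isCompactOperator hM h.pos) hl hL hlL

lemma IsOrliczModel.orliczIdealUpperEstimate (hM : IsOrliczFunction M) (hd : IsPowerDensity p q d)
    (hp : 1 ≤ p) (hp2 : p ≤ 2) (h : IsOrliczModel M p q (orliczPrimitive d) D₁ D₂) :
    OrliczIdealUpperEstimate H M p :=
  ⟨D₁ * 4 * D₂, by have := h.pos_left; have := h.pos_right; positivity,
    fun _ _ hx hdis => h.sum_of_leftDisjoint hM hd hp hp2 hx hdis⟩

lemma IsOrliczModel.orliczIdealLowerEstimate (hM : IsOrliczFunction M) (hd : IsPowerDensity p q d)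
    (hp : 1 ≤ p) (hp2 : p ≤ 2) (hq : 2 ≤ q) (h : IsOrliczModel M p q (orliczPrimitive d) D₁ D₂) :
    OrliczIdealLowerEstimate H M q := by
  refine ⟨4 * D₁ * D₂, by have := h.pos_left; have := h.pos_right; positivity,
    fun n x hx hdis => ?_⟩
  -- Membership of the sum comes from the upper estimate. The lower one presupposes it, since
  -- truncation needs singular values tending to zero.
  have hS := (h.sum_of_leftDisjoint hM hd hp hp2 hx hdis).1
  exact ⟨hS, norm_le_of_modular_lower hM h.orlicz h.pos_left h.pos_right (by linarith) h.dominates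
    h.dominated hS fun l L hl hL hlL => le_modular_sum_of_leftDisjoint hd hp hq hdis
      (fun e he => hS.exists_singularValue_lt hM h.pos he) hl hL hlL⟩

end IdealEstimates

/-! ### Testing the ideal on projections -/

section ProjectionTests

universe u

variable {H : Type u} [NormedAddCommGroup H] [InnerProductSpace ℂ H]
variable {ι : Type*} {e : HilbertBasis ι ℂ H}

lemma HilbertBasis.infinite_of_not_finiteDimensional (e : HilbertBasis ι ℂ H)
    (hH : ¬ FiniteDimensional ℂ H) : Infinite ι := by
  by_contra h
  have : Finite ι := not_infinite_iff_finite.1 h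
  have : Fintype ι := Fintype.ofFinite ι
  exact hH e.toOrthonormalBasis.toBasis.finiteDimensional_of_finite

variable [CompleteSpace H]

lemma HilbertBasis.spanProjection_apply (e : HilbertBasis ι ℂ H) (J : Set ι)
    [DecidablePred (· ∈ J)] (i : ι) :
    e.spanProjection J (e i) = if i ∈ J then e i else 0 := by
  split_ifs with hi
  exacts [e.spanProjection_apply_of_mem hi, e.spanProjection_apply_of_notMem hi]

lemma isSingularBasis_spanProjection (e : HilbertBasis ι ℂ H) (J : Set ι)
    [DecidablePred (· ∈ J)] :
    IsSingularBasis (e.spanProjection J) e fun i => if i ∈ J then 1 else 0 :=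
  .of_isSelfAdjoint (e.isStarProjection_spanProjection J).isSelfAdjoint
    (fun i => by split_ifs <;> norm_num)
    fun i => by rw [e.spanProjection_apply]; split_ifs <;> simp

lemma absRpow_spanProjection (e : HilbertBasis ι ℂ H) (J : Set ι) {s : ℝ} (hs : 0 < s) :
    absRpow s (e.spanProjection J) = e.spanProjection J := by
  classical
  refine e.ext_clm fun i => ?_
  rw [(isSingularBasis_spanProjection e J).absRpow_apply hs.le, e.spanProjection_apply]
  split_ifs <;> simp [Real.zero_rpow hs.ne']

lemma opPowerSum_spanProjection (e : HilbertBasis ι ℂ H) {J : Set ι} {n : ℕ} {I : Fin n → Set ι}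
    (h : ∑ k, e.spanProjection (I k) = e.spanProjection J) {s : ℝ} (hs : 0 < s) :
    opPowerSum s (fun k => e.spanProjection (I k)) = e.spanProjection J := by
  classical
  refine e.ext_clm fun i => ?_
  rw [opPowerSum_apply (a := if i ∈ J then 1 else 0) hs.le, e.spanProjection_apply]
  · have : s⁻¹ ≠ 0 := inv_ne_zero hs.ne'
    split_ifs <;> simp [Real.zero_rpow this]
  · simp only [absRpow_spanProjection e _ hs]
    rw [h, e.spanProjection_apply]
    split_ifs <;> simp

lemma leftDisjoint_spanProjection (e : HilbertBasis ι ℂ H) {I J : Set ι} (h : Disjoint I J) :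
    LeftDisjoint (e.spanProjection I) (e.spanProjection J) := by
  classical
  rw [LeftDisjoint, (e.isStarProjection_spanProjection I).rightSupport_eq,
    (e.isStarProjection_spanProjection J).rightSupport_eq]
  refine e.ext_clm fun i => ?_
  rw [mul_apply_eq_comp, e.spanProjection_apply]
  split_ifs with hi
  · rw [e.spanProjection_apply_of_notMem (disjoint_right.1 h hi)]
    rfl
  · simp

/-- The images of consecutive index blocks under an embedding of `ℕ` into the index type. -/
def embeddedBlock (g : ℕ ↪ ι) (n k : ℕ) : Set ι := ((indexBlock n k).map g : Finset ι)

lemma disjoint_embeddedBlock (g : ℕ ↪ ι) {n j k : ℕ} (hn : 0 < n) (hjk : j ≠ k) :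
    Disjoint (embeddedBlock g n j) (embeddedBlock g n k) := by
  rw [disjoint_left]
  intro i hi hi'
  obtain ⟨a, ha, rfl⟩ := Finset.mem_map.1 (Finset.mem_coe.1 hi)
  have hb : a ∈ indexBlock n k := (Finset.mem_map' g).1 (Finset.mem_coe.1 hi')
  exact hjk (((mem_indexBlock hn).1 ha).symm.trans ((mem_indexBlock hn).1 hb))

lemma sum_spanProjection_embeddedBlock (e : HilbertBasis ι ℂ H) (g : ℕ ↪ ι) {n m : ℕ}
    (hn : 0 < n) : ∑ k : Fin m, e.spanProjection (embeddedBlock g n k) =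
      e.spanProjection (((Finset.range (n * m)).map g : Finset ι) : Set ι) := by
  classical
  refine e.ext_clm fun i => ?_
  rw [sum_apply]
  simp only [embeddedBlock, e.spanProjection_apply, Finset.mem_coe]
  by_cases hi : i ∈ range g
  · obtain ⟨a, rfl⟩ := hi
    simp only [Finset.mem_map']
    exact sum_indexBlock hn (e (g a)) a
  · have h0 : ∀ A : Finset ℕ, i ∉ A.map g := fun A hA => by
      obtain ⟨a, -, ha⟩ := Finset.mem_map.1 hA
      exact hi ⟨a, ha⟩
    simp [h0]

variable {M : ℝ → ℝ} {p q : ℝ}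

lemma modular_spanProjection (hM : IsOrliczFunction M) (e : HilbertBasis ι ℂ H) (J : Finset ι)
    {r : ℝ} (hr : 0 < r) : modular M (singularSeq (e.spanProjection (J : Set ι))) r =
      J.card * ENNReal.ofReal (M (1 / r)) := by
  classical
  rw [(isSingularBasis_spanProjection e (J : Set ι)).modular_singularSeq hM hr,
    ← tsum_ofReal_indicator hM]
  rfl

lemma memOrliczIdeal_spanProjection (hM : IsOrliczFunction M) (e : HilbertBasis ι ℂ H)
    (J : Finset ι) : MemOrliczIdeal M (e.spanProjection (J : Set ι)) :=
  memOrliczSeq_of_modular_eq hM (bddAbove_singularSeq _) fun _ hr => modular_spanProjection hM e J hr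

lemma orliczIdealNorm_spanProjection (hM : IsOrliczFunction M) (e : HilbertBasis ι ℂ H)
    (J : Finset ι) :
    orliczIdealNorm M (e.spanProjection (J : Set ι)) = orliczFundamental M J.card :=
  orliczSeqNorm_eq_fundamental hM fun _ hr => modular_spanProjection hM e J hr

lemma orliczIdealNorm_embeddedBlock (hM : IsOrliczFunction M) (e : HilbertBasis ι ℂ H)
    (g : ℕ ↪ ι) (n k : ℕ) :
    orliczIdealNorm M (e.spanProjection (embeddedBlock g n k)) = orliczFundamental M n := by
  rw [embeddedBlock, orliczIdealNorm_spanProjection hM, Finset.card_map, card_indexBlock]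

lemma orliczIdealNorm_range (hM : IsOrliczFunction M) (e : HilbertBasis ι ℂ H) (g : ℕ ↪ ι) (n : ℕ) :
    orliczIdealNorm M (e.spanProjection (((Finset.range n).map g : Finset ι) : Set ι)) =
      orliczFundamental M n := by
  rw [orliczIdealNorm_spanProjection hM, Finset.card_map, Finset.card_range]

lemma hasFundamentalEstimates_of_idealEstimates (hH : ¬ FiniteDimensional ℂ H)
    (hM : IsOrliczFunction M) (hp : 0 < p) (hq : 0 < q) (h₁ : OrliczIdealUpperEstimate H M p)
    (h₂ : OrliczIdealLowerEstimate H M q) : HasFundamentalEstimates M p q := by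
  obtain ⟨K₁, hK₁, h₁⟩ := h₁
  obtain ⟨K₂, -, h₂⟩ := h₂
  obtain ⟨w, e, -⟩ := exists_hilbertBasis ℂ H
  have := e.infinite_of_not_finiteDimensional hH
  have g := Infinite.natEmbedding w
  refine hasFundamentalEstimates_of_sum (K₂ := K₂) hM hp hq hK₁ fun n m hn _ => ?_
  have hmem : ∀ k : Fin m, MemOrliczIdeal M (e.spanProjection (embeddedBlock g n k)) :=
    fun k => memOrliczIdeal_spanProjection hM e _
  have hdis : ∀ j k : Fin m, j ≠ k → LeftDisjoint (e.spanProjection (embeddedBlock g n j))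
      (e.spanProjection (embeddedBlock g n k)) := fun j k hjk =>
    leftDisjoint_spanProjection e (disjoint_embeddedBlock g hn (Fin.val_ne_of_ne hjk))
  have h3 := (h₁ m _ hmem hdis).2
  have h4 := (h₂ m _ hmem hdis).2
  simp only [sum_spanProjection_embeddedBlock e g hn, orliczIdealNorm_embeddedBlock hM,
    orliczIdealNorm_range hM] at h3 h4
  exact ⟨h3, h4⟩

/-- The test is made directly on projections, without passing through left disjoint families: for
those, the modulus of a sum is not a power sum in general, but for orthogonal projections onto spans
of basis vectors the two agree. -/
lemma hasFundamentalEstimates_of_idealConvexity (hH : ¬ FiniteDimensional ℂ H)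
    (hM : IsOrliczFunction M) (hp : 0 < p) (hq : 0 < q) (h₁ : OrliczIdealPConvex H M p)
    (h₂ : OrliczIdealQConcave H M q) : HasFundamentalEstimates M p q := by
  obtain ⟨K₁, hK₁, h₁⟩ := h₁
  obtain ⟨K₂, -, h₂⟩ := h₂
  obtain ⟨w, e, -⟩ := exists_hilbertBasis ℂ H
  have := e.infinite_of_not_finiteDimensional hH
  have g := Infinite.natEmbedding w
  refine hasFundamentalEstimates_of_sum (K₂ := K₂) hM hp hq hK₁ fun n m hn _ => ?_
  have hmem : ∀ k : Fin m, MemOrliczIdeal M (e.spanProjection (embeddedBlock g n k)) :=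
    fun k => memOrliczIdeal_spanProjection hM e _
  have hsum := sum_spanProjection_embeddedBlock (m := m) e g hn
  have h3 := (h₁ m _ hmem).2
  have h4 := (h₂ m _ hmem).2
  rw [opPowerSum_spanProjection e hsum hp] at h3
  rw [opPowerSum_spanProjection e hsum hq] at h4
  simp only [orliczIdealNorm_embeddedBlock hM, orliczIdealNorm_range hM] at h3 h4
  exact ⟨h3, h4⟩

end ProjectionTests

/-! ### Assembly of the equivalences -/

lemma HasPowerGrowth.exists_isOrliczModel {M : ℝ → ℝ} {p q : ℝ} (hM : IsOrliczFunction M)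
    (hp : 1 ≤ p) (hpq : p ≤ q) (h : HasPowerGrowth M p q) :
    ∃ (d : ℝ → ℝ) (D₁ D₂ : ℝ), IsPowerDensity p q d ∧ EquivOnUnitInterval M (orliczPrimitive d) ∧
      IsOrliczModel M p q (orliczPrimitive d) D₁ D₂ := by
  obtain ⟨d, hd, heq⟩ := h.exists_isPowerDensity hM hp hpq
  have hN := hd.isOrliczFunction hp
  obtain ⟨D₁, D₂, hD₁, hD₂, h₁, h₂⟩ := heq.exists_dominatesModular hM hN
  have hq : 0 < q := by linarith
  refine ⟨d, D₁, D₂, hd, heq, fun t ht => ?_, hN, hd.convexOn_rpow hp, hd.concaveOn_rpow hp hq,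
    hD₁, hD₂, h₁, h₂⟩
  have hmin : 0 < min t 1 := lt_min ht one_pos
  exact (h.1 _ ⟨hmin, min_le_right _ _⟩).trans_le (hM.mono hmin.le (min_le_left _ _))

end OrliczIdeals

theorem mainTheorem9 {H : Type*} [NormedAddCommGroup H] [InnerProductSpace ℂ H] [CompleteSpace H]
    [TopologicalSpace.SeparableSpace H] (hH : ¬ FiniteDimensional ℂ H)
    (p q : ℝ) (hp₁ : 1 ≤ p) (hp₂ : p ≤ 2) (hq : 2 ≤ q)
    (M : ℝ → ℝ) (hM : IsOrliczFunction M) :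
    List.TFAE [
      OrliczIdealPConvex H M p ∧ OrliczIdealQConcave H M q,
      OrliczIdealUpperEstimate H M p ∧ OrliczIdealLowerEstimate H M q,
      OrliczSeqPConvex M p ∧ OrliczSeqQConcave M q,
      OrliczSeqUpperEstimate M p ∧ OrliczSeqLowerEstimate M q,
      ∃ N : ℝ → ℝ, IsOrliczFunction N ∧ IsPConvexFunction p N ∧ IsQConcaveFunction q N ∧
        EquivOnUnitInterval M N] := by
  have hp0 : 0 < p := by linarith
  have hq1 : 1 ≤ q := by linarith
  have hq0 : 0 < q := by linarith
  have hpq : p ≤ q := hp₂.trans hq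
  have key : HasFundamentalEstimates M p q → ∃ N : ℝ → ℝ, IsOrliczFunction N ∧
      IsPConvexFunction p N ∧ IsQConcaveFunction q N ∧ EquivOnUnitInterval M N := fun h => by
    obtain ⟨d, D₁, D₂, -, heq, hmod⟩ :=
      (h.hasPowerGrowth hM hp0 hq0).exists_isOrliczModel hM hp₁ hpq
    exact ⟨_, hmod.orlicz, hmod.convex.subset Set.Ioi_subset_Ici_self (convex_Ioi 0),
      hmod.concave.subset Set.Ioi_subset_Ici_self (convex_Ioi 0), heq⟩
  -- Only the power growth of `M` is kept from the given `N`. A new function with a density is built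
  -- from it, because the excess and truncation criteria are stated for primitives of power
  -- densities.
  have model : (∃ N : ℝ → ℝ, IsOrliczFunction N ∧ IsPConvexFunction p N ∧
      IsQConcaveFunction q N ∧ EquivOnUnitInterval M N) →
      ∃ (d : ℝ → ℝ) (D₁ D₂ : ℝ), IsPowerDensity p q d ∧ EquivOnUnitInterval M (orliczPrimitive d) ∧
        IsOrliczModel M p q (orliczPrimitive d) D₁ D₂ := fun ⟨_, hN, hNp, hNq, h⟩ =>
    (hasPowerGrowth_of_equiv hp0 hq0 hN hNp hNq h).exists_isOrliczModel hM hp₁ hpq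
  tfae_have 1 → 5 := fun h => key (hasFundamentalEstimates_of_idealConvexity hH hM hp0 hq0 h.1 h.2)
  tfae_have 2 → 5 := fun h => key (hasFundamentalEstimates_of_idealEstimates hH hM hp0 hq0 h.1 h.2)
  tfae_have 3 → 4 := fun h => ⟨h.1.upperEstimate hp0, h.2.lowerEstimate hq0⟩
  tfae_have 4 → 5 := fun h => key (hasFundamentalEstimates_of_seqEstimates hM hp0 hq0 h.1 h.2)
  tfae_have 5 → 1 := fun h => by
    obtain ⟨d, D₁, D₂, -, -, hmod⟩ := model h
    exact ⟨hmod.orliczIdealPConvex hM hp₁, hmod.orliczIdealQConcave hM hq1⟩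
  tfae_have 5 → 2 := fun h => by
    obtain ⟨d, D₁, D₂, hd, -, hmod⟩ := model h
    exact ⟨hmod.orliczIdealUpperEstimate hM hd hp₁ hp₂,
      hmod.orliczIdealLowerEstimate hM hd hp₁ hp₂ hq⟩
  tfae_have 5 → 3 := fun h => by
    obtain ⟨d, D₁, D₂, -, -, hmod⟩ := model h
    exact ⟨hmod.orliczSeqPConvex hM hp₁, hmod.orliczSeqQConcave hM hq1⟩
  tfae_finish
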